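/- **Setting.** Let $N\ge 2$, $\omega=e^{2\pi i/N}$, and identify the group $\mathbb Z_N$ of $N$-th roots of unity with the centre of $SU(N)$. The braid group $B_k$ acts on the right on the free group $F_k=\langle x_1,\dots,x_k\rangle$ by $x_i^{\sigma_i}=x_{i+1}$, $x_{i+1}^{\sigma_i}=x_{i+1}^{-1}x_ix_{i+1}$, $x_j^{\sigma_i}=x_j$ for $j\ne i,i+1$, and on $\{1,\dots,k\}$ through the permutation $\bar\sigma$. For $\varepsilon\in(\mathbb Z_N)^k$ and $X\in SU(N)^k$ put $(\varepsilon\sigma)(X)_i=\varepsilon_i\,\sigma(X)_i$, where $\sigma(X)_i$ is the value of the word $x_i^\sigma$ at $X$, and let $\operatorname{Fix}(\varepsilon\sigma)\subset SU(N)^k$ be the fixed-point set. If the closure of $\sigma$ has components $\ell_1,\dots,\ell_n$, corresponding to the cycles $I_1,\dots,I_n$ of $\bar\sigma$, then $\varepsilon$ is compatible with labels $a=(a_1,\dots,a_n)$ if $\prod_{i\in I_j}\varepsilon_i=\omega^{a_j}$ for all $j$. A tuple of matrices in $SU(N)$ is irreducible if its entries cannot be simultaneously conjugated in $SU(N)$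 to block diagonal form with two blocks of positive size. Let $C_A\subset SU(N)$ be the conjugacy class of the diagonal matrix $A$ whose entries are the $N$ distinct $N$-th roots of $(-1)^{N-1}$, let $Q_k=(C_A)^k$, let $H_k^*$ be the manifold of irreducible pairs $(X,Y)\in Q_k\times Q_k$ with $X_1\cdots X_k=Y_1\cdots Y_k$, and let $\widehat H_k=H_k^*/PU(N)$ be its quotient by simultaneous conjugation. Let $\widehat\Delta_k,\widehat\Gamma_{\varepsilon\sigma}\subset\widehat H_k$ be the quotients of the irreducible parts of the diagonal $\{(X,X)\}$ and of the graph $\{(X,\varepsilon\sigma(X))\}$. An orientation of $C_A$ and one of $SU(N)$ orient all of these (by product orientations and the base-fibre rule), and $h_{N,a}(\varepsilon\sigma)=\langle\widehat\Delta_k,\widehat\Gamma_{\varepsilon\sigma}\rangle_{\widehat H_k}$ is the oriented intersection number (after a compactly supported isotopy making the intersection transverse, if it is not). For a link $L$ with labels $a$, $h_{N,a}(L)=h_{N,a}(\varepsilon\sigma)$, where $\sigma$ is a braid whose closure is $L$ and $\varepsilon$ is compatible with $a$. **Proposition.** Let $H$ be the Hopf link, i.e. the closure of $\sigma_1^2\in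 B_2$, and let $1\le d<N$ with $\gcd(d,N)=1$. 1. $h_{N,a}(H)=\pm1$ for $a=(d,N-d)$. That is, $h_{N,a}(\varepsilon\sigma)\in\{1,-1\}$ for every braid $\sigma$ (on any number of strands) whose closure is $H$, i.e. which is related to $\sigma_1^2$ by Markov moves, every numbering of the two components and every compatible $\varepsilon$. 2. For $\sigma=\sigma_1^2$ and $\varepsilon=(\omega^{d},\omega^{N-d})$, $$\operatorname{Fix}(\varepsilon\sigma)=\{(X_1,X_2)\in SU(N)^2 : X_1X_2X_1^{-1}X_2^{-1}=\omega^{-d}I\},$$ and for $\varepsilon=(\omega^{N-d},\omega^{d})$, $$\operatorname{Fix}(\varepsilon\sigma)=\{(X_1,X_2)\in SU(N)^2 : X_1X_2X_1^{-1}X_2^{-1}=\omega^{d}I\}.$$ In both cases $\operatorname{Fix}(\varepsilon\sigma)$ is a single (non-empty) conjugacy class under $SU(N)$, and it consists of irreducible pairs. 3. Let $\sigma=\sigma_1^2$, let $\varepsilon$ be one of the two pairs in (2), and let $G_H=\langle x_1,x_2\mid x_i=x_i^{\sigma},\ i=1,2\rangle$ be the link group. Every $(X_1,X_2)\in\operatorname{Fix}(\varepsilon\sigma)$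 is of the form $(\varrho(x_1),\varrho(x_2))$ for a projective representation $\varrho\colon G_H\to SU(N)$ (a function with $\varrho(gh)\varrho(h)^{-1}\varrho(g)^{-1}\in\mathbb Z_N$ for all $g,h$), and for every projective representation $\varrho$ with $(\varrho(x_1),\varrho(x_2))\in\operatorname{Fix}(\varepsilon\sigma)$ one has $H^1(G_H;su(N)_{\operatorname{Ad}\varrho})=0$. -/

import Mathlib

open scoped ContDiff

noncomputable section

namespace CassonLin

/-! ### Braids, their action on free groups, links as closures of braids -/

/-- Indices of the standard generators of the braid group on `k` strands: `i` stands for the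
generator which exchanges the (zero-based) strands `i` and `i + 1`. -/
abbrev Gen (k : ℕ) : Type := {i : ℕ // i + 1 < k}

def Gen.left {k : ℕ} (i : Gen k) : Fin k := ⟨i.1, by have := i.2; omega⟩

def Gen.right {k : ℕ} (i : Gen k) : Fin k := ⟨i.1 + 1, i.2⟩

/-- The braid relations. -/
def braidRels (k : ℕ) : Set (FreeGroup (Gen k)) :=
  {r | ∃ i j : Gen k, i.1 + 1 < j.1 ∧
    r = (FreeGroup.of i * FreeGroup.of j) * (FreeGroup.of j * FreeGroup.of i)⁻¹} ∪
  {r | ∃ i j : Gen k, i.1 + 1 = j.1 ∧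
    r = (FreeGroup.of i * FreeGroup.of j * FreeGroup.of i) *
      (FreeGroup.of j * FreeGroup.of i * FreeGroup.of j)⁻¹}

/-- The braid group on `k` strands. -/
abbrev BraidGroup (k : ℕ) : Type := PresentedGroup (braidRels k)

/-- The `i`-th standard generator. -/
def sig {k : ℕ} (i : Gen k) : BraidGroup k := PresentedGroup.of i

lemma lift_braidRels {k : ℕ} {G : Type*} [Group G] (f : Gen k → G)
    (h₁ : ∀ i j : Gen k, i.1 + 1 < j.1 → f i * f j = f j * f i)
    (h₂ : ∀ i j : Gen k, i.1 + 1 = j.1 → f i * f j * f i = f j * f i * f j) :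
    ∀ r ∈ braidRels k, FreeGroup.lift f r = 1 := by
  rintro r (⟨i, j, hij, rfl⟩ | ⟨i, j, hij, rfl⟩)
  · rw [map_mul, map_inv, mul_inv_eq_one]; simpa using h₁ i j hij
  · rw [map_mul, map_inv, mul_inv_eq_one]; simpa using h₂ i j hij

def artinHom {k : ℕ} (i : Gen k) : FreeGroup (Fin k) →* FreeGroup (Fin k) :=
  FreeGroup.lift fun l =>
    if l = i.left then FreeGroup.of i.right
    else if l = i.right then
      (FreeGroup.of i.right)⁻¹ * FreeGroup.of i.left * FreeGroup.of i.right
    else FreeGroup.of l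

def artinInvHom {k : ℕ} (i : Gen k) : FreeGroup (Fin k) →* FreeGroup (Fin k) :=
  FreeGroup.lift fun l =>
    if l = i.left then FreeGroup.of i.left * FreeGroup.of i.right * (FreeGroup.of i.left)⁻¹
    else if l = i.right then FreeGroup.of i.left
    else FreeGroup.of l

lemma Gen.right_ne_left {k : ℕ} (i : Gen k) : i.right ≠ i.left := by
  simp [Gen.left, Gen.right, Fin.ext_iff]

lemma Gen.left_ne_right {k : ℕ} (i : Gen k) : i.left ≠ i.right := i.right_ne_left.symm

/-- The automorphism `x_i ↦ x_{i+1}`, `x_{i+1} ↦ x_{i+1}⁻¹ x_i x_{i+1}`, `x_l ↦ x_l` otherwise, of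
the free group. -/
def artinAut {k : ℕ} (i : Gen k) : MulAut (FreeGroup (Fin k)) :=
  MonoidHom.toMulEquiv (artinHom i) (artinInvHom i)
    (by
      ext l
      by_cases h : l = i.left
      · subst h; simp [artinHom, artinInvHom, i.right_ne_left]
      · by_cases h' : l = i.right
        · subst h'; simp [artinHom, artinInvHom, i.right_ne_left, mul_assoc]
        · simp [artinHom, artinInvHom, h, h'])
    (by
      ext l
      by_cases h : l = i.left
      · subst h; simp [artinHom, artinInvHom, i.right_ne_left, mul_assoc]
      · by_cases h' : l = i.right
        · subst h'; simp [artinHom, artinInvHom, i.right_ne_left]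
        · simp [artinHom, artinInvHom, h, h'])

lemma artinAut_of {k : ℕ} (i : Gen k) (l : Fin k) :
    artinAut i (FreeGroup.of l) =
      if l = i.left then FreeGroup.of i.right
      else if l = i.right then
        (FreeGroup.of i.right)⁻¹ * FreeGroup.of i.left * FreeGroup.of i.right
      else FreeGroup.of l := by
  simp [artinAut, artinHom]

lemma mulAut_ext {k : ℕ} {f g : MulAut (FreeGroup (Fin k))}
    (h : ∀ l, f (FreeGroup.of l) = g (FreeGroup.of l)) : f = g := by
  apply MulEquiv.toMonoidHom_injective
  ext l
  exact h l

lemma artinAut_comm {k : ℕ} (i j : Gen k) (hij : i.1 + 1 < j.1) :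
    artinAut i * artinAut j = artinAut j * artinAut i := by
  have e1 : i.left ≠ j.left := by simp only [Gen.left, ne_eq, Fin.ext_iff]; omega
  have e2 : i.left ≠ j.right := by simp only [Gen.left, Gen.right, ne_eq, Fin.ext_iff]; omega
  have e3 : i.right ≠ j.left := by simp only [Gen.left, Gen.right, ne_eq, Fin.ext_iff]; omega
  have e4 : i.right ≠ j.right := by simp only [Gen.right, ne_eq, Fin.ext_iff]; omega
  have e5 := i.left_ne_right
  have e6 := j.left_ne_right
  apply mulAut_ext
  intro l
  rw [MulAut.mul_apply, MulAut.mul_apply]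
  by_cases h1 : l = i.left
  · subst h1; simp [artinAut_of, e1, e2, e3, e4]
  by_cases h2 : l = i.right
  · subst h2; simp [artinAut_of, e1, e2, e3, e4, e5.symm]
  by_cases h3 : l = j.left
  · subst h3; simp [artinAut_of, e1.symm, e2.symm, e3.symm, e4.symm]
  by_cases h4 : l = j.right
  · subst h4; simp [artinAut_of, e1.symm, e2.symm, e3.symm, e4.symm, e6.symm]
  simp [artinAut_of, h1, h2, h3, h4]

lemma artinAut_braid {k : ℕ} (i j : Gen k) (hij : i.1 + 1 = j.1) :
    artinAut i * artinAut j * artinAut i = artinAut j * artinAut i * artinAut j := by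
  have e1 : i.right = j.left := by simp only [Gen.left, Gen.right, Fin.ext_iff]; omega
  have e2 : i.left ≠ j.left := by simp only [Gen.left, ne_eq, Fin.ext_iff]; omega
  have e3 : i.left ≠ j.right := by simp only [Gen.left, Gen.right, ne_eq, Fin.ext_iff]; omega
  have e6 := j.left_ne_right
  apply mulAut_ext
  intro l
  rw [MulAut.mul_apply, MulAut.mul_apply, MulAut.mul_apply, MulAut.mul_apply]
  by_cases h1 : l = i.left
  · subst h1; simp [artinAut_of, e1, e2, e3, e3.symm, e6.symm]
  by_cases h2 : l = j.left
  · subst h2; simp [artinAut_of, e1, e2, e3, e2.symm, e3.symm, e6.symm]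
  by_cases h3 : l = j.right
  · subst h3; simp [artinAut_of, e1, e2, e3, e2.symm, e3.symm, e6.symm, mul_assoc]
  simp [artinAut_of, e1, h1, h2, h3]

/-- The right action of the braid group on the free group: `x ^ (σ τ) = (x ^ σ) ^ τ`. -/
def freeAction (k : ℕ) : BraidGroup k →* (MulAut (FreeGroup (Fin k)))ᵐᵒᵖ :=
  PresentedGroup.toGroup (f := fun i => MulOpposite.op (artinAut i))
    (lift_braidRels _
      (fun i j hij => MulOpposite.unop_injective (artinAut_comm i j hij).symm)
      (fun i j hij => MulOpposite.unop_injective (by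
        simpa [mul_assoc] using artinAut_braid i j hij)))

/-- The image `x_i ^ σ` of the `i`-th free generator. -/
def wordOf {k : ℕ} (σ : BraidGroup k) (i : Fin k) : FreeGroup (Fin k) :=
  (freeAction k σ).unop (FreeGroup.of i)

lemma swap_comm {k : ℕ} (i j : Gen k) (hij : i.1 + 1 < j.1) :
    Equiv.swap i.left i.right * Equiv.swap j.left j.right =
      Equiv.swap j.left j.right * Equiv.swap i.left i.right := by
  have e1 : i.left ≠ j.left := by simp only [Gen.left, ne_eq, Fin.ext_iff]; omega
  have e2 : i.left ≠ j.right := by simp only [Gen.left, Gen.right, ne_eq, Fin.ext_iff]; omega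
  have e3 : i.right ≠ j.left := by simp only [Gen.left, Gen.right, ne_eq, Fin.ext_iff]; omega
  have e4 : i.right ≠ j.right := by simp only [Gen.right, ne_eq, Fin.ext_iff]; omega
  apply Equiv.ext
  intro l
  rw [Equiv.Perm.mul_apply, Equiv.Perm.mul_apply]
  by_cases h1 : l = i.left
  · subst h1; rw [Equiv.swap_apply_of_ne_of_ne e1 e2, Equiv.swap_apply_left,
      Equiv.swap_apply_of_ne_of_ne e3 e4]
  by_cases h2 : l = i.right
  · subst h2; rw [Equiv.swap_apply_of_ne_of_ne e3 e4, Equiv.swap_apply_right,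
      Equiv.swap_apply_of_ne_of_ne e1 e2]
  rw [Equiv.swap_apply_of_ne_of_ne h1 h2]
  by_cases h3 : l = j.left
  · subst h3; rw [Equiv.swap_apply_left, Equiv.swap_apply_of_ne_of_ne e2.symm e4.symm]
  by_cases h4 : l = j.right
  · subst h4; rw [Equiv.swap_apply_right, Equiv.swap_apply_of_ne_of_ne e1.symm e3.symm]
  rw [Equiv.swap_apply_of_ne_of_ne h3 h4, Equiv.swap_apply_of_ne_of_ne h1 h2]

lemma swap_braid {k : ℕ} (i j : Gen k) (hij : i.1 + 1 = j.1) :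
    Equiv.swap i.left i.right * Equiv.swap j.left j.right * Equiv.swap i.left i.right =
      Equiv.swap j.left j.right * Equiv.swap i.left i.right * Equiv.swap j.left j.right := by
  have e1 : i.right = j.left := by simp only [Gen.left, Gen.right, Fin.ext_iff]; omega
  have e2 : i.left ≠ j.left := by simp only [Gen.left, ne_eq, Fin.ext_iff]; omega
  have e3 : i.left ≠ j.right := by simp only [Gen.left, Gen.right, ne_eq, Fin.ext_iff]; omega
  have e6 := j.left_ne_right
  have h1 := Equiv.swap_mul_swap_mul_swap e6.symm e3.symm
  have h2 := Equiv.swap_mul_swap_mul_swap e2 e3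
  rw [Equiv.swap_comm j.right j.left, Equiv.swap_comm j.left i.left] at h1
  rw [e1, h1, h2, Equiv.swap_comm]

/-- The right action of the braid group on the set of strands, sending the `i`-th generator to a
transposition. -/
def permAction (k : ℕ) : BraidGroup k →* (Equiv.Perm (Fin k))ᵐᵒᵖ :=
  PresentedGroup.toGroup (f := fun i => MulOpposite.op (Equiv.swap i.left i.right))
    (lift_braidRels _
      (fun i j hij => MulOpposite.unop_injective (by
        simpa using (swap_comm i j hij).symm))
      (fun i j hij => MulOpposite.unop_injective (by
        simpa [mul_assoc] using swap_braid i j hij)))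

/-- The permutation of a braid. -/
def braidPerm {k : ℕ} (σ : BraidGroup k) : Equiv.Perm (Fin k) := (permAction k σ).unop

/-- The inclusion of the braid group on `k` strands into that on `k + 1` strands. -/
def braidIncl (k : ℕ) : BraidGroup k →* BraidGroup (k + 1) :=
  PresentedGroup.toGroup (f := fun i : Gen k => sig (⟨i.1, by have := i.2; omega⟩ : Gen (k + 1)))
    (lift_braidRels _
      (by
        intro i j hij
        rw [← mul_inv_eq_one]
        exact PresentedGroup.one_of_mem (rels := braidRels (k + 1))
          (Or.inl ⟨⟨i.1, by have := i.2; omega⟩, ⟨j.1, by have := j.2; omega⟩, hij, rfl⟩))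
      (by
        intro i j hij
        rw [← mul_inv_eq_one]
        exact PresentedGroup.one_of_mem (rels := braidRels (k + 1))
          (Or.inr ⟨⟨i.1, by have := i.2; omega⟩, ⟨j.1, by have := j.2; omega⟩, hij, rfl⟩)))

/-- The last generator of the braid group on `k + 2` strands. -/
def lastGen (k : ℕ) : Gen (k + 2) := ⟨k, by omega⟩

/-- The Markov moves. -/
inductive MarkovMove : (Σ k : ℕ, BraidGroup k) → (Σ k : ℕ, BraidGroup k) → Prop
  | conj (k : ℕ) (σ ξ : BraidGroup k) : MarkovMove ⟨k, σ⟩ ⟨k, ξ⁻¹ * σ * ξ⟩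
  | stab (k : ℕ) (σ : BraidGroup (k + 1)) :
      MarkovMove ⟨k + 1, σ⟩ ⟨k + 2, braidIncl (k + 1) σ * sig (lastGen k)⟩
  | stabInv (k : ℕ) (σ : BraidGroup (k + 1)) :
      MarkovMove ⟨k + 1, σ⟩ ⟨k + 2, braidIncl (k + 1) σ * (sig (lastGen k))⁻¹⟩

/-- Two braids have isotopic closures if and only if they are related by Markov moves. Oriented
links in the three-sphere are represented by braids up to this relation. -/
def SameClosure {k l : ℕ} (σ : BraidGroup k) (τ : BraidGroup l) : Prop :=
  Relation.EqvGen MarkovMove ⟨k, σ⟩ ⟨l, τ⟩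

/-- The braid `σ₁²` on two strands, whose closure is the Hopf link. -/
def hopfBraid : BraidGroup 2 := sig (lastGen 0) ^ 2

/-- The link group `⟨x_1, …, x_k | x_i = x_i ^ σ⟩` of the closure of `σ`. -/
abbrev LinkGroup {k : ℕ} (σ : BraidGroup k) : Type :=
  PresentedGroup (Set.range fun i : Fin k => FreeGroup.of i * (wordOf σ i)⁻¹)

/-- The class of the free generator `x_i` in the link group. -/
def meridian {k : ℕ} (σ : BraidGroup k) (i : Fin k) : LinkGroup σ := PresentedGroup.of i

/-- `comp` numbers the components of the closure of `σ`, which are the cycles (fixed points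
included) of the permutation of `σ`. -/
structure IsComponentNumbering {k n : ℕ} (σ : BraidGroup k) (comp : Fin k → Fin n) : Prop where
  surjective : Function.Surjective comp
  sameCycle : ∀ i j, comp i = comp j ↔ (braidPerm σ).SameCycle i j

/-! ### The special unitary group, its centre and its Lie algebra -/

abbrev Mat (N : ℕ) : Type := Matrix (Fin N) (Fin N) ℂ

abbrev SU (N : ℕ) : Type := Matrix.specialUnitaryGroup (Fin N) ℂ

/-- The primitive root of unity `exp (2 π i / N)`, in the group of `N`-th roots of unity. -/
def omega (N : ℕ) [NeZero N] : rootsOfUnity N ℂ :=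
  (Complex.isPrimitiveRoot_exp N (NeZero.ne N)).toRootsOfUnity

/-- The scalar matrix `ζ I`, for an `N`-th root of unity `ζ`. -/
def scalarMat {N : ℕ} (ζ : rootsOfUnity N ℂ) : Mat N := ((ζ : ℂˣ) : ℂ) • (1 : Mat N)

lemma scalarMat_mem {N : ℕ} [NeZero N] (ζ : rootsOfUnity N ℂ) :
    scalarMat ζ ∈ Matrix.specialUnitaryGroup (Fin N) ℂ := by
  have hpow : ((ζ : ℂˣ) : ℂ) ^ N = 1 := by
    have h := (mem_rootsOfUnity N (ζ : ℂˣ)).1 ζ.2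
    rw [← Units.val_pow_eq_pow_val, h, Units.val_one]
  have hnorm : ‖((ζ : ℂˣ) : ℂ)‖ = 1 := Complex.norm_eq_one_of_pow_eq_one hpow (NeZero.ne N)
  rw [Matrix.mem_specialUnitaryGroup_iff, Matrix.mem_unitaryGroup_iff]
  constructor
  · have h : (starRingEnd ℂ) ((ζ : ℂˣ) : ℂ) * ((ζ : ℂˣ) : ℂ) = 1 := by
      simp [Complex.conj_mul', hnorm]
    simp [scalarMat, smul_smul, h]
  · simp [scalarMat, hpow]

/-- The identification of the `N`-th roots of unity with the centre of `SU(N)`. -/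
def scalarSU {N : ℕ} [NeZero N] (ζ : rootsOfUnity N ℂ) : SU N := ⟨scalarMat ζ, scalarMat_mem ζ⟩

/-- The Lie algebra `su(N)`, as a real vector space. -/
def su (N : ℕ) : Submodule ℝ (Mat N) where
  carrier := {ξ | star ξ = -ξ ∧ ξ.trace = 0}
  add_mem' := by
    rintro ξ η ⟨h₁, h₂⟩ ⟨h₃, h₄⟩
    exact ⟨by rw [star_add, h₁, h₃]; abel, by rw [Matrix.trace_add, h₂, h₄, add_zero]⟩
  zero_mem' := by simp
  smul_mem' := by
    rintro c ξ ⟨h₁, h₂⟩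
    exact ⟨by rw [star_smul, h₁]; simp, by rw [Matrix.trace_smul, h₂, smul_zero]⟩

lemma su_conj_mem {N : ℕ} (g : SU N) {ξ : Mat N} (hξ : ξ ∈ su N) :
    (g : Mat N) * ξ * ((g⁻¹ : SU N) : Mat N) ∈ su N := by
  have hs : ((g⁻¹ : SU N) : Mat N) = star (g : Mat N) := rfl
  have h1 : ((g⁻¹ : SU N) : Mat N) * (g : Mat N) = 1 :=
    congrArg Subtype.val (inv_mul_cancel g)
  obtain ⟨h₁, h₂⟩ := hξ
  refine ⟨?_, ?_⟩
  · rw [hs, star_mul, star_mul, star_star, h₁]; simp [mul_assoc]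
  · rw [Matrix.trace_mul_comm, ← mul_assoc, h1, one_mul, h₂]

/-- The adjoint representation of `SU(N)` on `su(N)`. -/
def adjoint (N : ℕ) : Representation ℝ (SU N) (su N) where
  toFun g :=
    { toFun := fun ξ => ⟨(g : Mat N) * ξ * ((g⁻¹ : SU N) : Mat N), su_conj_mem g ξ.2⟩
      map_add' := fun ξ η => by ext1; simp [mul_add, add_mul]
      map_smul' := fun c ξ => by ext1; simp }
  map_one' := by ext1 ξ; ext1; simp
  map_mul' g h := by ext1 ξ; ext1; simp [mul_assoc]

/-- A projective representation: a function which is multiplicative up to the centre. -/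
structure ProjRep (G : Type) [Group G] (N : ℕ) [NeZero N] where
  toFun : G → SU N
  mul_mem : ∀ g h : G, ∃ ζ : rootsOfUnity N ℂ,
    toFun (g * h) * (toFun h)⁻¹ * (toFun g)⁻¹ = scalarSU ζ

lemma adjoint_scalarSU {N : ℕ} [NeZero N] (ζ : rootsOfUnity N ℂ) :
    adjoint N (scalarSU ζ) = 1 := by
  have h : (scalarSU ζ : Mat N) * (((scalarSU ζ)⁻¹ : SU N) : Mat N) = 1 :=
    congrArg Subtype.val (mul_inv_cancel (scalarSU (N := N) ζ))
  ext1 ξ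
  ext1
  change (scalarSU ζ : Mat N) * (ξ : Mat N) * (((scalarSU ζ)⁻¹ : SU N) : Mat N) = ξ
  have hc : (scalarSU ζ : Mat N) * (ξ : Mat N) = (ξ : Mat N) * (scalarSU ζ : Mat N) := by
    simp [scalarSU, scalarMat]
  rw [hc, mul_assoc, h, mul_one]

/-- The representation `Ad ρ` on `su(N)`, for a projective representation `ρ`. -/
def ProjRep.ad {G : Type} [Group G] {N : ℕ} [NeZero N] (ρ : ProjRep G N) :
    Representation ℝ G (su N) where
  toFun g := adjoint N (ρ.toFun g)
  map_one' := by
    obtain ⟨ζ, hζ⟩ := ρ.mul_mem 1 1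
    have h := congrArg (adjoint N) hζ
    rw [adjoint_scalarSU, mul_one, mul_inv_cancel, one_mul] at h
    have h2 : adjoint N (ρ.toFun 1) * adjoint N (ρ.toFun 1)⁻¹ = 1 := by
      rw [← map_mul, mul_inv_cancel, map_one]
    rwa [h, mul_one] at h2
  map_mul' g h := by
    obtain ⟨ζ, hζ⟩ := ρ.mul_mem g h
    have e : ρ.toFun (g * h) = scalarSU ζ * (ρ.toFun g * ρ.toFun h) := by
      rw [← hζ]; group
    rw [e, map_mul, adjoint_scalarSU, one_mul, map_mul]

/-! ### Tuples of special unitary matrices and the twisted braid action -/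

/-- The space of `SU(N)` representations of the free group on `k` generators. -/
abbrev RepSpace (N k : ℕ) : Type := Fin k → SU N

/-- The ambient real vector space of `RepSpace N k`. -/
abbrev Amb (N k : ℕ) : Type := Fin k → Mat N

def coe {N k : ℕ} (X : RepSpace N k) : Amb N k := fun i => (X i : Mat N)

def coePair {N k : ℕ} (Z : RepSpace N k × RepSpace N k) : Amb N k × Amb N k := (coe Z.1, coe Z.2)

/-- Simultaneous conjugation by `U`. -/
def conjAmb {N k : ℕ} (U : SU N) (x : Amb N k) : Amb N k :=
  fun i => (U : Mat N) * x i * ((U⁻¹ : SU N) : Mat N)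

/-- The diffeomorphism `ε σ` of the representation space,
`X ↦ (ε_1 σ(X)_1, …, ε_k σ(X)_k)`, where `σ(X)_i` is the value of `X` on `x_i ^ σ`. -/
def twisted {N k : ℕ} [NeZero N] (σ : BraidGroup k) (ε : Fin k → rootsOfUnity N ℂ)
    (X : RepSpace N k) : RepSpace N k :=
  fun i => scalarSU (ε i) * FreeGroup.lift X (wordOf σ i)

/-- The fixed points of `ε σ`. -/
def fixedSet {N k : ℕ} [NeZero N] (σ : BraidGroup k) (ε : Fin k → rootsOfUnity N ℂ) :
    Set (RepSpace N k) :=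
  {X | twisted σ ε X = X}

/-- `ε` is compatible with the labels `a` of the components numbered by `comp`. -/
def Compatible {N k n : ℕ} [NeZero N] (a : Fin n → ℤ) (comp : Fin k → Fin n)
    (ε : Fin k → rootsOfUnity N ℂ) : Prop :=
  ∀ j, ∏ i with comp i = j, ε i = omega N ^ a j

/-- A family is reducible if it can be simultaneously conjugated to block diagonal form with blocks
of positive sizes `N₁` and `N - N₁`. -/
def IsReducible {N : ℕ} {ι : Type} (X : ι → SU N) : Prop :=
  ∃ (P : SU N) (N₁ : ℕ), 0 < N₁ ∧ N₁ < N ∧ ∀ (i : ι) (a b : Fin N),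
    ¬ ((a : ℕ) < N₁ ↔ (b : ℕ) < N₁) → ((P * X i * P⁻¹ : SU N) : Mat N) a b = 0

/-- The diagonal matrix whose entries are the `N`-th roots of `(-1) ^ (N - 1)`:
`diag(1, ω, …, ω ^ (N - 1))` for `N` odd and `diag(ξ, ω ξ, …, ω ^ (N - 1) ξ)` for `N` even,
with `ω = exp (2 π i / N)` and `ξ = exp (2 π i / 2 N)`. -/
def matA (N : ℕ) : Mat N :=
  Matrix.diagonal fun j : Fin N =>
    (if Even N then Complex.exp (2 * Real.pi * Complex.I / (2 * N)) else 1) *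
      Complex.exp (2 * Real.pi * Complex.I / N) ^ (j : ℕ)

/-- `P` diagonalizes the tuple `X`, with every entry conjugate to `matA N`. -/
def Diagonalizes {N k : ℕ} (P X : RepSpace N k) : Prop :=
  ∀ i, (X i : Mat N) = (P i : Mat N) * matA N * (((P i)⁻¹ : SU N) : Mat N)

/-- The tuples all of whose entries lie in the conjugacy class of `matA N`. -/
def Q (N k : ℕ) : Set (RepSpace N k) := {X | ∃ P, Diagonalizes P X}

/-- The irreducible part of `Q N k`. It parametrizes both the irreducible part of the diagonal and
the irreducible part of the graph of `ε σ` (the pair `(X, ε σ (X))` is reducible if and only if `X`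
is, as the entries of `ε σ (X)` are central multiples of words in those of `X`). -/
def Qstar (N k : ℕ) : Set (RepSpace N k) := {X | X ∈ Q N k ∧ ¬ IsReducible X}

/-- The product `X_1 ⋯ X_k`. -/
def tupleProd {N k : ℕ} (X : RepSpace N k) : SU N := (List.ofFn X).prod

/-- The map `(X, Y) ↦ X_1 ⋯ X_k Y_k⁻¹ ⋯ Y_1⁻¹`. -/
def prodMap {N k : ℕ} (Z : RepSpace N k × RepSpace N k) : SU N :=
  tupleProd Z.1 * (tupleProd Z.2)⁻¹

/-- The manifold of irreducible pairs `(X, Y)` in `Q N k × Q N k` with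
`X_1 ⋯ X_k = Y_1 ⋯ Y_k`. -/
def Hstar (N k : ℕ) : Set (RepSpace N k × RepSpace N k) :=
  {Z | Z.1 ∈ Q N k ∧ Z.2 ∈ Q N k ∧ ¬ IsReducible (Sum.elim Z.1 Z.2) ∧
    tupleProd Z.1 = tupleProd Z.2}

/-! ### Tangent vectors and orientations -/

/-- `w` is the image of the tangent vector `v` at `x` under the tangent map of `φ` on the
submanifold `S`: there is a curve in `S` through `x` with velocity `v` whose image under `φ` has
velocity `w`. The manifold is embedded in the vector space `V` by `e`. -/
def HasTangentImage {M V W : Type} [AddCommGroup V] [Module ℝ V] [TopologicalSpace V]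
    [ContinuousSMul ℝ V] [AddCommGroup W] [Module ℝ W] [TopologicalSpace W] [ContinuousSMul ℝ W]
    (S : Set M) (e : M → V) (φ : M → W) (x : M) (v : V) (w : W) : Prop :=
  ∃ c : ℝ → M, (∀ t, c t ∈ S) ∧ c 0 = x ∧ HasDerivAt (fun t => e (c t)) v 0 ∧
    HasDerivAt (fun t => φ (c t)) w 0

/-- The finite family `v` is obtained from the finite family `F` by a square matrix whose
determinant has sign `s`. If `F` is a basis of a space and `s = 1` (`s = -1`), this says that `v` is
a basis of that space with the same (the opposite) orientation. -/
def RelOrientation {V : Type} [AddCommGroup V] [Module ℝ V] {m n : ℕ} (s : SignType)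
    (v : Fin m → V) (F : Fin n → V) : Prop :=
  ∃ (h : m = n) (M : Matrix (Fin n) (Fin n) ℝ), SignType.sign M.det = s ∧
    ∀ i, v i = ∑ j, M (Fin.cast h i) j • F j

/-- The off-diagonal positions of an `N × N` matrix. -/
abbrev OffDiag (N : ℕ) : Type := {p : Fin N × Fin N // p.1 ≠ p.2}

/-- The standard real basis of the space of skew-Hermitian matrices with zero diagonal:
`E_ab - E_ba` for `a < b` and `i (E_ab + E_ba)` for `a > b`. -/
def skewBasis {N : ℕ} (p : OffDiag N) : Mat N :=
  if p.1.1 < p.1.2 then Matrix.single p.1.1 p.1.2 1 - Matrix.single p.1.2 p.1.1 1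
  else Matrix.single p.1.1 p.1.2 Complex.I + Matrix.single p.1.2 p.1.1 Complex.I

/-- An ordered basis of the tangent space at `P A P⁻¹` of the conjugacy class of `A = matA N`. Its
orientation does not depend on the choice of `P`, so that these bases orient the conjugacy class. -/
def classFrame {N : ℕ} (P : SU N) (i : Fin (Fintype.card (OffDiag N))) : Mat N :=
  (P : Mat N) * (skewBasis ((Fintype.equivFin (OffDiag N)).symm i) * matA N) *
    ((P⁻¹ : SU N) : Mat N)

/-- The product orientation of `Q N k`: an ordered basis of the tangent space at the tuple with
entries `P_i A P_i⁻¹`. -/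
def qFrame {N k : ℕ} (P : RepSpace N k) (i : Fin (k * Fintype.card (OffDiag N))) : Amb N k :=
  Pi.single (finProdFinEquiv.symm i).1
    (classFrame (P (finProdFinEquiv.symm i).1) (finProdFinEquiv.symm i).2)

/-- The product orientation of `Q N k × Q N k` at the pair whose entries are both diagonalized by
`P`. -/
def qqFrame {N k : ℕ} (P : RepSpace N k) :
    Fin (k * Fintype.card (OffDiag N) + k * Fintype.card (OffDiag N)) → Amb N k × Amb N k :=
  Fin.append (fun i => (qFrame P i, 0)) (fun i => (0, qFrame P i))

/-- A fixed basis of `su(N)`, which orients `SU(N)` and `PU(N)`. -/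
def suBasis (N : ℕ) : Fin (Module.finrank ℝ (su N)) → Mat N :=
  fun j => (Module.finBasis ℝ (su N) j : Mat N)

/-- The velocities at `X` of simultaneous conjugation by the one-parameter groups of the basis of
`su(N)`: an oriented basis of the tangent space of the orbit of an irreducible `X`. -/
def orbitFrame {N k : ℕ} (X : RepSpace N k) : Fin (Module.finrank ℝ (su N)) → Amb N k :=
  fun j i => suBasis N j * (X i : Mat N) - (X i : Mat N) * suBasis N j

/-! ### The oriented intersection number

A map `g` from `Q N k` to `Hstar N k` which is equivariant under conjugation, such as
`X ↦ (X, ε σ (X))`, is thought of as a parametrization of a half-dimensional oriented submanifold of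
the quotient of `Hstar N k` by `PU(N)`. It is intersected with the quotient of the diagonal.
All quotients and fibres are oriented by the rule "base first, then fibre". -/

/-- `g X` lies on the irreducible part of the diagonal, at the point `(Y, Y)`. -/
def Meets {N k : ℕ} (g : RepSpace N k → Amb N k × Amb N k) (X Y : RepSpace N k) : Prop :=
  X ∈ Qstar N k ∧ Y ∈ Qstar N k ∧ g X = (coe Y, coe Y)

/-- At `X`, the (quotient of the) submanifold parametrized by `g` meets the (quotient of the)
diagonal, transversally and with sign `s = 1` or `s = -1`, in the quotient of `Hstar N k`. Here

* `p` represents a positive basis of the tangent space of the quotient of `Q N k` at `X`, and `p'`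
  is its image under the tangent map of `g`;
* `q` represents a positive basis of the tangent space of the quotient of `Q N k` at `Y`, and
  `(q, q)` is its image under the tangent map of the diagonal;
* `z` is a lift of the basis of `su(N)` under the tangent map of `prodMap` at `(Y, Y)`.

The vectors `(q, q), p'` then represent a basis of the tangent space of the quotient of `Hstar N k`
with sign `s` if and only if `z, (q, q), p'`, followed by the directions of the orbit, is a basis
with sign `s` of the tangent space of `Q N k × Q N k`. -/
def HasLocalSign {N k : ℕ} (g : RepSpace N k → Amb N k × Amb N k) (X : RepSpace N k)
    (s : SignType) : Prop :=
  s ≠ 0 ∧ ∃ Y : RepSpace N k, Meets g X Y ∧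
  ∃ P R : RepSpace N k, Diagonalizes P X ∧ Diagonalizes R Y ∧
  ∃ (m : ℕ) (p q : Fin m → Amb N k) (p' : Fin m → Amb N k × Amb N k)
    (z : Fin (Module.finrank ℝ (su N)) → Amb N k × Amb N k),
    RelOrientation 1 (Fin.append p (orbitFrame X)) (qFrame P) ∧
    RelOrientation 1 (Fin.append q (orbitFrame Y)) (qFrame R) ∧
    (∀ i, HasTangentImage (Q N k) coe g X (p i) (p' i)) ∧
    (∀ j, HasTangentImage (Q N k ×ˢ Q N k) coePair (fun Z => (prodMap Z : Mat N)) (Y, Y)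
      (z j) (suBasis N j)) ∧
    RelOrientation s
      (Fin.append z (Fin.append (Fin.append (fun i => (q i, q i)) p')
        (fun j => (orbitFrame Y j, orbitFrame Y j))))
      (qqFrame R)

open Classical in
/-- The sign of the intersection at `X`; it is `0` if there is no transverse intersection. -/
def localSign {N k : ℕ} (g : RepSpace N k → Amb N k × Amb N k) (X : RepSpace N k) : ℤ :=
  if HasLocalSign g X 1 then 1 else if HasLocalSign g X (-1) then -1 else 0

/-- The orbits of simultaneous conjugation. -/
abbrev OrbitSpace (N k : ℕ) : Type :=
  MulAction.orbitRel.Quotient (ConjAct (SU N)) (RepSpace N k)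

/-- The intersection with the diagonal is transverse and consists of finitely many points (in the
quotient by conjugation). -/
def IsTransverse {N k : ℕ} (g : RepSpace N k → Amb N k × Amb N k) : Prop :=
  {o : OrbitSpace N k | ∃ X Y, Meets g X Y ∧ Quotient.mk'' X = o}.Finite ∧
    ∀ X Y, Meets g X Y → localSign g X ≠ 0

/-- The signed count of the intersection points. -/
def signedCount {N k : ℕ} (g : RepSpace N k → Amb N k × Amb N k) : ℤ :=
  ∑ᶠ o : OrbitSpace N k, localSign g o.out

section Isotopy

attribute [local instance] Matrix.normedAddCommGroup Matrix.normedSpace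

/-- A family `Φ t`, smooth on the product of the real line with `S` (that is, restricting a smooth
function on an open neighbourhood in the ambient vector space). -/
def IsSmoothFamily {N k : ℕ} (S : Set (RepSpace N k × RepSpace N k))
    (Φ : ℝ → Amb N k × Amb N k → Amb N k × Amb N k) : Prop :=
  ∃ U : Set (ℝ × (Amb N k × Amb N k)), IsOpen U ∧ (Set.univ ×ˢ (coePair '' S)) ⊆ U ∧
    ContDiffOn ℝ ∞ (fun y => Φ y.1 y.2) U

/-- A smooth isotopy of `Hstar N k` which starts at the identity, commutes with conjugation and has
compact support; equivalently (by lifting), a compactly supported isotopy of the quotient of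
`Hstar N k` by conjugation. -/
structure IsCompactIsotopy {N k : ℕ} (Φ : ℝ → Amb N k × Amb N k → Amb N k × Amb N k) : Prop where
  smooth : IsSmoothFamily (Hstar N k) Φ
  exists_inverse : ∃ Ψ, IsSmoothFamily (Hstar N k) Ψ ∧ ∀ t, ∀ x ∈ coePair '' Hstar N k,
    Φ t x ∈ coePair '' Hstar N k ∧ Ψ t x ∈ coePair '' Hstar N k ∧
      Ψ t (Φ t x) = x ∧ Φ t (Ψ t x) = x
  zero : ∀ x ∈ coePair '' Hstar N k, Φ 0 x = x
  equivariant : ∀ t, ∀ x ∈ coePair '' Hstar N k, ∀ U : SU N,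
    Φ t (conjAmb U x.1, conjAmb U x.2) = (conjAmb U (Φ t x).1, conjAmb U (Φ t x).2)
  support : ∃ K ⊆ coePair '' Hstar N k, IsCompact K ∧
    ∀ t, ∀ x ∈ coePair '' Hstar N k, x ∉ K → Φ t x = x

end Isotopy

/-- The parametrization `X ↦ (X, ε σ (X))` of the graph of `ε σ`. -/
def graphMap {N k : ℕ} [NeZero N] (σ : BraidGroup k) (ε : Fin k → rootsOfUnity N ℂ)
    (X : RepSpace N k) : Amb N k × Amb N k :=
  (coe X, coe (twisted σ ε X))

open Classical in
/-- The Casson-Lin number of `ε σ`: the oriented intersection number, in the quotient of `Hstar N k`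
by conjugation, of the diagonal and the graph of `ε σ`. It is the signed count of the intersection
points of the diagonal with the graph if these intersect transversally, and with a compactly
supported perturbation of the graph for which this is so otherwise. (The count does not depend on
the perturbation.) -/
def cassonLin {N k : ℕ} [NeZero N] (σ : BraidGroup k) (ε : Fin k → rootsOfUnity N ℂ) : ℤ :=
  if IsTransverse (graphMap σ ε) then signedCount (graphMap σ ε)
  else if h : ∃ Φ, IsCompactIsotopy Φ ∧ IsTransverse (fun X => Φ 1 (graphMap σ ε X)) then
    signedCount (fun X => h.choose 1 (graphMap σ ε X))
  else 0

end CassonLin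

end

noncomputable section

namespace CassonLin

/-! ### Values of braids on tuples of group elements -/

section BraidMap

variable {T Z : Type*} [Group T] [CommGroup Z] {k : ℕ}

/-! When the graph meets the diagonal transversally, the intersection number is a signed count of
conjugacy classes of irreducible fixed points in `Q N k`. It is therefore enough to show, for every
braid representing the Hopf link, that the fixed points form a single conjugacy class of irreducible
nondegenerate points of `Q N k`. The count then has one term, equal to ±1, and no perturbation is
needed.

Uniqueness, irreducibility and nondegeneracy are packed into one group-theoretic condition by
replacing SU(N) with its tangent group `AffAd N`, the semidirect product of su(N) and SU(N).
Evaluating a word there computes its value and its derivative at once, so a tuple fixed by εσ is a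
fixed point X together with a tangent vector fixed by the derivative of εσ
(`affTuple_mem_twistedFix_iff`). If such tuples form one conjugacy class with central centralizer
(`IsSingleOrbit`), then the fixed points X form one class, have only central stabilizers, have no
infinitesimal stabilizer, and the fixed tangent vectors are exactly the orbit directions
(`IsSingleOrbit.exists_isNondegenerateOrbit`).

The condition makes sense in any group with chosen central elements, and it is invariant under
Markov moves (`hasSingleOrbits_iff_of_sameClosure`): conjugating a braid transports fixed tuples by
the action of the conjugating braid, and stabilizing adds a strand whose entry is determined by the
others.

Only σ₁² remains (`isSingleOrbit_hopf`). Its fixed points are pairs commuting up to a primitive N-th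
root of unity. Such a pair is a clock and shift pair in a suitable orthonormal frame
(`exists_frame`), hence unique up to conjugation and with scalar commutant. Its adjoint operators
commute, have order dividing N and have no common invariants, so averaging shows that cocycles are
coboundaries (`exists_eq_coboundary`). This also gives the vanishing of H¹ of the link group.

Finally, nondegeneracy implies transversality (`exists_hasLocalSign`). The product map is a
submersion where there are no infinitesimal stabilizers, and `linearIndependent_transverse`
assembles a basis of the tangent space of `Q N k × Q N k` out of lifts of su(N), the diagonal, the
graph and the orbit. -/

lemma braid_induction {p : BraidGroup k → Prop} (one : p 1) (gen : ∀ i, p (sig i))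
    (mul : ∀ σ τ, p σ → p τ → p (σ * τ)) (inv : ∀ σ, p σ → p σ⁻¹) (σ : BraidGroup k) : p σ := by
  have h : σ ∈ Subgroup.closure (Set.range (PresentedGroup.of : Gen k → BraidGroup k)) := by
    rw [PresentedGroup.closure_range_of]; trivial
  induction h using Subgroup.closure_induction with
  | mem x hx => obtain ⟨i, rfl⟩ := hx; exact gen i
  | one => exact one
  | mul x y _ _ hx hy => exact mul x y hx hy
  | inv x _ hx => exact inv x hx

lemma freeAction_mul_unop (σ τ : BraidGroup k) (w : FreeGroup (Fin k)) :
    (freeAction k (σ * τ)).unop w = (freeAction k τ).unop ((freeAction k σ).unop w) := by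
  simp [map_mul, MulAut.mul_apply]

lemma freeAction_sig (i : Gen k) : (freeAction k (sig i)).unop = artinAut i := by
  simp [freeAction, sig]

lemma braidPerm_mul (σ τ : BraidGroup k) : braidPerm (σ * τ) = braidPerm τ * braidPerm σ := by
  simp [braidPerm]

lemma braidPerm_inv (σ : BraidGroup k) : braidPerm σ⁻¹ = (braidPerm σ)⁻¹ := by
  simp [braidPerm]

lemma braidPerm_sig (i : Gen k) : braidPerm (sig i) = Equiv.swap i.left i.right := by
  simp [braidPerm, permAction, sig]

/-- The tuple of the values of `X` on the words `x_i ^ σ`. -/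
def braidMap (σ : BraidGroup k) (X : Fin k → T) : Fin k → T :=
  fun i => FreeGroup.lift X (wordOf σ i)

lemma lift_braidMap (σ : BraidGroup k) (X : Fin k → T) (w : FreeGroup (Fin k)) :
    FreeGroup.lift (braidMap σ X) w = FreeGroup.lift X ((freeAction k σ).unop w) := by
  have h : FreeGroup.lift (braidMap σ X) =
      (FreeGroup.lift X).comp (freeAction k σ).unop.toMonoidHom := by
    ext i; simp [braidMap, wordOf]
  rw [h]; rfl

/-- Substitution is contravariant, so the right action on words becomes a left action on tuples. -/
lemma braidMap_mul (σ τ : BraidGroup k) (X : Fin k → T) :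
    braidMap (σ * τ) X = braidMap σ (braidMap τ X) := by
  funext i
  change FreeGroup.lift X ((freeAction k (σ * τ)).unop _) = _
  rw [freeAction_mul_unop, ← lift_braidMap]; rfl

lemma braidMap_one (X : Fin k → T) : braidMap 1 X = X := by
  funext i; simp [braidMap, wordOf]

lemma braidMap_inv_cancel (σ : BraidGroup k) (X : Fin k → T) :
    braidMap σ⁻¹ (braidMap σ X) = X := by
  rw [← braidMap_mul, inv_mul_cancel, braidMap_one]

lemma braidMap_cancel_inv (σ : BraidGroup k) (X : Fin k → T) :
    braidMap σ (braidMap σ⁻¹ X) = X := by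
  rw [← braidMap_mul, mul_inv_cancel, braidMap_one]

lemma map_lift {T' : Type*} [Group T'] (φ : T →* T') (X : Fin k → T) (w : FreeGroup (Fin k)) :
    φ (FreeGroup.lift X w) = FreeGroup.lift (fun i => φ (X i)) w := by
  have h : φ.comp (FreeGroup.lift X) = FreeGroup.lift (fun i => φ (X i)) := by ext i; simp
  rw [← h]; rfl

lemma lift_conj (g : T) (X : Fin k → T) (w : FreeGroup (Fin k)) :
    FreeGroup.lift (fun i => g * X i * g⁻¹) w = g * FreeGroup.lift X w * g⁻¹ :=
  (map_lift (MulAut.conj g).toMonoidHom X w).symm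

/-- This conjugacy is what makes twists travel along the permutation (`braidMap_smul`) and
conjugation-stable sets be preserved (`braidMap_mem`). -/
lemma exists_wordOf_eq_conj (σ : BraidGroup k) :
    ∀ i, ∃ h, wordOf σ i = h * FreeGroup.of (braidPerm σ i) * h⁻¹ := by
  induction σ using braid_induction with
  | one => intro i; exact ⟨1, by simp [wordOf, braidPerm]⟩
  | gen j =>
    intro i
    rw [wordOf, freeAction_sig, artinAut_of, braidPerm_sig]
    by_cases h1 : i = j.left
    · subst h1; exact ⟨1, by simp⟩
    by_cases h2 : i = j.right
    · subst h2; exact ⟨(FreeGroup.of j.right)⁻¹, by simp [h1]⟩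
    exact ⟨1, by simp [h1, h2, Equiv.swap_apply_of_ne_of_ne h1 h2]⟩
  | mul σ τ hσ hτ =>
    intro i
    obtain ⟨a, ha⟩ := hσ i
    obtain ⟨b, hb⟩ := hτ (braidPerm σ i)
    refine ⟨(freeAction k τ).unop a * b, ?_⟩
    rw [wordOf, freeAction_mul_unop]
    change (freeAction k τ).unop (wordOf σ i) = _
    rw [ha, map_mul, map_mul]
    change _ * wordOf τ _ * _ = _
    rw [hb, braidPerm_mul, Equiv.Perm.mul_apply, map_inv]
    group
  | inv σ hσ =>
    intro i
    -- Apply the action of `σ⁻¹` to the relation for the strand that σ sends to `i`, and solve for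
    -- the image of that strand's target.
    obtain ⟨a, ha⟩ := hσ ((braidPerm σ)⁻¹ i)
    rw [← Equiv.Perm.mul_apply, mul_inv_cancel, Equiv.Perm.one_apply] at ha
    refine ⟨((freeAction k σ⁻¹).unop a)⁻¹, ?_⟩
    have h := congrArg (freeAction k σ⁻¹).unop ha
    rw [wordOf, ← freeAction_mul_unop, mul_inv_cancel, map_mul, map_mul, map_inv _ a] at h
    have h' : FreeGroup.of ((braidPerm σ)⁻¹ i) =
        (freeAction k σ⁻¹).unop a * wordOf σ⁻¹ i * ((freeAction k σ⁻¹).unop a)⁻¹ := by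
      rw [wordOf, ← h]; simp
    rw [braidPerm_inv, h']
    group

variable (z : Z →* T)

lemma exists_lift_smul (hz : ∀ a t, z a * t = t * z a) (δ : Fin k → Z) (X : Fin k → T)
    (w : FreeGroup (Fin k)) :
    ∃ a, FreeGroup.lift (fun i => z (δ i) * X i) w = z a * FreeGroup.lift X w := by
  induction w using FreeGroup.induction_on with
  | C1 => exact ⟨1, by simp⟩
  | of i => exact ⟨δ i, by simp⟩
  | inv_of i _ =>
    refine ⟨(δ i)⁻¹, ?_⟩
    rw [hz]
    simp
  | mul x y hx hy =>
    obtain ⟨a, ha⟩ := hx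
    obtain ⟨b, hb⟩ := hy
    refine ⟨a * b, ?_⟩
    rw [map_mul, map_mul, map_mul, ha, hb]
    simp only [mul_assoc]
    rw [← mul_assoc _ (z b), ← hz b, mul_assoc]

/-- The word of strand `i` is a conjugate of one generator. Central factors inside the conjugator
cancel, so only the factor of that generator survives and its exact form elsewhere is irrelevant. -/
lemma braidMap_smul (hz : ∀ a t, z a * t = t * z a) (σ : BraidGroup k) (δ : Fin k → Z)
    (X : Fin k → T) (i : Fin k) :
    braidMap σ (fun i => z (δ i) * X i) i = z (δ (braidPerm σ i)) * braidMap σ X i := by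
  obtain ⟨h, hh⟩ := exists_wordOf_eq_conj σ i
  obtain ⟨a, ha⟩ := exists_lift_smul z hz δ X h
  simp only [braidMap, hh, map_mul, map_inv, ha, FreeGroup.lift_apply_of, mul_inv_rev]
  have := hz (δ (braidPerm σ i)) (z a * FreeGroup.lift X h)
  calc z a * FreeGroup.lift X h * (z (δ (braidPerm σ i)) * X (braidPerm σ i)) *
        ((FreeGroup.lift X h)⁻¹ * (z a)⁻¹)
      = (z a * FreeGroup.lift X h * z (δ (braidPerm σ i))) * X (braidPerm σ i) *
        ((FreeGroup.lift X h)⁻¹ * (z a)⁻¹) := by group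
    _ = z (δ (braidPerm σ i)) * (z a * (FreeGroup.lift X h * X (braidPerm σ i) *
        (FreeGroup.lift X h)⁻¹)) * (z a)⁻¹ := by rw [← this]; group
    _ = _ := by rw [hz a]; group

lemma braidMap_mem (σ : BraidGroup k) {C : Set T} (hC : ∀ g, ∀ t ∈ C, g * t * g⁻¹ ∈ C)
    {X : Fin k → T} (hX : ∀ i, X i ∈ C) (i : Fin k) : braidMap σ X i ∈ C := by
  obtain ⟨h, hh⟩ := exists_wordOf_eq_conj σ i
  simpa [braidMap, hh] using hC (FreeGroup.lift X h) _ (hX (braidPerm σ i))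

lemma prod_ofFn_congr_pair (i : Gen k) (f g : Fin k → T)
    (h : ∀ l, l ≠ i.left → l ≠ i.right → f l = g l)
    (hp : f i.left * f i.right = g i.left * g i.right) :
    (List.ofFn f).prod = (List.ofFn g).prod := by
  induction k with
  | zero => exact absurd i.2 (by omega)
  | succ n ih =>
    obtain ⟨i, hi⟩ := i
    rw [List.ofFn_succ, List.ofFn_succ, List.prod_cons, List.prod_cons]
    cases i with
    | zero =>
      obtain ⟨m, rfl⟩ : ∃ m, n = m + 1 := ⟨n - 1, by omega⟩
      rw [List.ofFn_succ, List.ofFn_succ, List.prod_cons, List.prod_cons, ← mul_assoc, ← mul_assoc]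
      have e : (fun l : Fin m => f l.succ.succ) = fun l => g l.succ.succ := by
        funext l
        apply h <;> simp [Gen.left, Gen.right, Fin.ext_iff]
      rw [e]
      exact congrArg (· * _) hp
    | succ i =>
      rw [h 0 (by simp [Gen.left, Fin.ext_iff]) (by simp [Gen.right, Fin.ext_iff])]
      congr 1
      refine ih ⟨i, by omega⟩ _ _ (fun l h1 h2 => h _ ?_ ?_) hp
      · simpa [Gen.left, Fin.ext_iff] using h1
      · simpa [Gen.right, Fin.ext_iff] using h2

lemma map_prod_ofFn {T' : Type*} [Group T'] (φ : T →* T') (X : Fin k → T) :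
    φ (List.ofFn X).prod = (List.ofFn fun i => φ (X i)).prod := by
  rw [map_list_prod, List.map_ofFn]; rfl

/-- A generator changes two adjacent entries but not their product: x_{i+1} · x_{i+1}⁻¹ x_i x_{i+1}
= x_i x_{i+1}. -/
lemma prod_braidMap (σ : BraidGroup k) (X : Fin k → T) :
    (List.ofFn (braidMap σ X)).prod = (List.ofFn X).prod := by
  induction σ using braid_induction generalizing X with
  | one => rw [braidMap_one]
  | gen i =>
    apply prod_ofFn_congr_pair i
    · intro l h1 h2
      simp [braidMap, wordOf, freeAction_sig, artinAut_of, h1, h2]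
    · simp [braidMap, wordOf, freeAction_sig, artinAut_of, i.right_ne_left, mul_assoc]
  | mul σ τ hσ hτ => rw [braidMap_mul, hσ, hτ]
  | inv σ hσ => rw [← hσ (braidMap σ⁻¹ X), braidMap_cancel_inv]

lemma prod_ofFn_smul (hz : ∀ a t, z a * t = t * z a) (δ : Fin k → Z) (X : Fin k → T) :
    (List.ofFn fun i => z (δ i) * X i).prod = z (∏ i, δ i) * (List.ofFn X).prod := by
  induction k with
  | zero => simp
  | succ n ih =>
    rw [List.ofFn_succ, List.ofFn_succ, List.prod_cons, List.prod_cons, ih, Fin.prod_univ_succ,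
      map_mul]
    have := hz (∏ i : Fin n, δ i.succ) (X 0)
    simp only [mul_assoc]
    rw [← mul_assoc (X 0), ← this, mul_assoc]

end BraidMap

/-! ### Invariance of fixed point sets under Markov moves -/

section Markov

variable {T Z : Type*} [Group T] [CommGroup Z] {k l n : ℕ}

/-- The tuples in a group fixed by `ε σ`, where `z` embeds the twists in the centre. -/
def twistedFix (z : Z →* T) (σ : BraidGroup k) (ε : Fin k → Z) : Set (Fin k → T) :=
  {X | ∀ i, z (ε i) * braidMap σ X i = X i}

def conjTuple (g : T) (X : Fin k → T) : Fin k → T := fun i => g * X i * g⁻¹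

lemma conjTuple_mem_twistedFix {z : Z →* T} (hz : ∀ a t, z a * t = t * z a) {σ : BraidGroup k}
    {ε : Fin k → Z} (g : T) {X : Fin k → T} (hX : X ∈ twistedFix z σ ε) :
    conjTuple g X ∈ twistedFix z σ ε := by
  intro i
  have h : braidMap σ (conjTuple g X) i = g * braidMap σ X i * g⁻¹ := lift_conj g X _
  rw [h, conjTuple, ← hX i, ← mul_assoc, ← mul_assoc, hz, ← mul_assoc]

/-- The fixed points of `ε σ` form a single conjugacy class of tuples with entries in `C` and with
central centralizer. -/
def IsSingleOrbit (z : Z →* T) (C : Set T) (σ : BraidGroup k) (ε : Fin k → Z) : Prop :=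
  ∃ X ∈ twistedFix z σ ε, (∀ Y ∈ twistedFix z σ ε, ∃ g, Y = conjTuple g X) ∧ (∀ i, X i ∈ C) ∧
    ∀ g, conjTuple g X = X → g ∈ Set.range z

/-- The common mechanism of all Markov moves: mutually inverse, conjugation-equivariant maps between
the fixed sets carry orbits to orbits and preserve centralizers. -/
lemma IsSingleOrbit.transport {z : Z →* T} {C : Set T}
    {σ : BraidGroup k} {ε : Fin k → Z} {τ : BraidGroup l} {δ : Fin l → Z}
    (h : IsSingleOrbit z C σ ε) (f : (Fin k → T) → Fin l → T) (e : (Fin l → T) → Fin k → T)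
    (hf : ∀ X ∈ twistedFix z σ ε, f X ∈ twistedFix z τ δ)
    (he : ∀ Y ∈ twistedFix z τ δ, e Y ∈ twistedFix z σ ε)
    (hfe : ∀ Y ∈ twistedFix z τ δ, f (e Y) = Y)
    (hef : ∀ X ∈ twistedFix z σ ε, e (f X) = X)
    (hfc : ∀ g X, f (conjTuple g X) = conjTuple g (f X))
    (hec : ∀ g Y, e (conjTuple g Y) = conjTuple g (e Y))
    (hC : ∀ X : Fin k → T, (∀ i, X i ∈ C) → ∀ i, f X i ∈ C) :
    IsSingleOrbit z C τ δ := by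
  obtain ⟨X, hX, h1, h2, h3⟩ := h
  refine ⟨f X, hf X hX, fun Y hY => ?_, hC X h2, fun g hg => h3 g ?_⟩
  · obtain ⟨g, hg⟩ := h1 _ (he Y hY)
    exact ⟨g, by rw [← hfe Y hY, hg, hfc]⟩
  · have := congrArg e hg
    rwa [hec, hef X hX] at this

/-- The fixed points of `ε σ` form a single conjugacy class for all `ε` compatible with the values
`c` of the components of the closure of `σ`. -/
def HasSingleOrbits (z : Z →* T) (C : Set T) (c : Fin n → Z) (σ : BraidGroup k) : Prop :=
  ∀ comp : Fin k → Fin n, IsComponentNumbering σ comp → ∀ ε : Fin k → Z,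
    (∀ j, ∏ i with comp i = j, ε i = c j) → IsSingleOrbit z C σ ε

lemma HasSingleOrbits.conj {z : Z →* T} (hz : ∀ a t, z a * t = t * z a) {C : Set T}
    (hC : ∀ g, ∀ t ∈ C, g * t * g⁻¹ ∈ C) {c : Fin n → Z} {σ : BraidGroup k}
    (h : HasSingleOrbits z C c σ) (ξ : BraidGroup k) :
    HasSingleOrbits z C c (ξ⁻¹ * σ * ξ) := by
  intro comp hcomp ε hε
  have hperm : braidPerm (ξ⁻¹ * σ * ξ) = braidPerm ξ * braidPerm σ * (braidPerm ξ)⁻¹ := by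
    simp [braidPerm_mul, braidPerm_inv, mul_assoc]
  -- The action of ξ intertwines `ξ⁻¹ * σ * ξ` twisted by ε with σ twisted by ε permuted along ξ.
  have hfix : ∀ Y : Fin k → T, braidMap ξ (fun i => z (ε i) * braidMap (ξ⁻¹ * σ * ξ) Y i) =
      fun i => z (ε (braidPerm ξ i)) * braidMap σ (braidMap ξ Y) i := by
    intro Y
    funext i
    rw [braidMap_smul z hz, braidMap_mul, braidMap_mul, braidMap_cancel_inv]
  refine (h (comp ∘ braidPerm ξ) ⟨hcomp.surjective.comp (braidPerm ξ).surjective, fun i j => ?_⟩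
    (ε ∘ braidPerm ξ) fun j => ?_).transport (braidMap ξ⁻¹) (braidMap ξ) ?_ ?_
    (fun Y _ => braidMap_inv_cancel ξ Y) (fun X _ => braidMap_cancel_inv ξ X)
    (fun g X => funext fun i => lift_conj g X _) (fun g X => funext fun i => lift_conj g X _)
    (fun X hX i => braidMap_mem _ hC hX i)
  · simp only [Function.comp]
    rw [hcomp.sameCycle, hperm, Equiv.Perm.sameCycle_conj]
    simp
  · rw [← hε j, Finset.prod_filter, Finset.prod_filter]
    exact Equiv.prod_comp (braidPerm ξ) fun i => if comp i = j then ε i else 1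
  · intro X hX i
    have h1 := hfix (braidMap ξ⁻¹ X)
    rw [braidMap_cancel_inv] at h1
    have h2 : braidMap ξ (fun i => z (ε i) * braidMap (ξ⁻¹ * σ * ξ) (braidMap ξ⁻¹ X) i) = X := by
      rw [h1]; exact funext hX
    have h3 := congrArg (braidMap ξ⁻¹) h2
    rw [braidMap_inv_cancel] at h3
    exact congrFun h3 i
  · intro Y hY i
    have h1 := hfix Y
    rw [show (fun i => z (ε i) * braidMap (ξ⁻¹ * σ * ξ) Y i) = Y from funext hY] at h1
    exact (congrFun h1 i).symm

/-- Describing cycles by invariant sets lets permutations of sets of different sizes be compared by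
pulling back sets, without following powers of a stabilized permutation. -/
lemma sameCycle_iff_invariant {α : Type*} (π : Equiv.Perm α) (i j : α) :
    π.SameCycle i j ↔ ∀ S : Set α, (∀ x, π x ∈ S ↔ x ∈ S) → (i ∈ S ↔ j ∈ S) := by
  constructor
  · rintro ⟨m, rfl⟩ S hS
    have hinv : ∀ x, π⁻¹ x ∈ S ↔ x ∈ S := fun x => by
      rw [← hS, ← Equiv.Perm.mul_apply, mul_inv_cancel, Equiv.Perm.one_apply]
    induction m using Int.induction_on with
    | zero => simp
    | succ m ih =>
      exact ih.trans (by rw [add_comm, zpow_add, zpow_one, Equiv.Perm.mul_apply, hS])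
    | pred m ih =>
      exact ih.trans (by
        rw [sub_eq_neg_add, zpow_add, zpow_neg π 1, zpow_one, Equiv.Perm.mul_apply, hinv])
  · intro h
    exact (h {x | π.SameCycle i x} fun x => by
      simp [Equiv.Perm.sameCycle_apply_right]).1 (Equiv.Perm.SameCycle.refl π i)

/-! ### Adding a strand and stabilization. -/

lemma braidIncl_sig (i : Gen k) :
    braidIncl k (sig i) = sig (⟨i.1, by have := i.2; omega⟩ : Gen (k + 1)) := by
  simp [braidIncl, sig]

lemma wordOf_braidIncl (σ : BraidGroup k) :
    (∀ i : Fin k, wordOf (braidIncl k σ) i.castSucc =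
      FreeGroup.map Fin.castSucc (wordOf σ i)) ∧
      wordOf (braidIncl k σ) (Fin.last k) = FreeGroup.of (Fin.last k) := by
  -- The statement on generators does not compose, so the induction runs over all words in the old
  -- generators.
  suffices h : (∀ w, (freeAction (k + 1) (braidIncl k σ)).unop (FreeGroup.map Fin.castSucc w) =
      FreeGroup.map Fin.castSucc ((freeAction k σ).unop w)) ∧
      wordOf (braidIncl k σ) (Fin.last k) = FreeGroup.of (Fin.last k) from
    ⟨fun i => by simpa [wordOf] using h.1 (FreeGroup.of i), h.2⟩
  induction σ using braid_induction with
  | one => simp [wordOf]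
  | gen j =>
    rw [wordOf, braidIncl_sig, freeAction_sig, freeAction_sig]
    have hl : Fin.castSucc j.left = Gen.left (⟨j.1, by have := j.2; omega⟩ : Gen (k + 1)) := rfl
    have hr : Fin.castSucc j.right = Gen.right (⟨j.1, by have := j.2; omega⟩ : Gen (k + 1)) := rfl
    constructor
    · intro w
      rw [← MulEquiv.coe_toMonoidHom, ← MulEquiv.coe_toMonoidHom, ← MonoidHom.comp_apply,
        ← MonoidHom.comp_apply]
      congr 1
      ext l
      simp only [MonoidHom.comp_apply, FreeGroup.map.of, MulEquiv.coe_toMonoidHom, artinAut_of,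
        ← hl, ← hr, Fin.castSucc_inj]
      split_ifs <;> simp
    · have h1 : Fin.last k ≠ Fin.castSucc j.left := (Fin.castSucc_lt_last _).ne'
      have h2 : Fin.last k ≠ Fin.castSucc j.right := (Fin.castSucc_lt_last _).ne'
      rw [artinAut_of, ← hl, ← hr, if_neg h1, if_neg h2]
  | mul σ τ hσ hτ =>
    refine ⟨fun w => ?_, ?_⟩
    · rw [map_mul, freeAction_mul_unop, freeAction_mul_unop, hσ.1, hτ.1]
    · rw [map_mul, wordOf, freeAction_mul_unop]
      exact (congrArg _ hσ.2).trans hτ.2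
  | inv σ hσ =>
    have e : ∀ m (ρ : BraidGroup m) w, (freeAction m ρ⁻¹).unop ((freeAction m ρ).unop w) = w := by
      intro m ρ w; rw [← freeAction_mul_unop, mul_inv_cancel]; simp
    have e' : ∀ m (ρ : BraidGroup m) w, (freeAction m ρ).unop ((freeAction m ρ⁻¹).unop w) = w := by
      intro m ρ w; rw [← freeAction_mul_unop, inv_mul_cancel]; simp
    refine ⟨fun w => ?_, ?_⟩
    · have := hσ.1 ((freeAction k σ⁻¹).unop w)
      rw [e'] at this
      rw [map_inv, ← this, e]
    · have h := hσ.2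
      rw [wordOf] at h
      have := e _ (braidIncl k σ) (FreeGroup.of (Fin.last k))
      rw [h] at this
      rw [map_inv]
      exact this

lemma braidMap_braidIncl_castSucc (σ : BraidGroup k) (X : Fin (k + 1) → T) (i : Fin k) :
    braidMap (braidIncl k σ) X i.castSucc = braidMap σ (fun j => X j.castSucc) i := by
  rw [braidMap, (wordOf_braidIncl σ).1, braidMap]
  have h : (FreeGroup.lift X).comp (FreeGroup.map Fin.castSucc) =
      FreeGroup.lift fun j : Fin k => X j.castSucc := by ext j; simp
  rw [← h]; rfl

lemma braidMap_braidIncl_last (σ : BraidGroup k) (X : Fin (k + 1) → T) :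
    braidMap (braidIncl k σ) X (Fin.last k) = X (Fin.last k) := by
  rw [braidMap, (wordOf_braidIncl σ).2, FreeGroup.lift_apply_of]

lemma braidPerm_braidIncl (σ : BraidGroup k) :
    (∀ i : Fin k, braidPerm (braidIncl k σ) i.castSucc = (braidPerm σ i).castSucc) ∧
      braidPerm (braidIncl k σ) (Fin.last k) = Fin.last k := by
  induction σ using braid_induction with
  | one => simp [braidPerm]
  | gen j =>
    rw [braidIncl_sig, braidPerm_sig, braidPerm_sig]
    have hl : Gen.left (⟨j.1, by have := j.2; omega⟩ : Gen (k + 1)) = Fin.castSucc j.left := rfl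
    have hr : Gen.right (⟨j.1, by have := j.2; omega⟩ : Gen (k + 1)) = Fin.castSucc j.right := rfl
    rw [hl, hr]
    exact ⟨fun i => ((Fin.castSucc_injective k).map_swap _ _ _).symm,
      Equiv.swap_apply_of_ne_of_ne (Fin.castSucc_lt_last _).ne' (Fin.castSucc_lt_last _).ne'⟩
  | mul σ τ hσ hτ =>
    rw [map_mul, braidPerm_mul, braidPerm_mul]
    simp [hσ, hτ]
  | inv σ hσ =>
    rw [map_inv, braidPerm_inv, braidPerm_inv]
    refine ⟨fun i => ?_, ?_⟩
    · rw [Equiv.Perm.inv_eq_iff_eq, hσ.1, ← Equiv.Perm.mul_apply, mul_inv_cancel,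
        Equiv.Perm.one_apply]
    · rw [Equiv.Perm.inv_eq_iff_eq, hσ.2]

/-- A braid on the last two strands which can be used for stabilization. -/
structure IsStabilizer (s : BraidGroup (k + 2)) : Prop where
  perm : braidPerm s = Equiv.swap (Fin.last k).castSucc (Fin.last (k + 1))
  other : ∀ {T : Type} [Group T] (X : Fin (k + 2) → T) l, l ≠ (Fin.last k).castSucc →
    l ≠ Fin.last (k + 1) → braidMap s X l = X l
  last : ∀ {T : Type} [Group T] (X : Fin (k + 2) → T) (a : T), (∀ t, a * t = t * a) →
    (a * braidMap s X (Fin.last (k + 1)) = X (Fin.last (k + 1)) ↔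
      X (Fin.last (k + 1)) = a * X (Fin.last k).castSucc)
  penultimate : ∀ {T : Type} [Group T] (X : Fin (k + 2) → T) (a : T), (∀ t, a * t = t * a) →
    X (Fin.last (k + 1)) = a * X (Fin.last k).castSucc →
      braidMap s X (Fin.last k).castSucc = X (Fin.last (k + 1))

lemma lastGen_left : (lastGen k).left = (Fin.last k).castSucc := rfl

lemma lastGen_right : (lastGen k).right = Fin.last (k + 1) := rfl

lemma braidMap_sig {T : Type*} [Group T] (i : Gen k) (X : Fin k → T) (l : Fin k) :
    braidMap (sig i) X l = if l = i.left then X i.right else if l = i.right then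
      (X i.right)⁻¹ * X i.left * X i.right else X l := by
  rw [braidMap, wordOf, freeAction_sig, artinAut_of]
  split_ifs <;> simp

lemma braidMap_sig_inv {T : Type*} [Group T] (i : Gen k) (X : Fin k → T) (l : Fin k) :
    braidMap (sig i)⁻¹ X l = if l = i.left then X i.left * X i.right * (X i.left)⁻¹
      else if l = i.right then X i.left else X l := by
  have h : X = braidMap (sig i) (fun l => if l = i.left then X i.left * X i.right * (X i.left)⁻¹
      else if l = i.right then X i.left else X l) := by
    funext l
    rw [braidMap_sig]
    by_cases h1 : l = i.left
    · simp [h1, i.right_ne_left]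
    by_cases h2 : l = i.right
    · simp [h2, i.right_ne_left, mul_assoc]
    simp [h1, h2]
  conv_lhs => rw [h, braidMap_inv_cancel]

lemma isStabilizer_sig : IsStabilizer (sig (lastGen k)) where
  perm := braidPerm_sig _
  other X l h1 h2 := by rw [braidMap_sig, lastGen_left, lastGen_right, if_neg h1, if_neg h2]
  last X a ha := by
    rw [braidMap_sig, lastGen_left, lastGen_right, if_neg (Fin.castSucc_lt_last _).ne',
      if_pos rfl, mul_assoc, ← mul_assoc, ha, mul_assoc, inv_mul_eq_iff_eq_mul,
      ← mul_assoc, mul_left_inj, eq_comm]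
  penultimate X a _ _ := by rw [braidMap_sig, lastGen_left, lastGen_right, if_pos rfl]

lemma isStabilizer_sig_inv : IsStabilizer (sig (lastGen k))⁻¹ where
  perm := by rw [braidPerm_inv, braidPerm_sig, Equiv.swap_inv]; rfl
  other X l h1 h2 := by rw [braidMap_sig_inv, lastGen_left, lastGen_right, if_neg h1, if_neg h2]
  last X a _ := by
    rw [braidMap_sig_inv, lastGen_left, lastGen_right, if_neg (Fin.castSucc_lt_last _).ne',
      if_pos rfl, eq_comm]
  penultimate X a ha h := by
    rw [braidMap_sig_inv, lastGen_left, lastGen_right, if_pos rfl, h, ← mul_assoc, ← ha,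
      mul_assoc, mul_inv_cancel, mul_one]

/-- The map which identifies the last two strands. -/
def mergeLast (k : ℕ) : Fin (k + 2) → Fin (k + 1) :=
  Fin.lastCases (Fin.last k) id

@[simp] lemma mergeLast_castSucc (i : Fin (k + 1)) : mergeLast k i.castSucc = i := by
  simp [mergeLast]

@[simp] lemma mergeLast_last : mergeLast k (Fin.last (k + 1)) = Fin.last k := by
  simp [mergeLast]

lemma braidPerm_stab_castSucc {s : BraidGroup (k + 2)} (hs : IsStabilizer s)
    (σ : BraidGroup (k + 1)) (i : Fin (k + 1)) :
    braidPerm (braidIncl (k + 1) σ * s) i.castSucc =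
      if braidPerm σ i = Fin.last k then Fin.last (k + 1) else (braidPerm σ i).castSucc := by
  rw [braidPerm_mul, hs.perm, Equiv.Perm.mul_apply, (braidPerm_braidIncl σ).1]
  split_ifs with h
  · rw [h, Equiv.swap_apply_left]
  · exact Equiv.swap_apply_of_ne_of_ne (fun e => h (Fin.castSucc_injective _ e))
      (Fin.castSucc_lt_last _).ne

lemma braidPerm_stab_last {s : BraidGroup (k + 2)} (hs : IsStabilizer s)
    (σ : BraidGroup (k + 1)) :
    braidPerm (braidIncl (k + 1) σ * s) (Fin.last (k + 1)) = (Fin.last k).castSucc := by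
  rw [braidPerm_mul, hs.perm, Equiv.Perm.mul_apply, (braidPerm_braidIncl σ).2,
    Equiv.swap_apply_right]

/-- The stabilized permutation inserts the new strand into a cycle just before the old last strand.
Invariant sets therefore correspond under merging these two strands. -/
lemma sameCycle_stab {s : BraidGroup (k + 2)} (hs : IsStabilizer s) (σ : BraidGroup (k + 1))
    (x y : Fin (k + 2)) :
    (braidPerm (braidIncl (k + 1) σ * s)).SameCycle x y ↔
      (braidPerm σ).SameCycle (mergeLast k x) (mergeLast k y) := by
  rw [sameCycle_iff_invariant, sameCycle_iff_invariant]
  have hm : ∀ S : Set (Fin (k + 2)),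
      (∀ x, braidPerm (braidIncl (k + 1) σ * s) x ∈ S ↔ x ∈ S) →
      ∀ x, (mergeLast k x).castSucc ∈ S ↔ x ∈ S := by
    intro S hS x
    induction x using Fin.lastCases with
    | cast i => simp
    | last => rw [mergeLast_last, ← braidPerm_stab_last hs σ, hS]
  constructor
  · intro h S hS
    refine h (mergeLast k ⁻¹' S) fun x => ?_
    induction x using Fin.lastCases with
    | cast i =>
      rw [braidPerm_stab_castSucc hs, Set.mem_preimage, Set.mem_preimage,
        mergeLast_castSucc, ← hS i]
      split_ifs with h
      · rw [mergeLast_last, h]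
      · rw [mergeLast_castSucc]
    | last => simp [braidPerm_stab_last hs]
  · intro h S hS
    rw [← hm S hS x, ← hm S hS y]
    refine h (Fin.castSucc ⁻¹' S) fun i => ?_
    rw [Set.mem_preimage, Set.mem_preimage, ← hS i.castSucc, braidPerm_stab_castSucc hs]
    split_ifs with hi
    · rw [hi, ← braidPerm_stab_last hs σ, hS]
    · rfl

lemma isComponentNumbering_stab {s : BraidGroup (k + 2)} (hs : IsStabilizer s)
    {σ : BraidGroup (k + 1)} {comp : Fin (k + 1) → Fin n} (h : IsComponentNumbering σ comp) :
    IsComponentNumbering (braidIncl (k + 1) σ * s) (comp ∘ mergeLast k) where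
  surjective := h.surjective.comp fun i => ⟨i.castSucc, by simp⟩
  sameCycle x y := by rw [sameCycle_stab hs, ← h.sameCycle]; rfl

lemma isComponentNumbering_of_stab {s : BraidGroup (k + 2)} (hs : IsStabilizer s)
    {σ : BraidGroup (k + 1)} {comp : Fin (k + 2) → Fin n}
    (h : IsComponentNumbering (braidIncl (k + 1) σ * s) comp) :
    comp = (comp ∘ Fin.castSucc) ∘ mergeLast k ∧ IsComponentNumbering σ (comp ∘ Fin.castSucc) := by
  have h1 : comp = (comp ∘ Fin.castSucc) ∘ mergeLast k := by
    funext x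
    refine (h.sameCycle _ _).2 ?_
    rw [sameCycle_stab hs, mergeLast_castSucc]
  refine ⟨h1, ⟨fun c => ?_, fun i j => ?_⟩⟩
  · obtain ⟨x, hx⟩ := h.surjective c
    exact ⟨mergeLast k x, by rw [h1] at hx; exact hx⟩
  · have := h.sameCycle i.castSucc j.castSucc
    rw [sameCycle_stab hs, mergeLast_castSucc, mergeLast_castSucc] at this
    exact this

/-- Merging the twists of the last two strands. -/
def mergeTwists (ε : Fin (k + 2) → Z) (i : Fin (k + 1)) : Z :=
  if i = Fin.last k then ε i.castSucc * ε (Fin.last (k + 1)) else ε i.castSucc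

lemma prod_mergeTwists (ε : Fin (k + 2) → Z) (comp : Fin (k + 1) → Fin n) (j : Fin n) :
    ∏ i with comp i = j, mergeTwists ε i = ∏ i with (comp ∘ mergeLast k) i = j, ε i := by
  rw [Finset.prod_filter, Finset.prod_filter, Fin.prod_univ_castSucc (n := k + 1),
    Fin.prod_univ_castSucc (n := k), Fin.prod_univ_castSucc (n := k), mul_assoc]
  congr 1
  · exact Finset.prod_congr rfl fun i _ => by
      simp [mergeTwists, (Fin.castSucc_lt_last i).ne]
  · simp only [Function.comp, mergeLast_last, mergeLast_castSucc, mergeTwists, if_true]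
    split_ifs <;> simp

/-- Drop the last but one entry of a tuple. -/
def dropPenultimate {T : Type*} (X : Fin (k + 2) → T) (i : Fin (k + 1)) : T :=
  if i = Fin.last k then X (Fin.last (k + 1)) else X i.castSucc

/-- Insert a multiple of the last entry as the last but one entry of a tuple. -/
def insertPenultimate (a : T) (Y : Fin (k + 1) → T) : Fin (k + 2) → T :=
  Fin.snoc (fun i => if i = Fin.last k then a * Y i else Y i) (Y (Fin.last k))

/-- The equation of the new strand says exactly that the last entry is a known central multiple of
the one before it. Eliminating the penultimate entry leaves the fixed point equations of σ, the two
twists being multiplied. -/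
lemma mem_twistedFix_stab {T : Type} [Group T] {z : Z →* T} (hz : ∀ a t, z a * t = t * z a)
    {s : BraidGroup (k + 2)} (hs : IsStabilizer s) (σ : BraidGroup (k + 1)) (ε : Fin (k + 2) → Z)
    (X : Fin (k + 2) → T) :
    X ∈ twistedFix z (braidIncl (k + 1) σ * s) ε ↔
      X (Fin.last (k + 1)) = z (ε (Fin.last (k + 1))) * X (Fin.last k).castSucc ∧
      dropPenultimate X ∈ twistedFix z σ (mergeTwists ε) := by
  have key : X (Fin.last (k + 1)) = z (ε (Fin.last (k + 1))) * X (Fin.last k).castSucc →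
      (fun j : Fin (k + 1) => braidMap s X j.castSucc) = dropPenultimate X := by
    intro h
    funext j
    rw [dropPenultimate]
    split_ifs with hj
    · rw [hj, hs.penultimate X _ (hz _) h]
    · exact hs.other X _ (fun e => hj (Fin.castSucc_injective _ e)) (Fin.castSucc_lt_last _).ne
  constructor
  · intro h
    have h1 := h (Fin.last (k + 1))
    rw [braidMap_mul, braidMap_braidIncl_last, hs.last _ _ (hz _)] at h1
    refine ⟨h1, fun i => ?_⟩
    have h2 := h i.castSucc
    rw [braidMap_mul, braidMap_braidIncl_castSucc, key h1] at h2
    rw [mergeTwists]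
    split_ifs with hi
    · rw [mul_comm, map_mul, mul_assoc, h2, dropPenultimate, if_pos hi, h1, hi]
    · rw [h2, dropPenultimate, if_neg hi]
  · rintro ⟨h1, h2⟩ i
    rw [braidMap_mul]
    induction i using Fin.lastCases with
    | last => rw [braidMap_braidIncl_last, hs.last _ _ (hz _), h1]
    | cast i =>
      rw [braidMap_braidIncl_castSucc, key h1]
      have h3 := h2 i
      rw [mergeTwists, dropPenultimate] at h3
      split_ifs at h3 with hi
      · rw [h1, mul_comm (ε _), map_mul, mul_assoc, mul_right_inj] at h3
        rw [h3, hi]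
      · exact h3

lemma isSingleOrbit_stab_iff {T : Type} [Group T] {z : Z →* T} (hz : ∀ a t, z a * t = t * z a)
    {C : Set T} (hC : ∀ a, ∀ t ∈ C, z a * t ∈ C)
    {s : BraidGroup (k + 2)} (hs : IsStabilizer s) (σ : BraidGroup (k + 1))
    (ε : Fin (k + 2) → Z) :
    IsSingleOrbit z C (braidIncl (k + 1) σ * s) ε ↔ IsSingleOrbit z C σ (mergeTwists ε) := by
  set a := ε (Fin.last (k + 1)) with ha
  -- The inverse of dropping the penultimate entry: that entry is recovered from the last one by the
  -- inverse of the last twist.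
  set f : (Fin (k + 1) → T) → Fin (k + 2) → T := insertPenultimate (z a⁻¹) with hf
  have hef : ∀ X, dropPenultimate (f X) = X := by
    intro X; funext i
    rw [dropPenultimate, hf, insertPenultimate]
    split_ifs with hi <;> simp [hi]
  have hfe : ∀ Y ∈ twistedFix z (braidIncl (k + 1) σ * s) ε, f (dropPenultimate Y) = Y := by
    intro Y hY; funext i
    have h := ((mem_twistedFix_stab hz hs σ ε Y).1 hY).1
    induction i using Fin.lastCases with
    | last => simp [hf, insertPenultimate, dropPenultimate]
    | cast i =>
      simp only [hf, insertPenultimate, dropPenultimate, Fin.snoc_castSucc]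
      split_ifs with hi
      · rw [h, ← mul_assoc, ← map_mul, inv_mul_cancel, map_one, one_mul, hi]
      · rfl
  have hmem : ∀ X ∈ twistedFix z σ (mergeTwists ε),
      f X ∈ twistedFix z (braidIncl (k + 1) σ * s) ε := by
    intro X hX
    rw [mem_twistedFix_stab hz hs, hef]
    refine ⟨?_, hX⟩
    simp [hf, insertPenultimate, ha]
  have hfc : ∀ g X, f (conjTuple g X) = conjTuple g (f X) := by
    intro g X; funext i
    induction i using Fin.lastCases with
    | last => simp [hf, insertPenultimate, conjTuple]
    | cast i =>
      simp only [hf, insertPenultimate, conjTuple, Fin.snoc_castSucc]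
      split_ifs with hi
      · rw [← mul_assoc, ← mul_assoc, hz, ← mul_assoc]
      · rfl
  have hec : ∀ g (Y : Fin (k + 2) → T),
      dropPenultimate (conjTuple g Y) = conjTuple g (dropPenultimate Y) := by
    intro g X; funext i
    simp only [dropPenultimate, conjTuple]
    split_ifs <;> rfl
  have he : ∀ Y ∈ twistedFix z (braidIncl (k + 1) σ * s) ε,
      dropPenultimate Y ∈ twistedFix z σ (mergeTwists ε) :=
    fun Y hY => ((mem_twistedFix_stab hz hs σ ε Y).1 hY).2
  constructor
  · intro h
    refine h.transport dropPenultimate f he hmem (fun Y _ => hef Y) hfe hec hfc fun X hX i => ?_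
    rw [dropPenultimate]
    split_ifs <;> exact hX _
  · intro h
    refine h.transport f dropPenultimate hmem he hfe (fun Y _ => hef Y) hfc hec fun X hX i => ?_
    induction i using Fin.lastCases with
    | last => simpa [hf, insertPenultimate] using hX _
    | cast i =>
      simp only [hf, insertPenultimate, Fin.snoc_castSucc]
      split_ifs
      · exact hC _ _ (hX _)
      · exact hX _

lemma hasSingleOrbits_stab_iff {T : Type} [Group T] {z : Z →* T}
    (hz : ∀ a t, z a * t = t * z a) {C : Set T} (hC : ∀ a, ∀ t ∈ C, z a * t ∈ C)
    {c : Fin n → Z} {s : BraidGroup (k + 2)} (hs : IsStabilizer s) (σ : BraidGroup (k + 1)) :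
    HasSingleOrbits z C c (braidIncl (k + 1) σ * s) ↔ HasSingleOrbits z C c σ := by
  constructor
  · intro h comp hcomp ε hε
    -- Every twist of σ arises by merging: give the new strand the trivial twist.
    have hm : mergeTwists (Fin.snoc ε 1 : Fin (k + 2) → Z) = ε := by
      funext i
      simp [mergeTwists]
    have := h _ (isComponentNumbering_stab hs hcomp) (Fin.snoc ε 1 : Fin (k + 2) → Z) fun j => by
      rw [← prod_mergeTwists, hm, hε]
    rwa [isSingleOrbit_stab_iff hz hC hs, hm] at this
  · intro h comp hcomp ε hε
    obtain ⟨h1, h2⟩ := isComponentNumbering_of_stab hs hcomp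
    rw [isSingleOrbit_stab_iff hz hC hs]
    refine h _ h2 _ fun j => ?_
    rw [prod_mergeTwists, ← h1, hε]

lemma hasSingleOrbits_iff_of_sameClosure {T : Type} [Group T] {z : Z →* T}
    (hz : ∀ a t, z a * t = t * z a) {C : Set T} (hC : ∀ a, ∀ t ∈ C, z a * t ∈ C)
    (hC' : ∀ g, ∀ t ∈ C, g * t * g⁻¹ ∈ C) {c : Fin n → Z} {σ : BraidGroup k} {τ : BraidGroup l}
    (h : SameClosure σ τ) : HasSingleOrbits z C c σ ↔ HasSingleOrbits z C c τ := by
  let p : (Σ k : ℕ, BraidGroup k) → Prop := fun x => HasSingleOrbits z C c x.2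
  suffices ∀ x y, Relation.EqvGen MarkovMove x y → (p x ↔ p y) from this _ _ h
  intro x y hxy
  induction hxy with
  | rel x y h =>
    cases h with
    | conj k σ ξ =>
      refine ⟨fun h => h.conj hz hC' ξ, fun h => ?_⟩
      have h2 := HasSingleOrbits.conj hz hC' (σ := ξ⁻¹ * σ * ξ) h ξ⁻¹
      have e : ξ⁻¹⁻¹ * (ξ⁻¹ * σ * ξ) * ξ⁻¹ = σ := by group
      rwa [e] at h2
    | stab k σ => exact (hasSingleOrbits_stab_iff hz hC isStabilizer_sig σ).symm
    | stabInv k σ => exact (hasSingleOrbits_stab_iff hz hC isStabilizer_sig_inv σ).symm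
  | refl x => rfl
  | symm x y _ ih => exact ih.symm
  | trans x y z _ _ ih1 ih2 => exact ih1.trans ih2

end Markov

/-! ### Pairs of special unitary matrices which commute up to a primitive root of unity -/

section Pairs

open Matrix
open scoped ComplexOrder

variable {N : ℕ}

/-- The first diagonal entry of `matA N`. -/
def rootA (N : ℕ) : ℂ := if Even N then Complex.exp (2 * Real.pi * Complex.I / (2 * N)) else 1

lemma matA_eq (N : ℕ) : matA N =
    diagonal fun j : Fin N => rootA N * Complex.exp (2 * Real.pi * Complex.I / N) ^ (j : ℕ) := rfl

/-- Here and below `-(-1) ^ N` stands for (-1)^(N-1), avoiding a truncated subtraction. -/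
lemma rootA_pow (N : ℕ) [NeZero N] : rootA N ^ N = -(-1) ^ N := by
  unfold rootA
  split_ifs with h
  · rw [← Complex.exp_nat_mul, h.neg_one_pow, ← Complex.exp_pi_mul_I]
    congr 1
    have : (N : ℂ) ≠ 0 := Nat.cast_ne_zero.2 (NeZero.ne N)
    field_simp
  · rw [(Nat.not_even_iff_odd.1 h).neg_one_pow]; simp

lemma norm_rootA (N : ℕ) [NeZero N] : ‖rootA N‖ = 1 := by
  have h : ‖rootA N‖ ^ N = 1 := by rw [← norm_pow, rootA_pow]; simp
  exact (pow_eq_one_iff_of_nonneg (norm_nonneg _) (NeZero.ne N)).1 h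

lemma SU.star_mul_self {X : Mat N} (hX : X ∈ specialUnitaryGroup (Fin N) ℂ) : star X * X = 1 :=
  mem_unitaryGroup_iff'.1 (mem_specialUnitaryGroup_iff.1 hX).1

lemma SU.det_eq_one {X : Mat N} (hX : X ∈ specialUnitaryGroup (Fin N) ℂ) : X.det = 1 :=
  (mem_specialUnitaryGroup_iff.1 hX).2

lemma SU.mem_of {X : Mat N} (h : star X * X = 1) (hd : X.det = 1) :
    X ∈ specialUnitaryGroup (Fin N) ℂ :=
  mem_specialUnitaryGroup_iff.2 ⟨mem_unitaryGroup_iff'.2 h, hd⟩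

variable {ζ : ℂ} {X Y : Mat N}

/-- X is similar to ζX through Y, so the characteristic polynomial is invariant under t ↦ ζt. As ζ
is primitive, only the coefficients of degrees 0 and N can survive; one is given by the determinant,
the other by monicity. -/
lemma charpoly_of_commute_up_to [NeZero N] (hζ : IsPrimitiveRoot ζ N)
    (hX : X.det = 1) (hY : Y.det = 1) (h : X * Y = ζ • (Y * X)) :
    X.charpoly = Polynomial.X ^ N - Polynomial.C (-(-1) ^ N) := by
  have hcomp : X.charpoly.comp (Polynomial.C ζ * Polynomial.X) = X.charpoly := by
    apply Polynomial.funext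
    intro t
    rw [Polynomial.eval_comp, Polynomial.eval_mul, Polynomial.eval_C, Polynomial.eval_X,
      eval_charpoly, eval_charpoly]
    have e : (scalar (Fin N) (ζ * t) - X) * Y = ζ • (Y * (scalar (Fin N) t - X)) := by
      rw [sub_mul, mul_sub, h, smul_sub]
      congr 1
      ext i j
      simp [diagonal_mul, mul_diagonal]
      ring
    have := congrArg det e
    rw [det_mul, det_smul, det_mul, hY, Fintype.card_fin, hζ.pow_eq_one] at this
    simpa using this
  have hdeg : X.charpoly.natDegree = N := by simp [charpoly_natDegree_eq_dim]
  ext n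
  rw [Polynomial.coeff_sub, Polynomial.coeff_X_pow, Polynomial.coeff_C]
  rcases Nat.lt_trichotomy n N with hn | hn | hn
  · rw [if_neg hn.ne]
    by_cases h0 : n = 0
    · subst h0
      have := det_eq_sign_charpoly_coeff X
      rw [hX, Fintype.card_fin] at this
      have h2 : ((-1 : ℂ) ^ N) * (-1) ^ N = 1 := by rw [← mul_pow]; simp
      rw [if_pos rfl, zero_sub, neg_neg]
      linear_combination (-1 : ℂ) ^ N * this * (-1) - X.charpoly.coeff 0 * h2
    · rw [if_neg h0, sub_zero]
      have h1 := congrArg (fun p => Polynomial.coeff p n) hcomp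
      simp only [Polynomial.comp_C_mul_X_coeff] at h1
      have h2 : ζ ^ n ≠ 1 := hζ.pow_ne_one_of_pos_of_lt h0 hn
      have h3 : X.charpoly.coeff n * (ζ ^ n - 1) = 0 := by linear_combination h1
      exact (mul_eq_zero.1 h3).resolve_right (sub_ne_zero.2 h2)
  · subst hn
    have := X.charpoly_monic.coeff_natDegree
    rw [hdeg] at this
    rw [if_pos rfl, if_neg (NeZero.ne n), this, sub_zero]
  · rw [if_neg hn.ne', if_neg (by omega), sub_zero]
    exact Polynomial.coeff_eq_zero_of_natDegree_lt (by omega)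

lemma pow_of_commute_up_to [NeZero N] (hζ : IsPrimitiveRoot ζ N)
    (hX : X.det = 1) (hY : Y.det = 1) (h : X * Y = ζ • (Y * X)) :
    X ^ N = (-(-1) ^ N : ℂ) • (1 : Mat N) := by
  have := aeval_self_charpoly X
  rw [charpoly_of_commute_up_to hζ hX hY h, map_sub, map_pow, Polynomial.aeval_X,
    Polynomial.aeval_C, sub_eq_zero, Algebra.algebraMap_eq_smul_one] at this
  exact this

lemma commute_up_to_symm (hζ : ζ ≠ 0) (h : X * Y = ζ • (Y * X)) : Y * X = ζ⁻¹ • (X * Y) := by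
  rw [h, smul_smul, inv_mul_cancel₀ hζ, one_smul]

lemma mul_pow_of_commute_up_to (h : X * Y = ζ • (Y * X)) (n : ℕ) :
    X * Y ^ n = ζ ^ n • (Y ^ n * X) := by
  induction n with
  | zero => simp
  | succ n ih =>
    rw [pow_succ, ← mul_assoc, ih, smul_mul_assoc, mul_assoc, h, mul_smul_comm, smul_smul,
      mul_assoc, ← pow_succ]

lemma exists_unit_eigenvector [NeZero N] (hζ : IsPrimitiveRoot ζ N)
    (hX : X.det = 1) (hY : Y.det = 1) (h : X * Y = ζ • (Y * X)) :
    ∃ v : Fin N → ℂ, X *ᵥ v = rootA N • v ∧ star v ⬝ᵥ v = 1 := by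
  have h0 : (scalar (Fin N) (rootA N) - X).det = 0 := by
    rw [← eval_charpoly, charpoly_of_commute_up_to hζ hX hY h]
    simp [rootA_pow]
  obtain ⟨w, hw, hw'⟩ := exists_mulVec_eq_zero_iff.2 h0
  have hw2 : X *ᵥ w = rootA N • w := by
    rw [sub_mulVec, sub_eq_zero] at hw'
    rw [← hw']
    ext i
    simp [mulVec_diagonal]
  have hpos : 0 < star w ⬝ᵥ w := dotProduct_star_self_pos_iff.2 hw
  obtain ⟨r, hr⟩ : ∃ r : ℝ, star w ⬝ᵥ w = r := ⟨_, Complex.eq_re_of_ofReal_le hpos.le⟩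
  rw [hr] at hpos
  have hr0 : 0 < r := by exact_mod_cast hpos
  refine ⟨((Real.sqrt r)⁻¹ : ℂ) • w, by rw [mulVec_smul, hw2, smul_comm], ?_⟩
  rw [star_smul, smul_dotProduct, dotProduct_smul, hr]
  simp only [smul_eq_mul, star_inv₀]
  have h2 : (Real.sqrt r : ℂ) * Real.sqrt r = r := by
    rw [← Complex.ofReal_mul, Real.mul_self_sqrt hr0.le]
  have h3 : (Real.sqrt r : ℂ) ≠ 0 := by
    exact_mod_cast (Real.sqrt_pos.2 hr0).ne'
  rw [← h2, Complex.star_def, Complex.conj_ofReal]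
  field_simp

/-- A cyclic shift, up to sign. -/
def shiftMat (N : ℕ) : Mat N := of fun i j =>
  if (i : ℕ) = j + 1 then 1 else if (j : ℕ) + 1 = N ∧ (i : ℕ) = 0 then -(-1) ^ N else 0

lemma mul_shiftMat_apply [NeZero N] (U : Mat N) (i j : Fin N) :
    (U * shiftMat N) i j =
      if h : (j : ℕ) + 1 < N then U i ⟨j + 1, h⟩ else -(-1) ^ N * U i 0 := by
  rw [mul_apply]
  split_ifs with h
  · rw [Finset.sum_eq_single (⟨j + 1, h⟩ : Fin N)]
    · simp [shiftMat]
    · intro l _ hl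
      have : (l : ℕ) ≠ j + 1 := fun e => hl (Fin.ext e)
      simp [shiftMat, this, h.ne]
    · simp
  · have hj : (j : ℕ) + 1 = N := by omega
    rw [Finset.sum_eq_single (0 : Fin N)]
    · simp [shiftMat, hj, mul_comm, (NeZero.ne N).symm]
    · intro l _ hl
      have h1 : (l : ℕ) ≠ 0 := fun e => hl (Fin.ext e)
      have h2 : (l : ℕ) ≠ j + 1 := by omega
      simp [shiftMat, hl, h2]
    · simp

/-- Take a unit eigenvector v of X for `rootA N`. The vectors Y^j v are eigenvectors for the
distinct eigenvalues `rootA N * ζ ^ j`, hence orthonormal. Y shifts them cyclically, up to the sign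
Y^N = (-1)^(N-1). The resulting normal form depends only on ζ. -/
lemma exists_frame [NeZero N] (hζ : IsPrimitiveRoot ζ N)
    (hX : X ∈ specialUnitaryGroup (Fin N) ℂ) (hY : Y ∈ specialUnitaryGroup (Fin N) ℂ)
    (h : X * Y = ζ • (Y * X)) :
    ∃ U : Mat N, star U * U = 1 ∧ X * U = U * diagonal (fun j : Fin N => rootA N * ζ ^ (j : ℕ)) ∧
      Y * U = U * shiftMat N := by
  have hX1 := SU.det_eq_one hX
  have hY1 := SU.det_eq_one hY
  have hζ0 : ζ ≠ 0 := hζ.ne_zero (NeZero.ne N)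
  obtain ⟨v, hv, hv1⟩ := exists_unit_eigenvector hζ hX1 hY1 h
  have hYN := pow_of_commute_up_to hζ.inv hY1 hX1 (commute_up_to_symm hζ0 h)
  set U : Mat N := of fun i j => (Y ^ (j : ℕ) *ᵥ v) i with hU
  have hXU : X * U = U * diagonal (fun j : Fin N => rootA N * ζ ^ (j : ℕ)) := by
    ext i j
    rw [mul_diagonal]
    change (X *ᵥ (Y ^ (j : ℕ) *ᵥ v)) i = _
    rw [mulVec_mulVec, mul_pow_of_commute_up_to h, smul_mulVec, ← mulVec_mulVec, hv,
      mulVec_smul]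
    simp [hU]; ring
  refine ⟨U, ?_, hXU, ?_⟩
  · ext i j
    by_cases hij : i = j
    · subst hij
      have e1 : (star U * U) i i = star (Y ^ (i : ℕ) *ᵥ v) ⬝ᵥ (Y ^ (i : ℕ) *ᵥ v) := rfl
      have e2 : star (Y ^ (i : ℕ)) * Y ^ (i : ℕ) = 1 := SU.star_mul_self (pow_mem hY _)
      rw [e1, star_mulVec, dotProduct_mulVec, vecMul_vecMul, ← star_eq_conjTranspose, e2,
        vecMul_one, hv1, one_apply_eq]
    · rw [one_apply_ne hij]
      -- Unitarity of X makes the Gram matrix invariant under the eigenvalues, which kills its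
      -- off-diagonal entries.
      have e : star (X * U) * (X * U) = star U * U := by
        rw [star_mul, mul_assoc, ← mul_assoc (star X), SU.star_mul_self hX, one_mul]
      rw [hXU, star_mul, mul_assoc, ← mul_assoc (star U), ← mul_assoc, star_eq_conjTranspose
        (diagonal _), diagonal_conjTranspose] at e
      have e2 := congrFun (congrFun e i) j
      rw [mul_diagonal, diagonal_mul] at e2
      have hn1 : star (rootA N) * rootA N = 1 := by
        rw [Complex.star_def, Complex.conj_mul', norm_rootA]; simp
      have hn2 : star ζ * ζ = 1 := by
        rw [Complex.star_def, Complex.conj_mul', hζ.norm'_eq_one (NeZero.ne N)]; simp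
      have hn3 : ζ ^ (i : ℕ) * star (ζ ^ (i : ℕ)) = 1 := by
        rw [star_pow, ← mul_pow, mul_comm, hn2, one_pow]
      simp only [Pi.star_apply, star_mul'] at e2
      have e3 : (ζ ^ (j : ℕ) - ζ ^ (i : ℕ)) * (star U * U) i j = 0 := by
        linear_combination ζ ^ (i : ℕ) * e2 - ζ ^ (j : ℕ) * (star U * U) i j * hn3 -
          ζ ^ (i : ℕ) * star (ζ ^ (i : ℕ)) * ζ ^ (j : ℕ) * (star U * U) i j * hn1
      refine (mul_eq_zero.1 e3).resolve_left (sub_ne_zero.2 fun e4 => hij (Fin.ext ?_))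
      exact (hζ.pow_inj j.2 i.2 e4).symm
  · ext i j
    rw [mul_shiftMat_apply]
    change (Y *ᵥ (Y ^ (j : ℕ) *ᵥ v)) i = _
    rw [mulVec_mulVec, ← pow_succ']
    split_ifs with hj
    · rfl
    · have : (j : ℕ) + 1 = N := by omega
      rw [this, hYN, smul_mulVec, one_mulVec]
      simp [hU]

/-- A unitary matrix can be scaled to determinant one. -/
lemma exists_smul_mem_SU [NeZero N] {U : Mat N} (hU : star U * U = 1) :
    ∃ c : ℂ, c ≠ 0 ∧ c • U ∈ specialUnitaryGroup (Fin N) ℂ := by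
  have hdet : star U.det * U.det = 1 := by
    rw [← det_conjTranspose, ← star_eq_conjTranspose, ← det_mul, hU, det_one]
  have hd0 : U.det ≠ 0 := fun h => by simp [h] at hdet
  -- An N-th root of the inverse determinant; it has modulus one because the determinant has.
  obtain ⟨c, hc⟩ := IsAlgClosed.exists_pow_nat_eq (U.det)⁻¹ (NeZero.pos N)
  have hnd : ‖U.det‖ = 1 := by
    rw [Complex.star_def, Complex.conj_mul'] at hdet
    have : ‖U.det‖ ^ 2 = 1 := by exact_mod_cast hdet
    exact (pow_eq_one_iff_of_nonneg (norm_nonneg _) two_ne_zero).1 this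
  have hnc : ‖c‖ = 1 := by
    have : ‖c‖ ^ N = 1 := by rw [← norm_pow, hc, norm_inv, hnd, inv_one]
    exact (pow_eq_one_iff_of_nonneg (norm_nonneg _) (NeZero.ne N)).1 this
  refine ⟨c, fun h => by simp [h] at hnc, SU.mem_of ?_ ?_⟩
  · rw [star_smul, smul_mul_smul_comm, hU, Complex.star_def, Complex.conj_mul', hnc]
    simp
  · rw [det_smul, Fintype.card_fin, hc, inv_mul_cancel₀ hd0]

lemma SU.coe_mul_inv_eq {N : ℕ} (W : SU N) : (W : Mat N) * ((W⁻¹ : SU N) : Mat N) = 1 :=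
  congrArg Subtype.val (mul_inv_cancel W)

lemma SU.coe_inv_mul_eq {N : ℕ} (W : SU N) : ((W⁻¹ : SU N) : Mat N) * (W : Mat N) = 1 :=
  congrArg Subtype.val (inv_mul_cancel W)

lemma SU.coe_inv {N : ℕ} (W : SU N) : ((W⁻¹ : SU N) : Mat N) = star (W : Mat N) := rfl

/-- Pairs which commute up to the same primitive root of unity are conjugate. -/
lemma exists_conj_pair [NeZero N] (hζ : IsPrimitiveRoot ζ N) {X Y X' Y' : SU N}
    (h : (X : Mat N) * Y = ζ • ((Y : Mat N) * X))
    (h' : (X' : Mat N) * Y' = ζ • ((Y' : Mat N) * X')) :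
    ∃ W : SU N, X' = W * X * W⁻¹ ∧ Y' = W * Y * W⁻¹ := by
  obtain ⟨U, hU, h1, h2⟩ := exists_frame hζ X.2 Y.2 h
  obtain ⟨V, hV, h3, h4⟩ := exists_frame hζ X'.2 Y'.2 h'
  have hU' : U * star U = 1 := mul_eq_one_comm.1 hU
  have hVU : star (V * star U) * (V * star U) = 1 := by
    rw [star_mul, star_star, mul_assoc, ← mul_assoc (star V), hV, one_mul, hU']
  obtain ⟨c, hc, hW⟩ := exists_smul_mem_SU hVU
  -- Both frames give the same normal form, so passing from one frame to the other intertwines the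
  -- pairs.
  have key : ∀ {A B D : Mat N}, A * U = U * D → B * V = V * D →
      B * (c • (V * star U)) = (c • (V * star U)) * A := by
    intro A B D hA hB
    have hA' : star U * A = D * star U := by
      calc star U * A = star U * (A * U) * star U := by rw [mul_assoc, mul_assoc, hU', mul_one]
        _ = D * star U := by rw [hA, ← mul_assoc, hU, one_mul]
    rw [mul_smul_comm, smul_mul_assoc, ← mul_assoc, hB, mul_assoc, mul_assoc, hA']
  refine ⟨⟨c • (V * star U), hW⟩, ?_, ?_⟩
  · rw [eq_mul_inv_iff_mul_eq]; exact Subtype.ext (key h1 h3)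
  · rw [eq_mul_inv_iff_mul_eq]; exact Subtype.ext (key h2 h4)

/-- A pair which commutes up to a primitive root of unity has scalar commutant. -/
lemma eq_smul_one_of_commute_pair [NeZero N] (hζ : IsPrimitiveRoot ζ N)
    (hX : X ∈ specialUnitaryGroup (Fin N) ℂ) (hY : Y ∈ specialUnitaryGroup (Fin N) ℂ)
    (h : X * Y = ζ • (Y * X)) {M : Mat N} (h1 : M * X = X * M) (h2 : M * Y = Y * M) :
    ∃ μ : ℂ, M = μ • (1 : Mat N) := by
  obtain ⟨U, hU, hXU, hYU⟩ := exists_frame hζ hX hY h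
  have hU' : U * star U = 1 := mul_eq_one_comm.1 hU
  have key : ∀ {A D : Mat N}, A * U = U * D → M * A = A * M →
      (star U * M * U) * D = D * (star U * M * U) := by
    intro A D hA hM
    have hA' : star U * A = D * star U := by
      calc star U * A = star U * (A * U) * star U := by rw [mul_assoc, mul_assoc, hU', mul_one]
        _ = D * star U := by rw [hA, ← mul_assoc, hU, one_mul]
    rw [mul_assoc, ← hA, ← mul_assoc, mul_assoc (star U), hM, ← mul_assoc, hA', ← mul_assoc,
      ← mul_assoc]
  have k1 := key hXU h1
  have k2 := key hYU h2
  set M' := star U * M * U with hM'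
  have hr0 : rootA N ≠ 0 := fun e => by simpa [e] using norm_rootA N
  -- Commuting with a diagonal matrix with distinct entries forces a diagonal matrix; commuting with
  -- the shift then makes that diagonal constant.
  have hdiag : ∀ i j, i ≠ j → M' i j = 0 := by
    intro i j hij
    have := congrFun (congrFun k1 i) j
    rw [mul_diagonal, diagonal_mul] at this
    have e : (ζ ^ (j : ℕ) - ζ ^ (i : ℕ)) * M' i j = 0 := by
      apply mul_left_cancel₀ hr0
      linear_combination this
    refine (mul_eq_zero.1 e).resolve_left (sub_ne_zero.2 fun e4 => hij (Fin.ext ?_))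
    exact (hζ.pow_inj j.2 i.2 e4).symm
  have hM'd : M' = diagonal fun i => M' i i := by
    ext i j
    by_cases hij : i = j
    · subst hij; simp
    · rw [hdiag i j hij, diagonal_apply_ne _ hij]
  have hconst : ∀ n (hn : n < N), M' ⟨n, hn⟩ ⟨n, hn⟩ = M' 0 0 := by
    intro n
    induction n with
    | zero => intro _; rfl
    | succ n ih =>
      intro hn
      rw [← ih (by omega)]
      have := congrFun (congrFun k2 ⟨n + 1, hn⟩) ⟨n, by omega⟩
      rw [hM'd, mul_diagonal, diagonal_mul] at this
      simpa [shiftMat] using this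
  refine ⟨M' 0 0, ?_⟩
  have hM'1 : M' = M' 0 0 • (1 : Mat N) := by
    conv_lhs => rw [hM'd]
    ext i j
    by_cases hij : i = j
    · subst hij; simpa using hconst i i.2
    · simp [hij]
  calc M = U * M' * star U := by
        rw [hM', mul_assoc (star U), ← mul_assoc U, hU', one_mul, mul_assoc, hU', mul_one]
    _ = _ := by rw [hM'1]; simp [hU']

/-- The entries of a pair which commutes up to a primitive root of unity are conjugate to
`matA N`. -/
lemma exists_conj_matA [NeZero N] (hζ : IsPrimitiveRoot ζ N) {X Y : SU N}
    (h : (X : Mat N) * Y = ζ • ((Y : Mat N) * X)) :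
    ∃ P : SU N, (X : Mat N) = (P : Mat N) * matA N * ((P⁻¹ : SU N) : Mat N) := by
  have hω := Complex.isPrimitiveRoot_exp N (NeZero.ne N)
  obtain ⟨b, -, hb⟩ := hζ.eq_pow_of_pow_eq_one hω.pow_eq_one
  -- Replacing Y by the power for which ζ^b is the standard root turns the diagonal form of X into
  -- `matA N` itself, with its entries in the right order.
  obtain ⟨U, hU, h1, -⟩ := exists_frame hω X.2 (pow_mem Y.2 b) (by
    rw [mul_pow_of_commute_up_to h, hb])
  obtain ⟨c, hc, hW⟩ := exists_smul_mem_SU hU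
  refine ⟨⟨c • U, hW⟩, ?_⟩
  have e := SU.coe_mul_inv_eq (⟨c • U, hW⟩ : SU N)
  have e2 : (X : Mat N) * (c • U) = (c • U) * matA N := by
    rw [mul_smul_comm, h1, smul_mul_assoc]; rfl
  calc (X : Mat N) = (X : Mat N) * ((c • U) * (((⟨c • U, hW⟩ : SU N)⁻¹ : SU N) : Mat N)) := by
        rw [e, mul_one]
    _ = _ := by rw [← mul_assoc, e2]

/-- The determinant is `rootA N ^ N` times ω^(N(N-1)/2). For even N both factors are -1, since
ω^(N/2) = -1; for odd N both are 1. -/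
lemma matA_mem (N : ℕ) [NeZero N] : matA N ∈ specialUnitaryGroup (Fin N) ℂ := by
  have hω := Complex.isPrimitiveRoot_exp N (NeZero.ne N)
  refine SU.mem_of ?_ ?_
  · rw [matA_eq, star_eq_conjTranspose, diagonal_conjTranspose, diagonal_mul_diagonal,
      ← diagonal_one]
    congr 1
    funext j
    rw [Pi.star_apply, Complex.star_def, Complex.conj_mul', norm_mul, norm_pow, norm_rootA,
      hω.norm'_eq_one (NeZero.ne N)]
    simp
  · rw [matA_eq, det_diagonal, Finset.prod_mul_distrib, Finset.prod_const, Finset.card_univ,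
      Fintype.card_fin, rootA_pow, Finset.prod_pow_eq_pow_sum,
      Fin.sum_univ_eq_sum_range (fun i => i)]
    by_cases h : Even N
    · obtain ⟨m, hm⟩ := h
      have hs : ∑ i ∈ Finset.range N, i = m * (N - 1) := by
        have := Finset.sum_range_id_mul_two N
        have h2 : N * (N - 1) = m * (N - 1) * 2 := by
          calc N * (N - 1) = (m + m) * (N - 1) := by rw [← hm]
            _ = _ := by ring
        omega
      have hm1 : Complex.exp (2 * Real.pi * Complex.I / N) ^ m = -1 := by
        rw [← Complex.exp_nat_mul, ← Complex.exp_pi_mul_I]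
        congr 1
        have hN : (N : ℂ) ≠ 0 := Nat.cast_ne_zero.2 (NeZero.ne N)
        have hmN : (N : ℂ) = m + m := by exact_mod_cast hm
        field_simp
        rw [hmN]; ring
      have hodd : Odd (N - 1) := ⟨m - 1, by have := NeZero.ne N; omega⟩
      rw [hs, pow_mul, hm1, hodd.neg_one_pow, (show Even N from ⟨m, hm⟩).neg_one_pow]
      norm_num
    · obtain ⟨m, hm⟩ := Nat.not_even_iff_odd.1 h
      have hs : ∑ i ∈ Finset.range N, i = N * m := by
        have := Finset.sum_range_id_mul_two N
        have h2 : N * (N - 1) = N * m * 2 := by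
          have : N - 1 = m * 2 := by omega
          rw [this, mul_assoc]
        omega
      rw [hs, pow_mul, hω.pow_eq_one, (Nat.not_even_iff_odd.1 h).neg_one_pow]
      simp

/-- There are pairs which commute up to any given root of unity. -/
lemma exists_pair [NeZero N] (hζ : ζ ^ N = 1) :
    ∃ X Y : SU N, (X : Mat N) * Y = ζ • ((Y : Mat N) * X) := by
  have hω := Complex.isPrimitiveRoot_exp N (NeZero.ne N)
  set w := Complex.exp (2 * Real.pi * Complex.I / N) with hw
  obtain ⟨a, -, ha⟩ := hω.eq_pow_of_pow_eq_one hζ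
  -- Addition in `Fin N` wraps around, so this is the cyclic permutation matrix. With `matA N` it
  -- commutes up to the standard root, and a power of it gives any other root of unity.
  set B : Mat N := of fun i j => if i = j + 1 then 1 else 0 with hB
  have hBu : star B * B = 1 := by
    ext i j
    rw [star_eq_conjTranspose, mul_apply, Finset.sum_eq_single (j + 1)]
    · by_cases hij : i = j
      · subst hij; simp [hB]
      · simp [hB, hij, Ne.symm hij]
    · intro l _ hl; simp [hB, hl]
    · simp
  obtain ⟨c, hc, hcB⟩ := exists_smul_mem_SU hBu
  have hAB : matA N * (c • B) = w • ((c • B) * matA N) := by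
    rw [matA_eq]
    ext i j
    rw [diagonal_mul, Matrix.smul_apply (r := w), mul_diagonal, ← hw]
    simp only [hB, Matrix.smul_apply, of_apply, smul_eq_mul]
    split_ifs with hij
    · subst hij
      have : w ^ ((j + 1 : Fin N) : ℕ) = w ^ ((j : ℕ) + 1) := by
        rw [Fin.val_add, Fin.val_one', Nat.add_mod_mod,
          ← pow_eq_pow_mod _ hω.pow_eq_one]
      rw [this, pow_succ]; ring
    · simp
  refine ⟨⟨matA N, matA_mem N⟩, ⟨c • B, hcB⟩ ^ a, ?_⟩
  rw [← ha]
  exact mul_pow_of_commute_up_to hAB a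

end Pairs

/-! ### The affine group of the adjoint representation, and the Hopf link -/

/-- Telescoping gives (1 - c)(1 + c + ⋯ + c^(i-1)) = 1 - c^i, and averaging over i < n turns the
right side into v minus its vanishing average. The operator is a polynomial in c; its commuting with
everything that commutes with c is needed for a second commuting action. -/
lemma exists_eq_sub_of_pow_eq_one {V : Type*} [AddCommGroup V] [Module ℝ V] {n : ℕ} (hn : n ≠ 0)
    (c : Module.End ℝ V) (v : V) (hv : ∑ i ∈ Finset.range n, (c ^ i) v = 0) :
    ∃ p : Module.End ℝ V, (∀ e, Commute e c → Commute e p) ∧ v = p v - c (p v) := by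
  refine ⟨(n : ℝ)⁻¹ • ∑ i ∈ Finset.range n, ∑ j ∈ Finset.range i, c ^ j, fun e he => ?_, ?_⟩
  · exact (Commute.sum_right _ _ _ fun i _ => Commute.sum_right _ _ _ fun j _ =>
      he.pow_right j).smul_right _
  · have h : ∀ i, (∑ j ∈ Finset.range i, c ^ j) v - c ((∑ j ∈ Finset.range i, c ^ j) v) =
        v - (c ^ i) v := by
      intro i
      have := congrArg (fun f : Module.End ℝ V => f v) (mul_neg_geom_sum c i)
      simpa [sub_mul] using this
    have h2 : ∑ i ∈ Finset.range n, (v - (c ^ i) v) = (n : ℝ) • v := by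
      rw [Finset.sum_sub_distrib, hv, sub_zero, Finset.sum_const, Finset.card_range,
        Nat.cast_smul_eq_nsmul]
    have hn' : (n : ℝ) ≠ 0 := Nat.cast_ne_zero.2 hn
    rw [LinearMap.smul_apply, map_smul, ← smul_sub, LinearMap.sum_apply, map_sum,
      ← Finset.sum_sub_distrib, Finset.sum_congr rfl fun i _ => h i, h2, smul_smul,
      inv_mul_cancel₀ hn', one_smul]

lemma sum_pow_invariant {V : Type*} [AddCommGroup V] [Module ℝ V] {n : ℕ} {c : Module.End ℝ V}
    (hc : c ^ n = 1) (v : V) :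
    c (∑ i ∈ Finset.range n, (c ^ i) v) = ∑ i ∈ Finset.range n, (c ^ i) v := by
  have h := congrArg (fun f : Module.End ℝ V => f v) (mul_neg_geom_sum c n)
  simp only [hc, sub_self, sub_mul, one_mul, LinearMap.sub_apply, LinearMap.zero_apply,
    Module.End.mul_apply, LinearMap.sum_apply] at h
  exact (sub_eq_zero.1 h).symm

/-- The first cohomology of an action of `ℤ × ℤ` through a finite group and without nonzero
invariants vanishes. -/
lemma exists_eq_coboundary {V : Type*} [AddCommGroup V] [Module ℝ V] {n : ℕ} (hn : n ≠ 0)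
    {a b : Module.End ℝ V} (hab : Commute a b) (ha : a ^ n = 1) (hb : b ^ n = 1)
    (hinv : ∀ v, a v = v → b v = v → v = 0) {u v : V} (h : u + a v = v + b u) :
    ∃ x, u = x - a x ∧ v = x - b x := by
  -- The sum is fixed by a, and also by b: the cocycle relation says b u - u = a v - v, and summing
  -- over powers of a annihilates a v - v.
  have hu : ∑ i ∈ Finset.range n, (a ^ i) u = 0 := by
    refine hinv _ (sum_pow_invariant ha u) ?_
    have h1 : b u - u = a v - v := by
      rw [sub_eq_sub_iff_add_eq_add, add_comm, ← h, add_comm]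
    rw [← sub_eq_zero, map_sum, ← Finset.sum_sub_distrib]
    have h2 : ∀ i ∈ Finset.range n, b ((a ^ i) u) - (a ^ i) u = a ((a ^ i) v) - (a ^ i) v := by
      intro i _
      have e1 : b ((a ^ i) u) = (a ^ i) (b u) :=
        congrArg (fun f : Module.End ℝ V => f u) (hab.symm.pow_right i).eq
      have e2 : a ((a ^ i) v) = (a ^ i) (a v) :=
        congrArg (fun f : Module.End ℝ V => f v) ((Commute.refl a).pow_right i).eq
      rw [e1, e2, ← map_sub, ← map_sub, h1]
    rw [Finset.sum_congr rfl h2, Finset.sum_sub_distrib, ← map_sum, sum_pow_invariant ha, sub_self]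
  obtain ⟨p, -, hpu⟩ := exists_eq_sub_of_pow_eq_one hn a u hu
  -- After subtracting the coboundary of `p u` the first component is zero, so the cocycle relation
  -- makes the second component w invariant under a.
  set w := v - (p u - b (p u)) with hw
  have haw : a w = w := by
    have e : a (b (p u)) = b (a (p u)) :=
      congrArg (fun f : Module.End ℝ V => f (p u)) hab.eq
    have h3 : b u = b (p u) - b (a (p u)) := by conv_lhs => rw [hpu, map_sub]
    rw [hw, map_sub, map_sub, e]
    have h4 : a v = v + b u - u := by rw [← h]; abel
    rw [h4, h3]
    conv_lhs => enter [1, 2]; rw [hpu]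
    abel
  have hbw : ∑ i ∈ Finset.range n, (b ^ i) w = 0 := by
    refine hinv _ ?_ (sum_pow_invariant hb w)
    rw [map_sum]
    refine Finset.sum_congr rfl fun i _ => ?_
    have e1 : a ((b ^ i) w) = (b ^ i) (a w) :=
      congrArg (fun f : Module.End ℝ V => f w) (hab.pow_right i).eq
    rw [e1, haw]
  obtain ⟨q, hq, hqw⟩ := exists_eq_sub_of_pow_eq_one hn b w hbw
  -- Hence adding `q w` to `p u` corrects the second component without disturbing the first.
  have haq : a (q w) = q w := by
    have := congrArg (fun f : Module.End ℝ V => f w) (hq a hab).eq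
    simpa [haw] using this
  refine ⟨p u + q w, ?_, ?_⟩
  · rw [map_add, haq, add_sub_add_right_eq_sub, ← hpu]
  · have : v = w + (p u - b (p u)) := by rw [hw]; abel
    rw [this, map_add]
    conv_lhs => rw [hqw]
    abel

/-! ### The tangent group and its central elements. -/

section Affine

variable {N : ℕ}

/-- The semidirect product of `su(N)` and `SU(N)`, the tangent group of `SU(N)`. -/
@[ext] structure AffAd (N : ℕ) where
  vec : su N
  lin : SU N

instance : Mul (AffAd N) := ⟨fun s t => ⟨s.vec + adjoint N s.lin t.vec, s.lin * t.lin⟩⟩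
instance : One (AffAd N) := ⟨⟨0, 1⟩⟩
instance : Inv (AffAd N) := ⟨fun s => ⟨-(adjoint N s.lin⁻¹ s.vec), s.lin⁻¹⟩⟩

@[simp] lemma AffAd.vec_mul (s t : AffAd N) : (s * t).vec = s.vec + adjoint N s.lin t.vec := rfl
@[simp] lemma AffAd.lin_mul (s t : AffAd N) : (s * t).lin = s.lin * t.lin := rfl
@[simp] lemma AffAd.vec_one : (1 : AffAd N).vec = 0 := rfl
@[simp] lemma AffAd.lin_one : (1 : AffAd N).lin = 1 := rfl
@[simp] lemma AffAd.vec_inv (s : AffAd N) : s⁻¹.vec = -(adjoint N s.lin⁻¹ s.vec) := rfl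
@[simp] lemma AffAd.lin_inv (s : AffAd N) : s⁻¹.lin = s.lin⁻¹ := rfl

instance : Group (AffAd N) := Group.ofLeftAxioms
  (fun s t r => AffAd.ext (by simp [add_assoc]) (by simp [mul_assoc]))
  (fun s => AffAd.ext (by simp) (by simp))
  (fun s => AffAd.ext (by simp) (by simp))

def AffAd.linHom : AffAd N →* SU N where
  toFun := AffAd.lin
  map_one' := rfl
  map_mul' _ _ := rfl

/-- The inclusion of `SU(N)`. -/
def AffAd.ofLin : SU N →* AffAd N where
  toFun g := ⟨0, g⟩
  map_one' := rfl
  map_mul' _ _ := AffAd.ext (by simp) rfl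

lemma scalarSU_mul [NeZero N] (ζ η : rootsOfUnity N ℂ) :
    (scalarSU (ζ * η) : SU N) = scalarSU ζ * scalarSU η := by
  apply Subtype.ext
  simp [scalarSU, scalarMat, smul_smul, mul_comm]

/-- `scalarSU` as a homomorphism. -/
def scalarHom (N : ℕ) [NeZero N] : rootsOfUnity N ℂ →* SU N :=
  MonoidHom.mk' scalarSU scalarSU_mul

@[simp] lemma scalarHom_apply [NeZero N] (ζ : rootsOfUnity N ℂ) :
    scalarHom N ζ = scalarSU ζ := rfl

lemma scalarSU_central [NeZero N] (ζ : rootsOfUnity N ℂ) (g : SU N) :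
    scalarSU ζ * g = g * scalarSU ζ := by
  apply Subtype.ext
  simp [scalarSU, scalarMat]

/-- The roots of unity, as central elements of the tangent group. -/
def affCentral (N : ℕ) [NeZero N] : rootsOfUnity N ℂ →* AffAd N :=
  AffAd.ofLin.comp (scalarHom N)

lemma affCentral_central [NeZero N] (ζ : rootsOfUnity N ℂ) (t : AffAd N) :
    affCentral N ζ * t = t * affCentral N ζ := by
  refine AffAd.ext ?_ (scalarSU_central ζ t.lin)
  simp [affCentral, AffAd.ofLin, adjoint_scalarSU]

lemma coe_adjoint (g : SU N) (ξ : su N) :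
    (adjoint N g ξ : Mat N) = (g : Mat N) * ξ * ((g⁻¹ : SU N) : Mat N) := rfl

lemma adjoint_eq_self_iff (g : SU N) (ξ : su N) :
    adjoint N g ξ = ξ ↔ (ξ : Mat N) * g = (g : Mat N) * ξ := by
  rw [← Subtype.coe_inj, coe_adjoint]
  constructor
  · intro h
    conv_lhs => rw [← h, mul_assoc, SU.coe_inv_mul_eq, mul_one]
  · intro h
    rw [← h, mul_assoc, SU.coe_mul_inv_eq, mul_one]

lemma adjoint_eq_one_of_scalar {g : SU N} {c : ℂ} (h : (g : Mat N) = c • (1 : Mat N)) :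
    adjoint N g = 1 := by
  ext1 ξ
  exact (adjoint_eq_self_iff g ξ).2 (by rw [h]; simp)

lemma exists_eq_scalarSU [NeZero N] {g : SU N} {c : ℂ} (h : (g : Mat N) = c • (1 : Mat N)) :
    ∃ ζ : rootsOfUnity N ℂ, g = scalarSU ζ := by
  have hd := SU.det_eq_one g.2
  rw [h, Matrix.det_smul, Matrix.det_one, mul_one, Fintype.card_fin] at hd
  refine ⟨rootsOfUnity.mkOfPowEq c hd, Subtype.ext ?_⟩
  simp [h, scalarSU, scalarMat]

lemma su_eq_zero_of_scalar [NeZero N] {ξ : su N} {c : ℂ} (h : (ξ : Mat N) = c • (1 : Mat N)) :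
    ξ = 0 := by
  have ht := ξ.2.2
  rw [h, Matrix.trace_smul, Matrix.trace_one, Fintype.card_fin, smul_eq_mul, mul_eq_zero] at ht
  have hc : c = 0 := ht.resolve_right (Nat.cast_ne_zero.2 (NeZero.ne N))
  exact Subtype.ext (by rw [h, hc, zero_smul]; rfl)

lemma coe_eq_smul_of_eq_scalarSU_mul [NeZero N] {ζ : rootsOfUnity N ℂ} {X Y : SU N}
    (h : X * Y = scalarSU ζ * (Y * X)) :
    (X : Mat N) * Y = ((ζ : ℂˣ) : ℂ) • ((Y : Mat N) * X) := by
  have := congrArg Subtype.val h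
  simpa [scalarSU, scalarMat] using this

lemma primitive_of_coprime [NeZero N] {d : ℕ} (h : Nat.Coprime d N) :
    IsPrimitiveRoot (((omega N ^ d : rootsOfUnity N ℂ) : ℂˣ) : ℂ) N := by
  have := (Complex.isPrimitiveRoot_exp N (NeZero.ne N)).pow_of_coprime d h
  simpa [omega] using this

/-- Cocycles of a pair which commutes up to a primitive root of unity are coboundaries. -/
lemma exists_coboundary_pair [NeZero N] {ζ : ℂ} (hζ : IsPrimitiveRoot ζ N) {X Y : SU N}
    (h : (X : Mat N) * Y = ζ • ((Y : Mat N) * X)) {u v : su N}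
    (huv : u + adjoint N X v = v + adjoint N Y u) :
    ∃ ξ, u = ξ - adjoint N X ξ ∧ v = ξ - adjoint N Y ξ := by
  have hX := SU.det_eq_one X.2
  have hY := SU.det_eq_one Y.2
  have hs := commute_up_to_symm (hζ.ne_zero (NeZero.ne N)) h
  refine exists_eq_coboundary (NeZero.ne N) ?_ ?_ ?_ ?_ huv
  · obtain ⟨c, hc⟩ : ∃ c : ℂ, ((X * Y * (Y * X)⁻¹ : SU N) : Mat N) = c • (1 : Mat N) := by
      refine ⟨ζ, ?_⟩
      change (X : Mat N) * Y * (((Y * X)⁻¹ : SU N) : Mat N) = _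
      rw [h, smul_mul_assoc]
      exact congrArg _ (SU.coe_mul_inv_eq (Y * X))
    -- The commutator is scalar and the adjoint action does not see scalars, so the adjoint
    -- operators commute; they have finite order because the N-th powers of X and Y are scalar.
    have h1 : X * Y = X * Y * (Y * X)⁻¹ * (Y * X) := by group
    change adjoint N X * adjoint N Y = adjoint N Y * adjoint N X
    rw [← map_mul, h1, map_mul, adjoint_eq_one_of_scalar hc, one_mul, map_mul]
  · rw [← map_pow]
    exact adjoint_eq_one_of_scalar (c := -(-1) ^ N) (pow_of_commute_up_to hζ hX hY h)
  · rw [← map_pow]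
    exact adjoint_eq_one_of_scalar (c := -(-1) ^ N) (pow_of_commute_up_to hζ.inv hY hX hs)
  · intro ξ h1 h2
    obtain ⟨c, hc⟩ := eq_smul_one_of_commute_pair hζ X.2 Y.2 h ((adjoint_eq_self_iff X ξ).1 h1)
      ((adjoint_eq_self_iff Y ξ).1 h2)
    exact su_eq_zero_of_scalar hc

end Affine

/-! ### Twisted fixed points of σ₁² in the tangent group. -/

section Hopf

lemma braidMap_hopf {T : Type*} [Group T] (X : Fin 2 → T) :
    braidMap hopfBraid X 0 = (X 1)⁻¹ * X 0 * X 1 ∧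
      braidMap hopfBraid X 1 = (X 1)⁻¹ * (X 0)⁻¹ * X 1 * X 0 * X 1 := by
  have hl : (lastGen 0).left = 0 := rfl
  have hr : (lastGen 0).right = 1 := rfl
  rw [hopfBraid, pow_two, braidMap_mul]
  simp [braidMap_sig, hl, hr, mul_assoc]

/-- Since the two twists are inverse to each other, the two fixed point equations are the same
relation: commuting up to the second twist. -/
lemma mem_twistedFix_hopf {T Z : Type*} [Group T] [CommGroup Z] (z : Z →* T)
    (hz : ∀ a t, z a * t = t * z a) {ε : Fin 2 → Z} (hε : ε 0 * ε 1 = 1) (X : Fin 2 → T) :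
    X ∈ twistedFix z hopfBraid ε ↔ X 0 * X 1 = z (ε 1) * (X 1 * X 0) := by
  have h0 : z (ε 0) = (z (ε 1))⁻¹ := by
    rw [← map_inv]; exact congrArg z (eq_inv_of_mul_eq_one_left hε)
  have e0 : z (ε 0) * ((X 1)⁻¹ * X 0 * X 1) = X 0 ↔ X 0 * X 1 = z (ε 1) * (X 1 * X 0) := by
    rw [h0, inv_mul_eq_iff_eq_mul, mul_assoc, inv_mul_eq_iff_eq_mul, ← mul_assoc (X 1), ← hz,
      mul_assoc]
  have e1 : z (ε 1) * ((X 1)⁻¹ * (X 0)⁻¹ * X 1 * X 0 * X 1) = X 1 ↔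
      X 0 * X 1 = z (ε 1) * (X 1 * X 0) := by
    rw [← mul_assoc (z (ε 1)), mul_eq_right, mul_assoc _ (X 1), ← mul_assoc, ← mul_assoc, hz,
      ← mul_inv_rev, mul_assoc, mul_assoc, inv_mul_eq_one]
  change (∀ i, _) ↔ _
  rw [Fin.forall_fin_two, (braidMap_hopf X).1, (braidMap_hopf X).2, e0, e1, and_self]

/-- The elements of the tangent group which lie over the conjugacy class of `matA N`. -/
def overClass (N : ℕ) : Set (AffAd N) :=
  {t | ∃ P : SU N, (t.lin : Mat N) = (P : Mat N) * matA N * ((P⁻¹ : SU N) : Mat N)}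

/-- The base case of the Markov argument. The SU(N) parts are controlled by the uniqueness of clock
and shift pairs, the su(N) parts by the vanishing of first cohomology, and the centralizer by the
scalar commutant. -/
lemma isSingleOrbit_hopf {N : ℕ} [NeZero N] {ε : Fin 2 → rootsOfUnity N ℂ} (hε : ε 0 * ε 1 = 1)
    (hprim : IsPrimitiveRoot ((ε 1 : ℂˣ) : ℂ) N) :
    IsSingleOrbit (affCentral N) (overClass N) hopfBraid ε := by
  have hmem := mem_twistedFix_hopf (affCentral N) affCentral_central hε
  have hlin : ∀ t : Fin 2 → AffAd N, t ∈ twistedFix (affCentral N) hopfBraid ε →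
      ((t 0).lin : Mat N) * (t 1).lin = ((ε 1 : ℂˣ) : ℂ) • (((t 1).lin : Mat N) * (t 0).lin) :=
    fun t ht => coe_eq_smul_of_eq_scalarSU_mul (congrArg AffAd.lin ((hmem t).1 ht))
  obtain ⟨X, Y, hXY⟩ := exists_pair hprim.pow_eq_one
  have hXY' : X * Y = scalarSU (ε 1) * (Y * X) := by
    apply Subtype.ext
    simpa [scalarSU, scalarMat] using hXY
  refine ⟨![AffAd.ofLin X, AffAd.ofLin Y], ?_, ?_, ?_, ?_⟩
  · rw [hmem]
    simp only [Matrix.cons_val_zero, Matrix.cons_val_one, affCentral, MonoidHom.comp_apply]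
    rw [← map_mul, hXY', scalarHom_apply, map_mul, map_mul]
  · intro t ht
    have h1 := hlin t ht
    obtain ⟨W, hW1, hW2⟩ := exists_conj_pair hprim hXY h1
    have hv := congrArg AffAd.vec ((hmem t).1 ht)
    obtain ⟨ξ, h2, h3⟩ := exists_coboundary_pair hprim h1 (u := (t 0).vec) (v := (t 1).vec) (by
      simpa [affCentral, AffAd.ofLin, adjoint_scalarSU] using hv)
    -- Conjugating (0, X) by (ξ, W) gives the vector part ξ - Ad(WXW⁻¹)ξ, so ξ must bound the given
    -- cocycle.
    refine ⟨⟨ξ, W⟩, ?_⟩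
    funext i
    fin_cases i
    · refine AffAd.ext ?_ hW1
      change (t 0).vec = _
      rw [h2, hW1]
      simp [conjTuple, AffAd.ofLin, sub_eq_add_neg]
    · refine AffAd.ext ?_ hW2
      change (t 1).vec = _
      rw [h3, hW2]
      simp [conjTuple, AffAd.ofLin, sub_eq_add_neg]
  · intro i
    fin_cases i
    · exact exists_conj_matA hprim hXY
    · exact exists_conj_matA hprim.inv
        (commute_up_to_symm (hprim.ne_zero (NeZero.ne N)) hXY)
  · intro g hg
    have c0 := congrFun hg 0
    have c1 := congrFun hg 1
    simp only [conjTuple, Matrix.cons_val_zero, Matrix.cons_val_one] at c0 c1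
    rw [mul_inv_eq_iff_eq_mul] at c0 c1
    have d0 := congrArg (fun t => (t.lin : Mat N)) c0
    have d1 := congrArg (fun t => (t.lin : Mat N)) c1
    obtain ⟨c, hc⟩ := eq_smul_one_of_commute_pair hprim X.2 Y.2 hXY d0 d1
    obtain ⟨ζ, hζ⟩ := exists_eq_scalarSU hc
    have f0 := congrArg AffAd.vec c0
    have f1 := congrArg AffAd.vec c1
    simp only [AffAd.vec_mul, AffAd.ofLin, MonoidHom.coe_mk, OneHom.coe_mk, map_zero, add_zero,
      zero_add] at f0 f1
    obtain ⟨μ, hμ⟩ := eq_smul_one_of_commute_pair hprim X.2 Y.2 hXY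
      ((adjoint_eq_self_iff X g.vec).1 f0.symm) ((adjoint_eq_self_iff Y g.vec).1 f1.symm)
    exact ⟨ζ, AffAd.ext (su_eq_zero_of_scalar hμ).symm hζ.symm⟩

lemma hasSingleOrbits_hopf {N : ℕ} [NeZero N] {c : Fin 2 → rootsOfUnity N ℂ} (hc : c 0 * c 1 = 1)
    (hprim : ∀ j, IsPrimitiveRoot ((c j : ℂˣ) : ℂ) N) :
    HasSingleOrbits (affCentral N) (overClass N) c hopfBraid := by
  intro comp hcomp ε hε
  apply isSingleOrbit_hopf
  · rw [← Fin.prod_univ_two, ← hc, ← Fin.prod_univ_two, ← Finset.prod_fiberwise _ comp]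
    exact Finset.prod_congr rfl fun j _ => hε j
  · have hinj : Function.Injective comp := Finite.injective_iff_surjective.2 hcomp.surjective
    have := hε (comp 1)
    have hf : Finset.univ.filter (fun i => comp i = comp 1) = {1} := by
      ext i; simp [hinj.eq_iff]
    rw [hf, Finset.prod_singleton] at this
    rw [this]
    exact hprim _

end Hopf

/-! ### Velocities of curves of special unitary matrices -/

section Calculus

open Matrix

variable {N k : ℕ}

section

attribute [local instance] Matrix.normedAddCommGroup Matrix.normedSpace

/-- Derivatives of matrix curves depend only on the topology, so each rule is proved with a
convenient norm: the entrywise one here, an operator norm for the exponential. -/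
lemma hasDerivAt_mat_iff {f : ℝ → Mat N} {f' : Mat N} {x : ℝ} :
    HasDerivAt f f' x ↔ ∀ i j, HasDerivAt (fun t => f t i j) (f' i j) x := by
  have h : HasDerivAt f f' x ↔ ∀ i, HasDerivAt (fun t => f t i) (f' i) x := hasDerivAt_pi
  exact h.trans (forall_congr' fun i => hasDerivAt_pi)

lemma hasDerivAt_amb_iff {f : ℝ → Amb N k} {f' : Amb N k} {x : ℝ} :
    HasDerivAt f f' x ↔ ∀ i, HasDerivAt (fun t => f t i) (f' i) x := hasDerivAt_pi

lemma hasDerivAt_amb_prodMk {f g : ℝ → Amb N k} {f' g' : Amb N k} {x : ℝ}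
    (hf : HasDerivAt f f' x) (hg : HasDerivAt g g' x) :
    HasDerivAt (fun t => (f t, g t)) (f', g') x := hf.prodMk hg

lemma hasDerivAt_const_amb (a : Amb N k) (x : ℝ) : HasDerivAt (fun _ => a) 0 x :=
  hasDerivAt_const x a

lemma hasDerivAt_const_mat (a : Mat N) (x : ℝ) : HasDerivAt (fun _ => a) 0 x :=
  hasDerivAt_const x a

end

lemma hasDerivAt_mat_mul {f g : ℝ → Mat N} {f' g' : Mat N} {x : ℝ} (hf : HasDerivAt f f' x)
    (hg : HasDerivAt g g' x) : HasDerivAt (fun t => f t * g t) (f' * g x + f x * g') x := by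
  rw [hasDerivAt_mat_iff] at *
  intro i j
  have := HasDerivAt.fun_sum (u := Finset.univ) fun l _ => (hf i l).mul (hg l j)
  simp only [mul_apply, Matrix.add_apply, ← Finset.sum_add_distrib]
  exact this

lemma hasDerivAt_mat_star {f : ℝ → Mat N} {f' : Mat N} {x : ℝ} (hf : HasDerivAt f f' x) :
    HasDerivAt (fun t => star (f t)) (star f') x := by
  rw [hasDerivAt_mat_iff] at *
  exact fun i j => (hf j i).star

section

attribute [local instance] Matrix.linftyOpNormedRing Matrix.linftyOpNormedAlgebra

lemma hasDerivAt_exp_smul_mat (ξ : Mat N) :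
    HasDerivAt (fun t : ℝ => (NormedSpace.exp (t • ξ) : Mat N)) ξ 0 := by
  have h := hasDerivAt_exp_smul_const (𝕂 := ℝ) ξ (0 : ℝ)
  rw [zero_smul, NormedSpace.exp_zero, one_mul] at h
  exact h

end

lemma star_exp_mul_exp {ξ : Mat N} (h : star ξ = -ξ) :
    star (NormedSpace.exp ξ) * NormedSpace.exp ξ = 1 := by
  rw [star_eq_conjTranspose, ← Matrix.exp_conjTranspose, ← star_eq_conjTranspose, h,
    Matrix.exp_neg]
  exact nonsing_inv_mul _ ((isUnit_iff_isUnit_det _).1 (Matrix.isUnit_exp ξ))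

/-- Every commutator with an element of `su(N)` is the velocity of a curve in the conjugacy
class. -/
lemma exists_curve_conj [NeZero N] {X P : SU N}
    (hP : (X : Mat N) = (P : Mat N) * matA N * ((P⁻¹ : SU N) : Mat N)) (ξ : su N) :
    ∃ c : ℝ → SU N, (∀ t, ∃ R : SU N, (c t : Mat N) = (R : Mat N) * matA N *
      ((R⁻¹ : SU N) : Mat N)) ∧ c 0 = X ∧
      HasDerivAt (fun t => (c t : Mat N)) ((ξ : Mat N) * X - (X : Mat N) * ξ) 0 := by
  set g : ℝ → Mat N := fun t => NormedSpace.exp (t • (ξ : Mat N)) with hg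
  have hu : ∀ t, star (g t) * g t = 1 := fun t =>
    star_exp_mul_exp (by rw [star_smul, ξ.2.1]; simp)
  have hu' : ∀ t, g t * star (g t) = 1 := fun t => mul_eq_one_comm.1 (hu t)
  have hmem : ∀ t, g t * X * star (g t) ∈ specialUnitaryGroup (Fin N) ℂ := by
    intro t
    refine SU.mem_of ?_ ?_
    · rw [star_mul, star_mul, star_star]
      calc g t * (star (X : Mat N) * star (g t)) * (g t * X * star (g t))
          = g t * (star (X : Mat N) * ((star (g t) * g t) * X)) * star (g t) := by
            simp only [mul_assoc]
        _ = 1 := by rw [hu, one_mul, SU.star_mul_self X.2, mul_one, hu']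
    · have h1 : (g t).det * (star (g t)).det = 1 := by rw [← det_mul, hu', det_one]
      rw [det_mul, det_mul, SU.det_eq_one X.2, mul_one, h1]
  have hg0 : g 0 = 1 := by simp [hg]
  refine ⟨fun t => ⟨_, hmem t⟩, fun t => ?_, Subtype.ext (by simp [hg0]), ?_⟩
  -- The determinant of the exponential is never computed: it cancels in the conjugate of X, and the
  -- conjugating unitary matrix is rescaled into SU(N).
  · have hgP : star (g t * P) * (g t * P) = 1 := by
      rw [star_mul, mul_assoc, ← mul_assoc (star (g t)), hu, one_mul, SU.star_mul_self P.2]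
    obtain ⟨a, ha, hmem⟩ := exists_smul_mem_SU hgP
    refine ⟨⟨a • (g t * P), hmem⟩, ?_⟩
    have h1 := SU.coe_mul_inv_eq (⟨a • (g t * P), hmem⟩ : SU N)
    have h2 : (g t * X * star (g t)) * (a • (g t * P)) = a • (g t * P) * matA N := by
      rw [mul_smul_comm, smul_mul_assoc, hP]
      congr 1
      calc g t * ((P : Mat N) * matA N * ((P⁻¹ : SU N) : Mat N)) * star (g t) * (g t * P)
          = g t * ((P : Mat N) * matA N * (((P⁻¹ : SU N) : Mat N) *
            ((star (g t) * g t) * P))) := by simp only [mul_assoc]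
        _ = _ := by rw [hu, one_mul, SU.coe_inv_mul_eq, mul_one, mul_assoc]
    calc g t * X * star (g t) = (g t * X * star (g t)) * ((a • (g t * P)) *
          (((⟨a • (g t * P), hmem⟩ : SU N)⁻¹ : SU N) : Mat N)) := by rw [h1, mul_one]
      _ = _ := by rw [← mul_assoc, h2]
  · have hd := hasDerivAt_exp_smul_mat (ξ : Mat N)
    have h1 := hasDerivAt_mat_mul (hasDerivAt_mat_mul hd (hasDerivAt_const_mat (X : Mat N) 0))
      (hasDerivAt_mat_star hd)
    have h2 : (ξ : Mat N) * X - (X : Mat N) * ξ = ((ξ : Mat N) * X + g 0 * 0) * star (g 0) +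
        g 0 * X * star (ξ : Mat N) := by
      rw [hg0, ξ.2.1]; simp [sub_eq_add_neg]
    rw [h2]
    exact h1

/-- A tuple of right-trivialized tangent vectors at a tuple in `SU(N)`. -/
def affTuple (u : Fin k → su N) (X : RepSpace N k) : Fin k → AffAd N := fun i => ⟨u i, X i⟩

lemma lin_lift_affTuple (u : Fin k → su N) (X : RepSpace N k) (w : FreeGroup (Fin k)) :
    (FreeGroup.lift (affTuple u X) w).lin = FreeGroup.lift X w :=
  map_lift AffAd.linHom (affTuple u X) w

/-- The velocity of the value of a word. -/
lemma hasDerivAt_lift {c : ℝ → RepSpace N k} {u : Fin k → su N}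
    (h : ∀ i, HasDerivAt (fun t => (c t i : Mat N)) ((u i : Mat N) * c 0 i) 0)
    (w : FreeGroup (Fin k)) :
    HasDerivAt (fun t => (FreeGroup.lift (c t) w : Mat N))
      (((FreeGroup.lift (affTuple u (c 0)) w).vec : Mat N) * (FreeGroup.lift (c 0) w : Mat N))
      0 := by
  induction w using FreeGroup.induction_on with
  | C1 => simpa using hasDerivAt_const_mat (1 : Mat N) 0
  | of i => simpa [affTuple] using h i
  | inv_of i _ =>
    have h1 := hasDerivAt_mat_star (h i)
    have h2 : (((FreeGroup.lift (affTuple u (c 0)) (FreeGroup.of i)⁻¹).vec : Mat N) *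
        (FreeGroup.lift (c 0) (FreeGroup.of i)⁻¹ : Mat N)) = star ((u i : Mat N) * c 0 i) := by
      rw [star_mul, (u i).2.1, map_inv, map_inv, FreeGroup.lift_apply_of, FreeGroup.lift_apply_of,
        AffAd.vec_inv, NegMemClass.coe_neg, coe_adjoint, inv_inv, neg_mul, mul_assoc]
      change -((((c 0 i)⁻¹ : SU N) : Mat N) * (u i : Mat N) * ((c 0 i : Mat N) *
        (((c 0 i)⁻¹ : SU N) : Mat N))) = _
      rw [SU.coe_mul_inv_eq, mul_one, mul_neg]
      rfl
    rw [h2]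
    simp only [map_inv, FreeGroup.lift_apply_of]
    exact h1
  | mul x y hx hy =>
    have h1 := hasDerivAt_mat_mul hx hy
    -- Multiplication in the tangent group is the right-trivialized Leibniz rule.
    have h2 : ∀ a b : AffAd N, ((a * b).vec : Mat N) * ((a * b).lin : Mat N) =
        (a.vec : Mat N) * (a.lin : Mat N) * (b.lin : Mat N) +
          (a.lin : Mat N) * ((b.vec : Mat N) * (b.lin : Mat N)) := by
      intro a b
      rw [AffAd.vec_mul, Submodule.coe_add, coe_adjoint, AffAd.lin_mul, add_mul]
      congr 1
      · exact (mul_assoc _ _ _).symm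
      · change _ * _ * _ * ((a.lin : Mat N) * (b.lin : Mat N)) = _
        rw [mul_assoc _ _ ((a.lin : Mat N) * _), ← mul_assoc _ (a.lin : Mat N), SU.coe_inv_mul_eq,
          one_mul, mul_assoc]
    have h3 := h2 (FreeGroup.lift (affTuple u (c 0)) x) (FreeGroup.lift (affTuple u (c 0)) y)
    rw [← map_mul, lin_lift_affTuple, lin_lift_affTuple, lin_lift_affTuple] at h3
    rw [h3]
    simpa using h1

/-- With the base point fixed, every group operation is linear in the vector part; this turns
derivatives of words into linear maps. -/
lemma exists_linearMap_vec_lift (X : RepSpace N k) (w : FreeGroup (Fin k)) :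
    ∃ L : (Fin k → su N) →ₗ[ℝ] su N, ∀ u, (FreeGroup.lift (affTuple u X) w).vec = L u := by
  induction w using FreeGroup.induction_on with
  | C1 => exact ⟨0, fun u => by simp⟩
  | of i => exact ⟨LinearMap.proj i, fun u => by simp [affTuple]⟩
  | inv_of i _ =>
    refine ⟨-((adjoint N (X i)⁻¹ : Module.End ℝ (su N)) ∘ₗ LinearMap.proj i), fun u => ?_⟩
    rw [map_inv, FreeGroup.lift_apply_of]
    rfl
  | mul x y hx hy =>
    obtain ⟨L, hL⟩ := hx
    obtain ⟨M, hM⟩ := hy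
    refine ⟨L + (adjoint N (FreeGroup.lift X x) : Module.End ℝ (su N)) ∘ₗ M, fun u => ?_⟩
    rw [map_mul, AffAd.vec_mul, hL, hM, lin_lift_affTuple]
    rfl

/-- The right-trivialized derivative of the value of a word (a Fox derivative). -/
def foxDeriv (X : RepSpace N k) (w : FreeGroup (Fin k)) : (Fin k → su N) →ₗ[ℝ] su N :=
  (exists_linearMap_vec_lift X w).choose

lemma vec_lift_affTuple (u : Fin k → su N) (X : RepSpace N k) (w : FreeGroup (Fin k)) :
    (FreeGroup.lift (affTuple u X) w).vec = foxDeriv X w u :=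
  (exists_linearMap_vec_lift X w).choose_spec u

lemma hasDerivAt_lift' {c : ℝ → RepSpace N k} {X : RepSpace N k} (hc : c 0 = X)
    {u : Fin k → su N} (h : ∀ i, HasDerivAt (fun t => (c t i : Mat N)) ((u i : Mat N) * X i) 0)
    (w : FreeGroup (Fin k)) :
    HasDerivAt (fun t => (FreeGroup.lift (c t) w : Mat N))
      ((foxDeriv X w u : Mat N) * (FreeGroup.lift X w : Mat N)) 0 := by
  subst hc
  rw [← vec_lift_affTuple]
  exact hasDerivAt_lift h w

end Calculus

/-! ### Bases of tangent spaces -/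

section Frames

open Matrix

variable {N k : ℕ}

lemma sum_skewBasis_apply (c : OffDiag N → ℝ) {a b : Fin N} (hab : a < b) :
    (∑ p, c p • skewBasis p) a b =
      (c ⟨(a, b), hab.ne⟩ : ℂ) + c ⟨(b, a), hab.ne'⟩ * Complex.I := by
  have h : ∀ p : OffDiag N, (c p • skewBasis p) a b =
      (if p = ⟨(a, b), hab.ne⟩ then (c ⟨(a, b), hab.ne⟩ : ℂ) else 0) +
        if p = ⟨(b, a), hab.ne'⟩ then c ⟨(b, a), hab.ne'⟩ * Complex.I else 0 := by
    rintro ⟨⟨x, y⟩, hxy⟩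
    simp only [Subtype.mk.injEq, Prod.mk.injEq, skewBasis]
    by_cases h1 : x = a ∧ y = b
    · obtain ⟨rfl, rfl⟩ := h1
      simp [hab, hab.ne, hab.ne']
    by_cases h2 : x = b ∧ y = a
    · obtain ⟨rfl, rfl⟩ := h2
      simp [hab.not_gt, hab.ne, hab.ne']
    rw [if_neg h1, if_neg h2]
    have h2' : ¬ (y = a ∧ x = b) := fun h => h2 ⟨h.2, h.1⟩
    split_ifs <;> simp [h1, h2']
  rw [Matrix.sum_apply, Finset.sum_congr rfl fun p _ => h p, Finset.sum_add_distrib]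
  simp

lemma star_skewBasis (p : OffDiag N) : star (skewBasis p) = -skewBasis p := by
  rw [skewBasis, star_eq_conjTranspose]
  split_ifs
  · simp
  · simp [add_comm, ← single_neg]

lemma skewBasis_diag (p : OffDiag N) (a : Fin N) : skewBasis p a a = 0 := by
  obtain ⟨⟨x, y⟩, hxy⟩ := p
  have h1 : ¬ (x = a ∧ y = a) := fun h => hxy (h.1.trans h.2.symm)
  have h2 : ¬ (y = a ∧ x = a) := fun h => hxy (h.2.trans h.1.symm)
  rw [skewBasis]
  split_ifs <;> simp [h1, h2]

lemma sum_skewBasis_eq_iff (c : OffDiag N → ℝ) {ζ : Mat N} (hζ : star ζ = -ζ)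
    (hd : ∀ a, ζ a a = 0) :
    (∑ p, c p • skewBasis p = ζ) ↔ ∀ a b (hab : a < b),
      (c ⟨(a, b), hab.ne⟩ : ℂ) + c ⟨(b, a), hab.ne'⟩ * Complex.I = ζ a b := by
  constructor
  · intro h a b hab
    rw [← sum_skewBasis_apply c hab, h]
  · intro h
    have hs : star (∑ p, c p • skewBasis p) = -∑ p, c p • skewBasis p := by
      rw [star_sum, ← Finset.sum_neg_distrib]
      exact Finset.sum_congr rfl fun p _ => by rw [star_smul, star_skewBasis]; simp
    ext a b
    rcases lt_trichotomy a b with hab | rfl | hab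
    · rw [sum_skewBasis_apply c hab, h a b hab]
    · rw [hd, Matrix.sum_apply]
      exact Finset.sum_eq_zero fun p _ => by rw [Matrix.smul_apply, skewBasis_diag, smul_zero]
    · have e1 := congrFun (congrFun hs a) b
      have e2 := congrFun (congrFun hζ a) b
      rw [star_eq_conjTranspose, conjTranspose_apply, Matrix.neg_apply] at e1 e2
      rw [sum_skewBasis_apply c hab, h b a hab, e2] at e1
      exact (neg_injective e1).symm

lemma linearIndependent_skewBasis : LinearIndependent ℝ (skewBasis : OffDiag N → Mat N) := by
  rw [Fintype.linearIndependent_iff]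
  intro c hc p
  have h := (sum_skewBasis_eq_iff c (ζ := 0) (by simp) (fun _ => rfl)).1 hc
  have h' : ∀ a b (hab : a < b), c ⟨(a, b), hab.ne⟩ = 0 ∧ c ⟨(b, a), hab.ne'⟩ = 0 := by
    intro a b hab
    have := h a b hab
    exact ⟨by simpa using congrArg Complex.re this, by simpa using congrArg Complex.im this⟩
  obtain ⟨⟨x, y⟩, hxy⟩ := p
  rcases lt_or_gt_of_ne hxy with hlt | hlt
  · exact (h' x y hlt).1
  · exact (h' y x hlt).2

lemma exists_sum_skewBasis {ζ : Mat N} (hζ : star ζ = -ζ) (hd : ∀ a, ζ a a = 0) :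
    ∃ c : OffDiag N → ℝ, ∑ p, c p • skewBasis p = ζ := by
  refine ⟨fun p => if p.1.1 < p.1.2 then (ζ p.1.1 p.1.2).re else (ζ p.1.2 p.1.1).im, ?_⟩
  rw [sum_skewBasis_eq_iff _ hζ hd]
  intro a b hab
  simp only [hab, hab.not_gt, if_true, if_false]
  exact Complex.re_add_im _

/-- The right-trivialized tangent space of the conjugacy class at `g`. -/
def tangentClass (g : SU N) : Submodule ℝ (su N) :=
  LinearMap.range (1 - adjoint N g : Module.End ℝ (su N))

lemma mem_tangentClass {g : SU N} {u : su N} :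
    u ∈ tangentClass g ↔ ∃ ξ, u = ξ - adjoint N g ξ := by
  simp [tangentClass, LinearMap.mem_range, eq_comm]

lemma coe_sub_adjoint_mul (g : SU N) (ξ : su N) :
    ((ξ - adjoint N g ξ : su N) : Mat N) * g = (ξ : Mat N) * g - (g : Mat N) * ξ := by
  rw [Submodule.coe_sub, coe_adjoint, sub_mul, mul_assoc ((g : Mat N) * _), SU.coe_inv_mul_eq,
    mul_one]

lemma norm_entry_matA [NeZero N] (a : Fin N) :
    ‖rootA N * Complex.exp (2 * Real.pi * Complex.I / N) ^ (a : ℕ)‖ = 1 := by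
  rw [norm_mul, norm_pow, norm_rootA,
    (Complex.isPrimitiveRoot_exp N (NeZero.ne N)).norm'_eq_one (NeZero.ne N)]
  simp

lemma entry_matA_injective [NeZero N] {a b : Fin N}
    (h : rootA N * Complex.exp (2 * Real.pi * Complex.I / N) ^ (a : ℕ) =
      rootA N * Complex.exp (2 * Real.pi * Complex.I / N) ^ (b : ℕ)) : a = b := by
  have hr0 : rootA N ≠ 0 := fun e => by simpa [e] using norm_rootA N
  exact Fin.ext ((Complex.isPrimitiveRoot_exp N (NeZero.ne N)).pow_inj a.2 b.2
    (mul_left_cancel₀ hr0 h))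

/-- The commutators of `su(N)` with `matA N` are the products with `matA N` of the skew-Hermitian
matrices with zero diagonal. -/
lemma exists_commutator_matA_iff [NeZero N] (M : Mat N) :
    (∃ η ∈ su N, M = η * matA N - matA N * η) ↔
      ∃ ζ : Mat N, star ζ = -ζ ∧ (∀ a, ζ a a = 0) ∧ M = ζ * matA N := by
  set e : Fin N → ℂ := fun a => rootA N * Complex.exp (2 * Real.pi * Complex.I / N) ^ (a : ℕ)
    with he
  have hA : matA N = diagonal e := matA_eq N
  have hn : ∀ a, star (e a) * e a = 1 := fun a => by
    rw [Complex.star_def, Complex.conj_mul', norm_entry_matA]; simp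
  have h0 : ∀ a, e a ≠ 0 := fun a h => by have := hn a; simp [h] at this
  have hinj : ∀ a b, a ≠ b → e b - e a ≠ 0 := fun a b hab h =>
    hab (entry_matA_injective (sub_eq_zero.1 h).symm)
  have hs : ∀ a, star (e a) = (e a)⁻¹ := fun a => eq_inv_of_mul_eq_one_left (hn a)
  rw [hA]
  constructor
  · rintro ⟨η, ⟨h1, -⟩, rfl⟩
    have h1' : ∀ a b, star (η b a) = -η a b := fun a b => congrFun (congrFun h1 a) b
    -- The (a, b) entry of the commutator is η_ab (e_b - e_a); dividing by `matA N` on the right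
    -- divides it by e_b.
    refine ⟨of fun a b => η a b * (e b - e a) * (e b)⁻¹, ?_, fun a => by simp, ?_⟩
    · ext a b
      rw [star_eq_conjTranspose, conjTranspose_apply, Matrix.neg_apply, of_apply, of_apply,
        star_mul', star_mul', h1', star_sub, star_inv₀, hs, hs, inv_inv]
      have := h0 a
      have := h0 b
      field_simp
    · ext a b
      rw [Matrix.sub_apply, mul_diagonal, diagonal_mul, mul_diagonal, of_apply]
      have := h0 b
      field_simp
  · rintro ⟨ζ, h1, h2, rfl⟩
    have h1' : ∀ a b, star (ζ b a) = -ζ a b := fun a b => congrFun (congrFun h1 a) b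
    -- Off the diagonal the entries are distinct, so the previous formula can be inverted. On the
    -- diagonal the value is 0, which yields trace zero.
    refine ⟨of fun a b => ζ a b * e b * (e b - e a)⁻¹, ⟨?_, ?_⟩, ?_⟩
    · ext a b
      rw [star_eq_conjTranspose, conjTranspose_apply, Matrix.neg_apply, of_apply, of_apply]
      by_cases hab : a = b
      · subst hab; simp [h2]
      · rw [star_mul', star_mul', h1', star_inv₀, star_sub, hs, hs]
        have := h0 a
        have := h0 b
        have := hinj a b hab
        have h4 : (e a)⁻¹ - (e b)⁻¹ = (e b - e a) * (e a)⁻¹ * (e b)⁻¹ := by field_simp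
        rw [h4]
        field_simp
    · simp [Matrix.trace, h2]
    · ext a b
      rw [Matrix.sub_apply, mul_diagonal, diagonal_mul, mul_diagonal, of_apply]
      by_cases hab : a = b
      · subst hab; simp [h2]
      · have := hinj a b hab
        field_simp

/-- Conjugation by a special unitary matrix. -/
def conjLin (P : SU N) : Mat N →ₗ[ℝ] Mat N :=
  (LinearMap.mulLeft ℝ (P : Mat N)) ∘ₗ (LinearMap.mulRight ℝ ((P⁻¹ : SU N) : Mat N))

lemma conjLin_apply (P : SU N) (M : Mat N) :
    conjLin P M = (P : Mat N) * M * ((P⁻¹ : SU N) : Mat N) := (mul_assoc _ _ _).symm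

lemma conjLin_injective (P : SU N) : Function.Injective (conjLin P) := by
  have h : ∀ M, conjLin P⁻¹ (conjLin P M) = M := by
    intro M
    rw [conjLin_apply, conjLin_apply, inv_inv]
    calc ((P⁻¹ : SU N) : Mat N) * ((P : Mat N) * M * ((P⁻¹ : SU N) : Mat N)) * (P : Mat N)
        = (((P⁻¹ : SU N) : Mat N) * (P : Mat N)) * M * (((P⁻¹ : SU N) : Mat N) * (P : Mat N)) := by
          simp only [mul_assoc]
      _ = M := by rw [SU.coe_inv_mul_eq, one_mul, mul_one]
  exact Function.LeftInverse.injective h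

lemma classFrame_eq (P : SU N) : classFrame P =
    (conjLin P ∘ₗ LinearMap.mulRight ℝ (matA N)) ∘ skewBasis ∘
      (Fintype.equivFin (OffDiag N)).symm := by
  funext i
  simp only [classFrame, Function.comp, LinearMap.comp_apply, conjLin_apply]
  rfl

lemma linearIndependent_classFrame [NeZero N] (P : SU N) :
    LinearIndependent ℝ (classFrame P) := by
  have h : LinearIndependent ℝ
      (skewBasis ∘ (Fintype.equivFin (OffDiag N)).symm : _ → Mat N) :=
    linearIndependent_skewBasis.comp _ (Equiv.injective _)
  rw [classFrame_eq]
  refine h.map' _ (LinearMap.ker_eq_bot.2 ((conjLin_injective P).comp fun M M' hM => ?_))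
  let A : SU N := ⟨matA N, matA_mem N⟩
  have hM' : M * (A : Mat N) = M' * (A : Mat N) := hM
  have := congrArg (· * ((A⁻¹ : SU N) : Mat N)) hM'
  simpa only [mul_assoc, SU.coe_mul_inv_eq, mul_one] using this

/-- Conjugation by P moves the frame at `matA N`, where the tangent space was computed entrywise, to
X. This identifies the span of the orienting frame with the orbit directions. -/
lemma mem_span_classFrame [NeZero N] {X P : SU N}
    (hP : (X : Mat N) = (P : Mat N) * matA N * ((P⁻¹ : SU N) : Mat N)) (M : Mat N) :
    M ∈ Submodule.span ℝ (Set.range (classFrame P)) ↔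
      ∃ u ∈ tangentClass X, M = (u : Mat N) * X := by
  have hPi : Function.LeftInverse (conjLin P) (conjLin P⁻¹) := by
    intro M
    rw [conjLin_apply, conjLin_apply, inv_inv]
    calc (P : Mat N) * (((P⁻¹ : SU N) : Mat N) * M * (P : Mat N)) * ((P⁻¹ : SU N) : Mat N)
        = ((P : Mat N) * ((P⁻¹ : SU N) : Mat N)) * M * ((P : Mat N) * ((P⁻¹ : SU N) : Mat N)) := by
          simp only [mul_assoc]
      _ = M := by rw [SU.coe_mul_inv_eq, one_mul, mul_one]
  have hmul : ∀ A B, conjLin P (A * B) = conjLin P A * conjLin P B := by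
    intro A B
    rw [conjLin_apply, conjLin_apply, conjLin_apply]
    calc (P : Mat N) * (A * B) * ((P⁻¹ : SU N) : Mat N) =
        (P : Mat N) * A * 1 * B * ((P⁻¹ : SU N) : Mat N) := by simp only [mul_assoc, mul_one]
      _ = _ := by rw [← SU.coe_inv_mul_eq P]; simp only [mul_assoc]
  have hX : conjLin P (matA N) = X := by rw [conjLin_apply, hP]
  have e1 : M ∈ Submodule.span ℝ (Set.range (classFrame P)) ↔
      ∃ ζ : Mat N, star ζ = -ζ ∧ (∀ a, ζ a a = 0) ∧ conjLin P⁻¹ M = ζ * matA N := by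
    have hc : ∀ c : OffDiag N → ℝ, ∑ i, c ((Fintype.equivFin (OffDiag N)).symm i) • classFrame P i =
        conjLin P ((∑ p, c p • skewBasis p) * matA N) := by
      intro c
      rw [Finset.sum_mul, map_sum, ← Equiv.sum_comp (Fintype.equivFin (OffDiag N)).symm]
      refine Finset.sum_congr rfl fun i _ => ?_
      rw [smul_mul_assoc, map_smul, conjLin_apply]
      rfl
    rw [Submodule.mem_span_range_iff_exists_fun]
    constructor
    · rintro ⟨c, rfl⟩
      refine ⟨∑ p, c (Fintype.equivFin (OffDiag N) p) • skewBasis p, ?_, fun a => ?_, ?_⟩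
      · rw [star_sum, ← Finset.sum_neg_distrib]
        exact Finset.sum_congr rfl fun p _ => by rw [star_smul, star_skewBasis]; simp
      · rw [Matrix.sum_apply]
        exact Finset.sum_eq_zero fun p _ => by rw [Matrix.smul_apply, skewBasis_diag, smul_zero]
      · apply conjLin_injective P
        rw [hPi, ← hc]
        simp
    · rintro ⟨ζ, h1, h2, h3⟩
      obtain ⟨c, hc'⟩ := exists_sum_skewBasis h1 h2
      exact ⟨fun i => c ((Fintype.equivFin (OffDiag N)).symm i), by rw [hc, hc', ← h3, hPi]⟩
  rw [e1, ← exists_commutator_matA_iff]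
  constructor
  · rintro ⟨η, hη, h⟩
    have h' : M = conjLin P η * X - (X : Mat N) * conjLin P η := by
      rw [← hPi M, h, map_sub, hmul, hmul, hX]
    let ξ : su N := adjoint N P ⟨η, hη⟩
    have hξ : (ξ : Mat N) = conjLin P η := (conjLin_apply P η).symm
    exact ⟨ξ - adjoint N X ξ, mem_tangentClass.2 ⟨ξ, rfl⟩, by rw [coe_sub_adjoint_mul, hξ, h']⟩
  · rintro ⟨u, hu, rfl⟩
    obtain ⟨ξ, rfl⟩ := mem_tangentClass.1 hu
    let η : su N := adjoint N P⁻¹ ξ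
    have hη : conjLin P (η : Mat N) = ξ := by
      have : (η : Mat N) = conjLin P⁻¹ ξ := (conjLin_apply P⁻¹ ξ).symm
      rw [this, hPi]
    refine ⟨η, η.2, ?_⟩
    apply conjLin_injective P
    rw [hPi, map_sub, hmul, hmul, hX, hη, coe_sub_adjoint_mul]

/-- Right-trivialized tangent vectors as vectors of the ambient space. -/
def untriv (X : RepSpace N k) : (Fin k → su N) →ₗ[ℝ] Amb N k where
  toFun u i := (u i : Mat N) * X i
  map_add' u v := by funext i; simp [add_mul]
  map_smul' c u := by funext i; simp

lemma untriv_injective (X : RepSpace N k) : Function.Injective (untriv X) := by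
  intro u v h
  funext i
  have h1 : (u i : Mat N) * X i = (v i : Mat N) * X i := congrFun h i
  have := congrArg (· * (((X i)⁻¹ : SU N) : Mat N)) h1
  simp only [mul_assoc, SU.coe_mul_inv_eq, mul_one] at this
  exact Subtype.ext this

/-- The right-trivialized tangent space of `Q N k` at `X`. -/
def tangentQ (X : RepSpace N k) : Submodule ℝ (Fin k → su N) :=
  Submodule.pi Set.univ fun i => tangentClass (X i)

lemma mem_tangentQ {X : RepSpace N k} {u : Fin k → su N} :
    u ∈ tangentQ X ↔ ∀ i, u i ∈ tangentClass (X i) := by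
  simp [tangentQ, Submodule.mem_pi]

lemma sum_qFrame (P : RepSpace N k) (c : Fin (k * Fintype.card (OffDiag N)) → ℝ) (i : Fin k) :
    (∑ j, c j • qFrame P j) i = ∑ l, c (finProdFinEquiv (i, l)) • classFrame (P i) l := by
  rw [← Equiv.sum_comp finProdFinEquiv, Fintype.sum_prod_type, Finset.sum_apply,
    Finset.sum_eq_single i]
  · simp [Finset.sum_apply, qFrame]
  · intro b _ hb
    rw [Finset.sum_apply]
    refine Finset.sum_eq_zero fun l _ => ?_
    simp [qFrame, hb.symm]
  · simp

lemma linearIndependent_qFrame [NeZero N] (P : RepSpace N k) :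
    LinearIndependent ℝ (qFrame P) := by
  rw [Fintype.linearIndependent_iff]
  intro c hc j
  have h := congrFun hc (finProdFinEquiv.symm j).1
  rw [sum_qFrame] at h
  have := Fintype.linearIndependent_iff.1 (linearIndependent_classFrame _) _ h
    (finProdFinEquiv.symm j).2
  rwa [Prod.mk.eta, Equiv.apply_symm_apply] at this

lemma mem_span_qFrame [NeZero N] {X P : RepSpace N k} (hP : Diagonalizes P X) (v : Amb N k) :
    v ∈ Submodule.span ℝ (Set.range (qFrame P)) ↔ ∃ u ∈ tangentQ X, v = untriv X u := by
  have h1 : v ∈ Submodule.span ℝ (Set.range (qFrame P)) ↔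
      ∀ i, v i ∈ Submodule.span ℝ (Set.range (classFrame (P i))) := by
    simp only [Submodule.mem_span_range_iff_exists_fun]
    constructor
    · rintro ⟨c, rfl⟩ i
      exact ⟨_, (sum_qFrame P c i).symm⟩
    · intro h
      choose c hc using h
      refine ⟨fun j => c (finProdFinEquiv.symm j).1 (finProdFinEquiv.symm j).2, ?_⟩
      funext i
      rw [sum_qFrame, ← hc i]
      simp
  rw [h1]
  simp only [fun i => mem_span_classFrame (hP i)]
  constructor
  · intro h
    choose u hu hv using h
    exact ⟨u, mem_tangentQ.2 hu, funext hv⟩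
  · rintro ⟨u, hu, rfl⟩ i
    exact ⟨u i, mem_tangentQ.1 hu i, rfl⟩

/-- A traceless skew-Hermitian matrix is determined by its entries above the diagonal and all
diagonal entries but one, so the dimension is at most N² - 1 < 2(N² - N). The strict inequality
leaves a direction transverse to the orbit, needed to adjust an orientation. -/
lemma finrank_su_lt (hN : 2 ≤ N) (hk : 2 ≤ k) :
    Module.finrank ℝ (su N) < k * Fintype.card (OffDiag N) := by
  have : NeZero N := ⟨by omega⟩
  let f : su N →ₗ[ℝ] (OffDiag N → ℝ) × ({j : Fin N // j ≠ 0} → ℝ) :=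
    { toFun := fun ξ => (fun p => if p.1.1 < p.1.2 then ((ξ : Mat N) p.1.1 p.1.2).re
          else ((ξ : Mat N) p.1.2 p.1.1).im, fun j => ((ξ : Mat N) j.1 j.1).im)
      map_add' := fun ξ η => by
        ext p
        · simp; split_ifs <;> rfl
        · simp
      map_smul' := fun c ξ => by
        ext p <;> simp }
  have hf : Function.Injective f := by
    rw [← LinearMap.ker_eq_bot, LinearMap.ker_eq_bot']
    intro ξ hξ
    have h1 : ∀ p : OffDiag N, (if p.1.1 < p.1.2 then ((ξ : Mat N) p.1.1 p.1.2).re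
          else ((ξ : Mat N) p.1.2 p.1.1).im) = 0 := fun p => congrFun (congrArg Prod.fst hξ) p
    have h2 : ∀ j : {j : Fin N // j ≠ 0}, ((ξ : Mat N) j.1 j.1).im = 0 :=
      fun j => congrFun (congrArg Prod.snd hξ) j
    have hs : ∀ a b, star ((ξ : Mat N) b a) = -(ξ : Mat N) a b :=
      fun a b => congrFun (congrFun ξ.2.1 a) b
    have hlt : ∀ a b, a < b → (ξ : Mat N) a b = 0 := by
      intro a b hab
      have e1 := h1 ⟨(a, b), hab.ne⟩
      have e2 := h1 ⟨(b, a), hab.ne'⟩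
      simp only [hab, hab.not_gt, if_true, if_false] at e1 e2
      exact Complex.ext e1 e2
    have hd : ∀ a, a ≠ 0 → (ξ : Mat N) a a = 0 := by
      intro a ha
      refine Complex.ext ?_ (h2 ⟨a, ha⟩)
      have := congrArg Complex.re (hs a a)
      simp at this
      simp; linarith
    have h0 : (ξ : Mat N) 0 0 = 0 := by
      have ht := ξ.2.2
      have h5 : (ξ : Mat N).trace = (ξ : Mat N) 0 0 :=
        Finset.sum_eq_single 0 (fun a _ ha => hd a ha) fun h => absurd (Finset.mem_univ _) h
      rw [← h5, ht]
    apply Subtype.ext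
    ext a b
    rcases lt_trichotomy a b with hab | rfl | hab
    · exact hlt a b hab
    · by_cases ha : a = 0
      · rw [ha]; exact h0
      · exact hd a ha
    · have := hs a b
      rw [hlt b a hab, star_zero] at this
      simpa using this.symm
  have h1 := LinearMap.finrank_le_finrank_of_injective hf
  rw [Module.finrank_prod, Module.finrank_fintype_fun_eq_card,
    Module.finrank_fintype_fun_eq_card] at h1
  have h2 : Fintype.card {j : Fin N // j ≠ 0} = N - 1 := by
    rw [Fintype.card_subtype_compl]; simp
  have h3 : Fintype.card (OffDiag N) = N * N - N := by
    have : Fintype.card (OffDiag N) = (Finset.univ : Finset (Fin N)).offDiag.card := by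
      rw [Fintype.card_subtype]
      congr 1
      ext p; simp
    rw [this, Finset.offDiag_card]; simp
  have h4 : 2 * N ≤ N * N := Nat.mul_le_mul_right N hN
  have h5 : 2 * Fintype.card (OffDiag N) ≤ k * Fintype.card (OffDiag N) :=
    Nat.mul_le_mul_right _ hk
  omega

end Frames

/-! ### Orientations -/

section Orientation

variable {V : Type} [AddCommGroup V] [Module ℝ V] {m n r : ℕ}

/-- The coefficient matrix is invertible because a vector in its left kernel would be a linear
relation in `v`. -/
lemma exists_relOrientation {v : Fin m → V} {F : Fin n → V} (hmn : m = n)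
    (hv : LinearIndependent ℝ v) (hF : ∀ i, v i ∈ Submodule.span ℝ (Set.range F)) :
    ∃ s : SignType, s ≠ 0 ∧ RelOrientation s v F := by
  subst hmn
  simp only [Submodule.mem_span_range_iff_exists_fun] at hF
  choose M hM using hF
  refine ⟨SignType.sign (Matrix.of M).det, ?_, rfl, Matrix.of M, rfl, fun i => (hM i).symm⟩
  rw [ne_eq, sign_eq_zero_iff]
  intro h
  obtain ⟨w, hw, hw'⟩ := Matrix.exists_vecMul_eq_zero_iff.2 h
  refine hw (funext fun i => Fintype.linearIndependent_iff.1 hv w ?_ i)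
  calc ∑ i, w i • v i = ∑ i, ∑ j, (w i * M i j) • F j := by
        refine Finset.sum_congr rfl fun i _ => ?_
        rw [← hM i, Finset.smul_sum]
        exact Finset.sum_congr rfl fun j _ => smul_smul _ _ _
    _ = ∑ j, (Matrix.vecMul w (Matrix.of M)) j • F j := by
        rw [Finset.sum_comm]
        refine Finset.sum_congr rfl fun j _ => ?_
        rw [← Finset.sum_smul]
        rfl
    _ = 0 := by rw [hw']; simp

lemma RelOrientation.smul {s : SignType} {v : Fin m → V} {F : Fin n → V}
    (h : RelOrientation s v F) (e : Fin m → ℝ) :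
    RelOrientation (SignType.sign (∏ i, e i) * s) (fun i => e i • v i) F := by
  obtain ⟨rfl, M, hM, hv⟩ := h
  refine ⟨rfl, Matrix.diagonal e * M, ?_, fun i => ?_⟩
  · rw [Matrix.det_mul, Matrix.det_diagonal, sign_mul, hM]
  · change e i • v i = _
    rw [hv i, Finset.smul_sum]
    refine Finset.sum_congr rfl fun j _ => ?_
    rw [smul_smul, Fin.cast_eq_self, Matrix.diagonal_mul]

lemma linearIndependent_append {v : Fin m → V} {w : Fin n → V} (hv : LinearIndependent ℝ v)
    (hw : LinearIndependent ℝ w)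
    (h : Disjoint (Submodule.span ℝ (Set.range v)) (Submodule.span ℝ (Set.range w))) :
    LinearIndependent ℝ (Fin.append v w) := by
  have := hv.sum_type hw h
  rwa [← linearIndependent_equiv finSumFinEquiv, show Fin.append v w ∘ finSumFinEquiv =
    Sum.elim v w from by ext (i | i) <;> simp]

/-- A linearly independent family in the span of a longer one extends to a basis of that span, with
any orientation. -/
lemma exists_positive_extension [Module.Finite ℝ V] {F : Fin n → V} {o : Fin r → V}
    (hF : LinearIndependent ℝ F) (ho : LinearIndependent ℝ o)
    (hoF : ∀ i, o i ∈ Submodule.span ℝ (Set.range F)) (hr : r < n) :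
    ∃ (m : ℕ) (p : Fin m → V), m + r = n ∧ (∀ i, p i ∈ Submodule.span ℝ (Set.range F)) ∧
      LinearIndependent ℝ (Fin.append p o) ∧ RelOrientation 1 (Fin.append p o) F := by
  set E := Submodule.span ℝ (Set.range F) with hE
  set O := Submodule.span ℝ (Set.range o) with hO
  have hOE : O ≤ E := Submodule.span_le.2 (by rintro _ ⟨i, rfl⟩; exact hoF i)
  obtain ⟨C', hC'⟩ := Submodule.exists_isCompl O
  -- By the modular law this is a complement of the span of `o` inside E.
  set C := C' ⊓ E with hC
  have hdis : Disjoint C O := hC'.disjoint.symm.mono_left inf_le_left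
  have hsup : C ⊔ O = E := by
    rw [hC, sup_comm, ← sup_inf_assoc_of_le C' hOE, hC'.sup_eq_top, top_inf_eq]
  have hdim : Module.finrank ℝ C + r = n := by
    have h1 := Submodule.finrank_sup_add_finrank_inf_eq C O
    rw [hsup, hdis.eq_bot, finrank_bot, add_zero] at h1
    have h2 : Module.finrank ℝ E = n := by simpa using finrank_span_eq_card hF
    have h3 : Module.finrank ℝ O = r := by simpa using finrank_span_eq_card ho
    omega
  let b := Module.finBasis ℝ C
  have hind : ∀ q : Fin (Module.finrank ℝ C) → V, (∀ i, q i ∈ C) → LinearIndependent ℝ q →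
      LinearIndependent ℝ (Fin.append q o) := fun q hq hq' =>
    linearIndependent_append hq' ho
      (hdis.mono_left (Submodule.span_le.2 (by rintro _ ⟨i, rfl⟩; exact hq i)))
  have hmem : ∀ q : Fin (Module.finrank ℝ C) → V, (∀ i, q i ∈ C) →
      ∀ i, Fin.append q o i ∈ E := by
    intro q hq i
    induction i using Fin.addCases with
    | left i => rw [Fin.append_left]; exact (hq i).2
    | right i => rw [Fin.append_right]; exact hoF i
  have hbl : LinearIndependent ℝ fun i => (b i : V) :=
    b.linearIndependent.map' C.subtype (Submodule.ker_subtype C)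
  have hb0 := hind _ (fun i => (b i).2) hbl
  obtain ⟨s, hs, hrel⟩ := exists_relOrientation hdim hb0 (hmem _ fun i => (b i).2)
  let i0 : Fin (Module.finrank ℝ C) := ⟨0, by omega⟩
  -- Multiplying a single new vector by the sign corrects the orientation; `r < n` guarantees that
  -- there is one.
  let e : Fin (Module.finrank ℝ C) → ℝ := Function.update 1 i0 (s : ℝ)
  have hs2 : s * s = 1 := by cases s <;> simp_all
  have he0 : ∀ i, e i ≠ 0 := by
    intro i
    by_cases hi : i = i0
    · subst hi
      cases s <;> simp_all [e]
    · simp [e, hi]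
  have hprod : ∏ i, e i = (s : ℝ) := by
    rw [Fintype.prod_eq_single i0 fun i hi => by simp [e, hi]]
    simp [e]
  have h1 := hrel.smul (Fin.append e 1)
  have h2 : (fun i => (Fin.append e (1 : Fin r → ℝ)) i • Fin.append (fun i => (b i : V)) o i) =
      Fin.append (fun i => e i • (b i : V)) o := by
    funext i
    induction i using Fin.addCases <;> simp
  have h3 : SignType.sign (∏ i, (Fin.append e (1 : Fin r → ℝ)) i) * s = 1 := by
    rw [Fin.prod_univ_add]
    simp only [Fin.append_left, Fin.append_right, Pi.one_apply, Finset.prod_const_one, mul_one,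
      hprod]
    cases s <;> simp_all
  rw [h2, h3] at h1
  refine ⟨_, fun i => e i • (b i : V), hdim, fun i => (C.smul_mem _ (b i).2).2, ?_, h1⟩
  exact hind _ (fun i => C.smul_mem _ (b i).2) (hbl.units_smul fun i => Units.mk0 _ (he0 i))

lemma mem_span_pair_append {W : Type} [AddCommGroup W] [Module ℝ W] {v : Fin m → V}
    {w : Fin n → W} {x : V} {y : W} (hx : x ∈ Submodule.span ℝ (Set.range v))
    (hy : y ∈ Submodule.span ℝ (Set.range w)) :
    (x, y) ∈ Submodule.span ℝ
      (Set.range (Fin.append (fun i => (v i, (0 : W))) fun i => ((0 : V), w i))) := by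
  rw [Submodule.mem_span_range_iff_exists_fun] at *
  obtain ⟨a, rfl⟩ := hx
  obtain ⟨b, rfl⟩ := hy
  refine ⟨Fin.append a b, ?_⟩
  rw [Fin.sum_univ_add]
  ext <;> simp [Prod.fst_sum, Prod.snd_sum]

/-- The linear algebra of a transverse intersection of the graph of `D` with the diagonal in a fibre
of a submersion `L`. -/
lemma linearIndependent_transverse {U S : Type} [AddCommGroup U] [Module ℝ U]
    [AddCommGroup S] [Module ℝ S] (J : U →ₗ[ℝ] V) (hJ : Function.Injective J)
    (L : U →ₗ[ℝ] S) (D : U →ₗ[ℝ] U) (o : S →ₗ[ℝ] U) (W : Submodule ℝ U)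
    (hLD : ∀ u, L (D u) = L u) (hD : ∀ u ∈ W, D u = u → ∃ ξ, u = o ξ)
    {b : Fin r → S} (hb : LinearIndependent ℝ b) (hspan : Submodule.span ℝ (Set.range b) = ⊤)
    {z : Fin r → U} (hz : ∀ j, L (z j) = b j) {p : Fin m → U} (hpW : ∀ i, p i ∈ W)
    (hp : LinearIndependent ℝ (Fin.append p fun j => o (b j))) :
    LinearIndependent ℝ (Fin.append (fun j => (J (z j), (0 : V)))
      (Fin.append (Fin.append (fun i => (J (p i), J (p i))) fun i => (J (p i), J (D (p i))))
        fun j => (J (o (b j)), J (o (b j))))) := by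
  have hp' : ∀ (c : Fin m → ℝ) (d : Fin r → ℝ), ∑ i, c i • p i + ∑ j, d j • o (b j) = 0 →
      (∀ i, c i = 0) ∧ ∀ j, d j = 0 := by
    intro c d h
    have := Fintype.linearIndependent_iff.1 hp (Fin.append c d) (by
      rw [Fin.sum_univ_add]; simpa using h)
    exact ⟨fun i => by simpa using this (Fin.castAdd r i),
      fun j => by simpa using this (Fin.natAdd m j)⟩
  rw [Fintype.linearIndependent_iff] at hb ⊢
  have key : ∀ (a d : Fin r → ℝ) (c c' : Fin m → ℝ), ∑ j, a j • (J (z j), (0 : V)) +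
      (∑ i, c i • (J (p i), J (p i)) + ∑ i, c' i • (J (p i), J (D (p i))) +
        ∑ j, d j • (J (o (b j)), J (o (b j)))) = 0 →
      (∀ j, a j = 0) ∧ (∀ i, c i = 0) ∧ (∀ i, c' i = 0) ∧ ∀ j, d j = 0 := by
    intro a d c c' hg
    have h1 := congrArg Prod.fst hg
    have h2 := congrArg Prod.snd hg
    simp only [Prod.fst_add, Prod.snd_add, Prod.fst_sum, Prod.snd_sum, Prod.smul_fst,
      Prod.smul_snd, Prod.fst_zero, Prod.snd_zero, smul_zero, Finset.sum_const_zero,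
      zero_add] at h1 h2
    have k1 : ∑ j, a j • z j + (∑ i, c i • p i + ∑ i, c' i • p i + ∑ j, d j • o (b j)) = 0 :=
      hJ (by simpa [map_add, map_sum] using h1)
    have k2 : ∑ i, c i • p i + ∑ i, c' i • D (p i) + ∑ j, d j • o (b j) = 0 :=
      hJ (by simpa [map_add, map_sum] using h2)
    -- Since L does not distinguish D u from u, the two components have the same L-image except for
    -- the lifts `z`, which are therefore absent.
    have l1 := congrArg L k1
    have l2 := congrArg L k2
    simp only [map_add, map_sum, map_smul, hLD, hz, map_zero] at l1 l2
    rw [l2, add_zero] at l1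
    have ha0 : ∀ j, a j = 0 := hb a l1
    have hcc : (∀ i, c i + c' i = 0) ∧ ∀ j, d j = 0 := by
      apply hp'
      have : ∑ j, a j • z j = 0 := Finset.sum_eq_zero fun j _ => by rw [ha0, zero_smul]
      simp only [add_smul, Finset.sum_add_distrib]
      rwa [this, zero_add] at k1
    have hd0 : ∑ j, d j • o (b j) = 0 := Finset.sum_eq_zero fun j _ => by rw [hcc.2, zero_smul]
    -- The first component now gives c = -c' and d = 0, so the second one exhibits a vector fixed by
    -- D. It must be an orbit vector, which the independence of `p` from the orbit forces to vanish.
    have hfix : D (∑ i, c' i • p i) = ∑ i, c' i • p i := by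
      have e : ∑ i, c i • p i = -∑ i, c' i • p i := by
        rw [← Finset.sum_neg_distrib]
        exact Finset.sum_congr rfl fun i _ => by
          rw [← neg_smul, eq_neg_of_add_eq_zero_left (hcc.1 i)]
      rw [hd0, add_zero, e, neg_add_eq_zero] at k2
      simp only [map_sum, map_smul]
      exact k2.symm
    obtain ⟨ξ, hξ⟩ := hD _ (W.sum_mem fun i _ => W.smul_mem _ (hpW i)) hfix
    obtain ⟨f, rfl⟩ := (Submodule.mem_span_range_iff_exists_fun ℝ).1
      (show ξ ∈ Submodule.span ℝ (Set.range b) by rw [hspan]; trivial)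
    have hc0 := (hp' c' (-f) (by rw [hξ]; simp)).1
    exact ⟨ha0, fun i => by simpa [hc0] using hcc.1 i, hc0, hcc.2⟩
  intro g hg
  rw [Fin.sum_univ_add, Fin.sum_univ_add, Fin.sum_univ_add] at hg
  simp only [Fin.append_left, Fin.append_right] at hg
  obtain ⟨h1, h2, h3, h4⟩ := key _ _ _ _ hg
  intro i
  induction i using Fin.addCases with
  | left j => exact h1 j
  | right i =>
    induction i using Fin.addCases with
    | left i =>
      induction i using Fin.addCases with
      | left i => exact h2 i
      | right i => exact h3 i
    | right j => exact h4 j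

end Orientation

/-! ### Transversality at nondegenerate fixed points -/

section Transversality

open Matrix

variable {N k : ℕ}

lemma exists_curve_Q [NeZero N] {X P : RepSpace N k} (hP : Diagonalizes P X) {u : Fin k → su N}
    (hu : u ∈ tangentQ X) : ∃ c : ℝ → RepSpace N k, (∀ t, c t ∈ Q N k) ∧ c 0 = X ∧
      ∀ i, HasDerivAt (fun t => (c t i : Mat N)) ((u i : Mat N) * X i) 0 := by
  have h : ∀ i, ∃ c : ℝ → SU N, (∀ t, ∃ R : SU N, (c t : Mat N) = (R : Mat N) * matA N *
      ((R⁻¹ : SU N) : Mat N)) ∧ c 0 = X i ∧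
      HasDerivAt (fun t => (c t : Mat N)) ((u i : Mat N) * X i) 0 := by
    intro i
    obtain ⟨ξ, hξ⟩ := mem_tangentClass.1 (mem_tangentQ.1 hu i)
    rw [hξ, coe_sub_adjoint_mul]
    exact exists_curve_conj (hP i) ξ
  choose c hc h0 hd using h
  choose R hR using hc
  exact ⟨fun t i => c i t, fun t => ⟨fun i => R i t, fun i => hR i t⟩, funext h0, hd⟩

lemma hasDerivAt_coe {c : ℝ → RepSpace N k} {X : RepSpace N k} {u : Fin k → su N}
    (h : ∀ i, HasDerivAt (fun t => (c t i : Mat N)) ((u i : Mat N) * X i) 0) :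
    HasDerivAt (fun t => coe (c t)) (untriv X u) 0 :=
  hasDerivAt_amb_iff.2 h

/-- The product of the free generators. -/
def prodWord (k : ℕ) : FreeGroup (Fin k) := (List.ofFn FreeGroup.of).prod

lemma lift_prodWord {T : Type*} [Group T] (X : Fin k → T) :
    FreeGroup.lift X (prodWord k) = (List.ofFn X).prod := by
  rw [prodWord, map_prod_ofFn]
  simp

/-- The right-trivialized derivative of the action of a braid. -/
def braidDeriv (X : RepSpace N k) (σ : BraidGroup k) : (Fin k → su N) →ₗ[ℝ] (Fin k → su N) :=
  LinearMap.pi fun i => foxDeriv X (wordOf σ i)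

/-- The right-trivialized velocities of simultaneous conjugation. -/
def orbitMap (X : RepSpace N k) : su N →ₗ[ℝ] (Fin k → su N) :=
  LinearMap.pi fun i => (1 - adjoint N (X i) : Module.End ℝ (su N))

lemma orbitMap_apply (X : RepSpace N k) (ξ : su N) (i : Fin k) :
    orbitMap X ξ i = ξ - adjoint N (X i) ξ := rfl

lemma orbitMap_mem (X : RepSpace N k) (ξ : su N) : orbitMap X ξ ∈ tangentQ X :=
  mem_tangentQ.2 fun _ => mem_tangentClass.2 ⟨ξ, rfl⟩

lemma orbitFrame_eq (X : RepSpace N k) (j : Fin (Module.finrank ℝ (su N))) :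
    orbitFrame X j = untriv X (orbitMap X (Module.finBasis ℝ (su N) j)) := by
  funext i
  exact (coe_sub_adjoint_mul (X i) _).symm

/-- The derivative of εσ at a fixed point is εσ itself in the tangent group, the central twists
having no vector part. Algebraic facts about braids thereby become facts about derivatives. -/
lemma affTuple_braidDeriv [NeZero N] {σ : BraidGroup k} {ε : Fin k → rootsOfUnity N ℂ}
    {X : RepSpace N k}
    (hfix : twisted σ ε X = X) (u : Fin k → su N) :
    affTuple (braidDeriv X σ u) X =
      fun i => affCentral N (ε i) * braidMap σ (affTuple u X) i := by
  funext i
  refine AffAd.ext ?_ ?_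
  · change foxDeriv X (wordOf σ i) u = 0 + adjoint N (scalarSU (ε i)) _
    rw [adjoint_scalarSU, zero_add, ← vec_lift_affTuple]
    rfl
  · change X i = scalarSU (ε i) * (FreeGroup.lift (affTuple u X) (wordOf σ i)).lin
    rw [lin_lift_affTuple]
    exact (congrFun hfix i).symm

/-- The infinitesimal form of the invariance of the product, obtained from that invariance in the
tangent group. -/
lemma foxDeriv_prodWord_braidDeriv [NeZero N] {σ : BraidGroup k} {ε : Fin k → rootsOfUnity N ℂ}
    (hε : ∏ i, ε i = 1) {X : RepSpace N k} (hfix : twisted σ ε X = X) (u : Fin k → su N) :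
    foxDeriv X (prodWord k) (braidDeriv X σ u) = foxDeriv X (prodWord k) u := by
  rw [← vec_lift_affTuple, ← vec_lift_affTuple, lift_prodWord, lift_prodWord,
    affTuple_braidDeriv hfix, prod_ofFn_smul _ affCentral_central, hε, map_one, one_mul,
    prod_braidMap]

/-- An element (ξ - Ad(t)ξ, t) is the conjugate of (0, t) by (ξ, 1). Composing with g gives the
conjugator whose vector part is the witness. -/
lemma conj_mem_tangent (g : AffAd N) {t : AffAd N} (ht : t.vec ∈ tangentClass t.lin) :
    (g * t * g⁻¹).vec ∈ tangentClass (g * t * g⁻¹).lin := by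
  obtain ⟨ξ, hξ⟩ := mem_tangentClass.1 ht
  refine mem_tangentClass.2 ⟨g.vec + adjoint N g.lin ξ, ?_⟩
  have e : adjoint N (g.lin * t.lin * g.lin⁻¹) (adjoint N g.lin ξ) =
      adjoint N g.lin (adjoint N t.lin ξ) := by
    rw [← Module.End.mul_apply, ← map_mul, inv_mul_cancel_right, map_mul]; rfl
  have e2 : adjoint N (g.lin * t.lin) (adjoint N g.lin⁻¹ g.vec) =
      adjoint N (g.lin * t.lin * g.lin⁻¹) g.vec := by
    rw [← Module.End.mul_apply, ← map_mul]
  change g.vec + adjoint N g.lin t.vec + adjoint N (g.lin * t.lin) (-(adjoint N g.lin⁻¹ g.vec)) =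
    g.vec + adjoint N g.lin ξ - adjoint N (g.lin * t.lin * g.lin⁻¹) (g.vec + adjoint N g.lin ξ)
  rw [map_neg, e2, map_add, e, hξ, map_sub]
  abel

lemma braidDeriv_mem [NeZero N] {σ : BraidGroup k} {ε : Fin k → rootsOfUnity N ℂ} {X : RepSpace N k}
    (hfix : twisted σ ε X = X) {u : Fin k → su N} (hu : u ∈ tangentQ X) :
    braidDeriv X σ u ∈ tangentQ X := by
  rw [mem_tangentQ]
  intro i
  have h1 := braidMap_mem σ (C := {t : AffAd N | t.vec ∈ tangentClass t.lin})
    (fun g t ht => conj_mem_tangent g ht) (X := affTuple u X) (mem_tangentQ.1 hu) i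
  have h2 := congrFun (affTuple_braidDeriv hfix u) i
  have h3 : X i = scalarSU (ε i) * (braidMap σ (affTuple u X) i).lin := congrArg AffAd.lin h2
  have h4 : adjoint N (X i) = adjoint N (braidMap σ (affTuple u X) i).lin := by
    rw [h3, map_mul, adjoint_scalarSU, one_mul]
  have h5 : braidDeriv X σ u i = (braidMap σ (affTuple u X) i).vec :=
    (vec_lift_affTuple u X (wordOf σ i)).symm
  rw [tangentClass, h4, h5]
  exact h1

/-- The derivative of the product is u₁ + Ad(X₁)u₂ + Ad(X₁X₂)u₃ + ⋯. Varying u₁ alone makes f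
invariant under X₁; then f absorbs the leading Ad(X₁) from the other terms and the argument repeats.
-/
lemma invariant_of_vanish {X : RepSpace N k} (f : su N →ₗ[ℝ] ℝ)
    (hf : ∀ u ∈ tangentQ X, f (List.ofFn (affTuple u X)).prod.vec = 0) :
    ∀ i ξ, f (adjoint N (X i) ξ) = f ξ := by
  induction k with
  | zero => exact fun i => i.elim0
  | succ n ih =>
    have hcons : ∀ u : Fin (n + 1) → su N, (List.ofFn (affTuple u X)).prod.vec =
        u 0 + adjoint N (X 0)
          (List.ofFn (affTuple (fun i => u i.succ) fun i => X i.succ)).prod.vec := by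
      intro u
      rw [List.ofFn_succ, List.prod_cons]
      rfl
    have hzero : (List.ofFn (affTuple (0 : Fin n → su N) fun i => X i.succ)).prod.vec = 0 := by
      rw [← lift_prodWord, vec_lift_affTuple, map_zero]
    have h0 : ∀ ξ, f (adjoint N (X 0) ξ) = f ξ := by
      intro ξ
      have h1 := hf (Fin.cons (ξ - adjoint N (X 0) ξ) 0) (mem_tangentQ.2 fun i => by
        induction i using Fin.cases with
        | zero => exact mem_tangentClass.2 ⟨ξ, rfl⟩
        | succ i => exact Submodule.zero_mem _)
      rw [hcons] at h1
      have h2 : (fun i : Fin n =>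
        (Fin.cons (ξ - adjoint N (X 0) ξ) 0 : Fin (n + 1) → su N) i.succ) = 0 := rfl
      rw [h2, hzero, map_zero, add_zero, Fin.cons_zero, map_sub, sub_eq_zero] at h1
      exact h1.symm
    intro i
    induction i using Fin.cases with
    | zero => exact h0
    | succ i =>
      refine ih (X := fun i => X i.succ) (fun u hu => ?_) i
      have h1 := hf (Fin.cons 0 u) (mem_tangentQ.2 fun i => by
        induction i using Fin.cases with
        | zero => exact Submodule.zero_mem _
        | succ i => exact mem_tangentQ.1 hu i)
      rw [hcons, Fin.cons_zero, zero_add, h0] at h1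
      exact h1

/-- The form `Re tr (η* ξ)` on `su(N)`. -/
def traceForm (N : ℕ) : su N →ₗ[ℝ] Module.Dual ℝ (su N) :=
  LinearMap.mk₂ ℝ (fun η ξ => (star (η : Mat N) * (ξ : Mat N)).trace.re)
    (fun η η' ξ => by simp [add_mul]) (fun c η ξ => by simp)
    (fun η ξ ξ' => by simp [mul_add]) (fun c η ξ => by simp)

lemma traceForm_apply (η ξ : su N) :
    traceForm N η ξ = (star (η : Mat N) * (ξ : Mat N)).trace.re := rfl

lemma traceForm_injective : Function.Injective (traceForm N) := by
  rw [← LinearMap.ker_eq_bot, LinearMap.ker_eq_bot']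
  intro η h
  have h1 : (star (η : Mat N) * (η : Mat N)).trace.re = 0 := by
    rw [← traceForm_apply, h]; rfl
  have h2 : (star (η : Mat N) * (η : Mat N)).trace.re =
      ∑ j, ∑ i, Complex.normSq ((η : Mat N) i j) := by
    simp [Matrix.trace, mul_apply, Complex.normSq_apply]
  rw [h2, Finset.sum_eq_zero_iff_of_nonneg
    fun j _ => Finset.sum_nonneg fun i _ => Complex.normSq_nonneg _] at h1
  apply Subtype.ext
  ext i j
  have h3 := h1 j (Finset.mem_univ j)
  rw [Finset.sum_eq_zero_iff_of_nonneg fun i _ => Complex.normSq_nonneg _] at h3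
  exact Complex.normSq_eq_zero.1 (h3 i (Finset.mem_univ i))

lemma traceForm_adjoint (g : SU N) (η ξ : su N) :
    traceForm N (adjoint N g η) (adjoint N g ξ) = traceForm N η ξ := by
  have h1 := SU.star_mul_self g.2
  rw [traceForm_apply, traceForm_apply, coe_adjoint, coe_adjoint, SU.coe_inv, star_mul, star_mul,
    star_star]
  congr 1
  calc ((g : Mat N) * (star (η : Mat N) * star (g : Mat N)) *
        ((g : Mat N) * ξ * star (g : Mat N))).trace
      = ((g : Mat N) * (star (η : Mat N) * (star (g : Mat N) * (g : Mat N)) * ξ *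
        star (g : Mat N))).trace := by simp only [mul_assoc]
    _ = _ := by
        rw [h1, mul_one, trace_mul_comm, mul_assoc, h1, mul_one]

/-- The product map is a submersion at irreducible tuples. -/
lemma exists_foxDeriv_prodWord_eq {X : RepSpace N k}
    (hinv : ∀ ξ : su N, (∀ i, adjoint N (X i) ξ = ξ) → ξ = 0) (η : su N) :
    ∃ u ∈ tangentQ X, foxDeriv X (prodWord k) u = η := by
  suffices h : (tangentQ X).map (foxDeriv X (prodWord k)) = ⊤ by
    have : η ∈ (tangentQ X).map (foxDeriv X (prodWord k)) := by rw [h]; trivial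
    exact this
  by_contra hne
  -- A functional annihilating the image is invariant under all X i. The invariant trace form
  -- represents it by an invariant element of su(N), which must be zero.
  obtain ⟨f, hf0, hf⟩ := Submodule.exists_le_ker_of_lt_top _ (lt_top_iff_ne_top.2 hne)
  have h1 := invariant_of_vanish (X := X) f fun u hu => by
    rw [← lift_prodWord, vec_lift_affTuple]
    exact hf (Submodule.mem_map_of_mem hu)
  have hsurj : Function.Surjective (traceForm N) :=
    (LinearMap.injective_iff_surjective_of_finrank_eq_finrank
      Subspace.dual_finrank_eq.symm).1 traceForm_injective
  obtain ⟨ζ, rfl⟩ := hsurj f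
  refine hf0 ?_
  rw [hinv ζ fun i => traceForm_injective (LinearMap.ext fun ξ => ?_), map_zero]
  have h2 : ξ = adjoint N (X i) (adjoint N (X i)⁻¹ ξ) := by
    rw [← Module.End.mul_apply, ← map_mul, mul_inv_cancel, map_one]; rfl
  conv_lhs => rw [h2]
  rw [traceForm_adjoint, ← h1 i, ← h2]

/-- Nondegenerate irreducible fixed points are transverse intersections of the graph with the
diagonal. -/
theorem exists_hasLocalSign [NeZero N] (hN : 2 ≤ N) (hk : 2 ≤ k) {σ : BraidGroup k}
    {ε : Fin k → rootsOfUnity N ℂ} (hε : ∏ i, ε i = 1) {X P : RepSpace N k}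
    (hP : Diagonalizes P X) (hirr : ¬ IsReducible X) (hfix : twisted σ ε X = X)
    (hinv : ∀ ξ : su N, (∀ i, adjoint N (X i) ξ = ξ) → ξ = 0)
    (hcoh : ∀ u, braidDeriv X σ u = u → ∃ ξ, u = orbitMap X ξ) :
    ∃ s, HasLocalSign (graphMap σ ε) X s := by
  have hspanX := fun v => mem_span_qFrame hP v
  have hJ := untriv_injective X
  set b := Module.finBasis ℝ (su N) with hb
  have hoinj : Function.Injective (orbitMap X) := by
    rw [← LinearMap.ker_eq_bot, LinearMap.ker_eq_bot']
    exact fun ξ h => hinv ξ fun i => (sub_eq_zero.1 (congrFun h i)).symm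
  have ho : LinearIndependent ℝ (orbitFrame X) := by
    rw [show orbitFrame X = (untriv X ∘ₗ orbitMap X) ∘ b from funext (orbitFrame_eq X)]
    exact b.linearIndependent.map' _ (LinearMap.ker_eq_bot.2 (hJ.comp hoinj))
  -- The vectors `p` represent a positive basis of the tangent space of the quotient of `Q N k`.
  obtain ⟨m, p, hm, hpF, hind, hrel⟩ := exists_positive_extension (linearIndependent_qFrame P) ho
    (fun j => (hspanX _).2 ⟨_, orbitMap_mem X _, orbitFrame_eq X j⟩) (finrank_su_lt hN hk)
  choose q hq hpq using fun i => (hspanX _).1 (hpF i)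
  obtain rfl : p = fun i => untriv X (q i) := funext hpq
  choose z hz hzb using exists_foxDeriv_prodWord_eq (X := X) hinv
  have hq_ind : LinearIndependent ℝ (Fin.append q fun j => orbitMap X (b j)) := by
    have e : Fin.append (fun i => untriv X (q i)) (orbitFrame X) =
        untriv X ∘ Fin.append q fun j => orbitMap X (b j) := by
      funext i
      induction i using Fin.addCases with
      | left i => simp
      | right j => simp [orbitFrame_eq, hb]
    rw [e] at hind
    exact LinearIndependent.of_comp _ hind
  have htot := linearIndependent_transverse (untriv X) hJ (foxDeriv X (prodWord k))
    (braidDeriv X σ) (orbitMap X) (tangentQ X) (foxDeriv_prodWord_braidDeriv hε hfix)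
    (fun u _ h => hcoh u h) b.linearIndependent b.span_eq (fun j => hzb (b j)) hq hq_ind
  simp only [hb, ← orbitFrame_eq] at htot
  rw [← hb] at htot
  have hqq : ∀ {u v}, u ∈ tangentQ X → v ∈ tangentQ X →
      (untriv X u, untriv X v) ∈ Submodule.span ℝ (Set.range (qqFrame P)) := fun hu hv =>
    mem_span_pair_append ((hspanX _).2 ⟨_, hu, rfl⟩) ((hspanX _).2 ⟨_, hv, rfl⟩)
  have hO : ∀ j, (orbitFrame X j, orbitFrame X j) ∈
      Submodule.span ℝ (Set.range (qqFrame P)) := by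
    intro j
    rw [orbitFrame_eq]
    exact hqq (orbitMap_mem X _) (orbitMap_mem X _)
  obtain ⟨s, hs, hrel2⟩ := exists_relOrientation (F := qqFrame P) (by omega) htot (by
    intro i
    induction i using Fin.addCases with
    | left j =>
      rw [Fin.append_left, ← map_zero (untriv X)]
      exact hqq (hz _) (Submodule.zero_mem _)
    | right i =>
      rw [Fin.append_right]
      induction i using Fin.addCases with
      | left i =>
        rw [Fin.append_left]
        induction i using Fin.addCases with
        | left i => rw [Fin.append_left]; exact hqq (hq i) (hq i)
        | right i => rw [Fin.append_right]; exact hqq (hq i) (braidDeriv_mem hfix (hq i))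
      | right j => rw [Fin.append_right]; exact hO j)
  have hXQ : X ∈ Qstar N k := ⟨⟨P, hP⟩, hirr⟩
  -- The graph and the diagonal meet at (X, X), so the same basis serves for both. The lifts of
  -- su(N) are taken in the first factor only.
  refine ⟨s, hs, X, ⟨hXQ, hXQ, ?_⟩, P, P, hP, hP, m, fun i => untriv X (q i),
    fun i => untriv X (q i), fun i => (untriv X (q i), untriv X (braidDeriv X σ (q i))),
    fun j => (untriv X (z (b j)), 0), hrel, hrel, fun i => ?_, fun j => ?_, hrel2⟩
  · rw [graphMap, hfix]
  · obtain ⟨c, hcQ, hc0, hc⟩ := exists_curve_Q hP (hq i)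
    refine ⟨c, hcQ, hc0, hasDerivAt_coe hc, hasDerivAt_amb_prodMk (hasDerivAt_coe hc) ?_⟩
    refine hasDerivAt_amb_iff.2 fun l => ?_
    have h1 := hasDerivAt_mat_mul (hasDerivAt_const_mat (scalarSU (ε l) : Mat N) 0)
      (hasDerivAt_lift' hc0 hc (wordOf σ l))
    have h2 : untriv X (braidDeriv X σ (q i)) l =
        0 * (FreeGroup.lift (c 0) (wordOf σ l) : Mat N) + (scalarSU (ε l) : Mat N) *
          ((foxDeriv X (wordOf σ l) (q i) : Mat N) * (FreeGroup.lift X (wordOf σ l) : Mat N)) := by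
      have h3 : (X l : Mat N) = (scalarSU (ε l) : Mat N) *
          (FreeGroup.lift X (wordOf σ l) : Mat N) :=
        congrArg Subtype.val (congrFun hfix l).symm
      change (foxDeriv X (wordOf σ l) (q i) : Mat N) * (X l : Mat N) = _
      rw [h3, zero_mul, zero_add]
      simp [scalarSU, scalarMat]
    rw [h2]
    exact h1
  · obtain ⟨c, hcQ, hc0, hc⟩ := exists_curve_Q hP (hz (b j))
    refine ⟨fun t => (c t, X), fun t => ⟨hcQ t, P, hP⟩, Prod.ext hc0 rfl,
      hasDerivAt_amb_prodMk (hasDerivAt_coe hc) (hasDerivAt_const_amb (coe X) 0), ?_⟩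
    have h1 := hasDerivAt_mat_mul (hasDerivAt_lift' hc0 hc (prodWord k))
      (hasDerivAt_const_mat (((tupleProd X)⁻¹ : SU N) : Mat N) 0)
    rw [hzb, lift_prodWord, mul_zero, add_zero, mul_assoc] at h1
    simp only [lift_prodWord] at h1
    have h2 : ((List.ofFn X).prod : Mat N) * (((tupleProd X)⁻¹ : SU N) : Mat N) = 1 :=
      SU.coe_mul_inv_eq (tupleProd X)
    rw [h2, mul_one] at h1
    exact h1

/-- Tuples with central centralizer are irreducible. -/
lemma not_isReducible_of_centralizer [NeZero N] {ι : Type} {X : ι → SU N}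
    (h : ∀ g : SU N, (∀ i, g * X i = X i * g) → ∃ ζ : rootsOfUnity N ℂ, g = scalarSU ζ) :
    ¬ IsReducible X := by
  rintro ⟨P, N₁, h0, hlt, hP⟩
  -- The diagonal matrix with opposite signs on the two blocks commutes with every block diagonal
  -- matrix but is not scalar.
  set e : Fin N → ℂ := fun a => if (a : ℕ) < N₁ then 1 else -1 with he
  have hD : star (diagonal e) * diagonal e = (1 : Mat N) := by
    rw [star_eq_conjTranspose, diagonal_conjTranspose, diagonal_mul_diagonal, ← diagonal_one]
    congr 1
    funext a
    simp only [Pi.star_apply, he]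
    split_ifs <;> simp
  obtain ⟨c, hc, hcD⟩ := exists_smul_mem_SU hD
  set D : SU N := ⟨c • diagonal e, hcD⟩ with hDdef
  have hcomm : ∀ i, D * (P * X i * P⁻¹) = (P * X i * P⁻¹) * D := by
    intro i
    apply Subtype.ext
    change (c • diagonal e) * ((P * X i * P⁻¹ : SU N) : Mat N) =
      ((P * X i * P⁻¹ : SU N) : Mat N) * (c • diagonal e)
    rw [smul_mul_assoc, mul_smul_comm]
    congr 1
    ext a b
    rw [diagonal_mul, mul_diagonal]
    by_cases hab : ((a : ℕ) < N₁ ↔ (b : ℕ) < N₁)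
    · have : e a = e b := by simp only [he, hab]
      rw [this, mul_comm]
    · rw [hP i a b hab]; simp
  obtain ⟨ζ, hζ⟩ := h (P⁻¹ * D * P) fun i => by
    have := congrArg (fun t => P⁻¹ * t * P) (hcomm i)
    simpa [mul_assoc] using this
  have hDζ : D = scalarSU ζ := by
    have : D = P * (P⁻¹ * D * P) * P⁻¹ := by group
    rw [this, hζ, ← scalarSU_central, mul_inv_cancel_right]
  have hent : ∀ a, c * e a = ((ζ : ℂˣ) : ℂ) := by
    intro a
    have := congrFun (congrFun (congrArg Subtype.val hDζ) a) a
    simpa [hDdef, scalarSU, scalarMat] using this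
  have h1 := hent ⟨0, by omega⟩
  have h2 := hent ⟨N₁, hlt⟩
  simp only [he, h0, if_true, lt_irrefl, if_false, mul_one] at h1 h2
  have h3 : c = 0 := by linear_combination (h1 - h2) / 2
  exact hc h3

end Transversality

/-! ### Fixed points forming a single nondegenerate orbit -/

section FixedPoints

variable {N k : ℕ}

lemma conj_mem_overClass (g t : AffAd N) (ht : t ∈ overClass N) : g * t * g⁻¹ ∈ overClass N := by
  obtain ⟨P, hP⟩ := ht
  refine ⟨g.lin * P, ?_⟩
  have h : ((g * t * g⁻¹).lin : Mat N) =
      (g.lin : Mat N) * (t.lin : Mat N) * ((g.lin⁻¹ : SU N) : Mat N) := rfl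
  rw [h, hP, mul_inv_rev]
  change _ = ((g.lin : Mat N) * (P : Mat N)) * matA N *
    (((P⁻¹ : SU N) : Mat N) * ((g.lin⁻¹ : SU N) : Mat N))
  simp only [mul_assoc]

/-- The conjugacy class of `matA N` is stable under multiplication by the centre. -/
lemma central_mul_mem_overClass [NeZero N] (ζ : rootsOfUnity N ℂ) (t : AffAd N)
    (ht : t ∈ overClass N) :
    affCentral N ζ * t ∈ overClass N := by
  obtain ⟨P, hP⟩ := ht
  have hω := Complex.isPrimitiveRoot_exp N (NeZero.ne N)
  obtain ⟨X, Y, hXY⟩ := exists_pair hω.pow_eq_one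
  obtain ⟨R, hR⟩ := exists_conj_matA hω hXY
  -- Multiplying X by a central element does not change the relation with Y. So X and its central
  -- multiple are both conjugate to `matA N`, hence to each other.
  have hζX : ((scalarSU ζ * X : SU N) : Mat N) * Y =
      Complex.exp (2 * Real.pi * Complex.I / N) •
        ((Y : Mat N) * ((scalarSU ζ * X : SU N) : Mat N)) := by
    have h : ((scalarSU ζ * X : SU N) : Mat N) = ((ζ : ℂˣ) : ℂ) • (X : Mat N) := by
      simp [scalarSU, scalarMat]
    rw [h, smul_mul_assoc, hXY, mul_smul_comm, smul_comm]
  obtain ⟨S, hS⟩ := exists_conj_matA hω hζX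
  let A : SU N := ⟨matA N, matA_mem N⟩
  have e1 : t.lin = P * A * P⁻¹ := Subtype.ext hP
  have e2 : X = R * A * R⁻¹ := Subtype.ext hR
  have e3 : scalarSU ζ * X = S * A * S⁻¹ := Subtype.ext hS
  refine ⟨P * R⁻¹ * S, congrArg Subtype.val
    (show scalarSU ζ * t.lin = P * R⁻¹ * S * A * (P * R⁻¹ * S)⁻¹ from ?_)⟩
  have e4 : t.lin = P * R⁻¹ * X * R * P⁻¹ := by rw [e1, e2]; group
  calc scalarSU ζ * t.lin = P * R⁻¹ * (scalarSU ζ * X) * R * P⁻¹ := by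
        rw [e4, ← mul_assoc, ← mul_assoc, ← mul_assoc, ← mul_assoc, scalarSU_central,
          ← mul_assoc]
        simp only [mul_assoc, scalarSU_central]
    _ = _ := by rw [e3]; group

lemma mem_fixedSet_iff [NeZero N] {σ : BraidGroup k} {ε : Fin k → rootsOfUnity N ℂ}
    {X : RepSpace N k} :
    X ∈ fixedSet σ ε ↔ X ∈ twistedFix (scalarHom N) σ ε := funext_iff

/-- The dictionary between group theory in the tangent group and nondegeneracy of fixed points: the
two parts of the equation are the fixed point equation and its linearization. -/
lemma affTuple_mem_twistedFix_iff [NeZero N] {σ : BraidGroup k} {ε : Fin k → rootsOfUnity N ℂ}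
    {X : RepSpace N k} {u : Fin k → su N} :
    affTuple u X ∈ twistedFix (affCentral N) σ ε ↔
      X ∈ fixedSet σ ε ∧ braidDeriv X σ u = u := by
  have h : ∀ i, affCentral N (ε i) * braidMap σ (affTuple u X) i = affTuple u X i ↔
      twisted σ ε X i = X i ∧ braidDeriv X σ u i = u i := by
    intro i
    have hv : (affCentral N (ε i) * braidMap σ (affTuple u X) i).vec = braidDeriv X σ u i := by
      change 0 + adjoint N (scalarSU (ε i)) _ = _
      rw [adjoint_scalarSU, zero_add]
      exact vec_lift_affTuple u X (wordOf σ i)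
    have hl : (affCentral N (ε i) * braidMap σ (affTuple u X) i).lin = twisted σ ε X i := by
      change scalarSU (ε i) * (FreeGroup.lift (affTuple u X) (wordOf σ i)).lin = _
      rw [lin_lift_affTuple]
      rfl
    rw [AffAd.ext_iff, hv, hl, and_comm]
    rfl
  rw [fixedSet, Set.mem_ofPred_eq, funext_iff, funext_iff, ← forall_and]
  exact forall_congr' h

/-- The fixed points form a single orbit of irreducible nondegenerate points of the conjugacy
class. -/
structure IsNondegenerateOrbit [NeZero N] (σ : BraidGroup k) (ε : Fin k → rootsOfUnity N ℂ)
    (X : RepSpace N k) : Prop where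
  orbit : fixedSet σ ε = {Y | ∃ U : SU N, ∀ i, Y i = U * X i * U⁻¹}
  diagonalizes : ∀ Y ∈ fixedSet σ ε, ∃ P, Diagonalizes P Y
  irreducible : ∀ Y ∈ fixedSet σ ε, ¬ IsReducible Y
  invariants : ∀ Y ∈ fixedSet σ ε, ∀ ξ : su N, (∀ i, adjoint N (Y i) ξ = ξ) → ξ = 0
  coboundary : ∀ Y ∈ fixedSet σ ε, ∀ u, braidDeriv Y σ u = u → ∃ ξ, u = orbitMap Y ξ

/-- Restricting to zero vectors gives the orbit and membership in the class. Central centralizers,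
tested on elements of SU(N) and of su(N), give irreducibility and the absence of invariants.
Comparing (0, Y) with (u, Y) in the same orbit gives nondegeneracy. -/
lemma IsSingleOrbit.exists_isNondegenerateOrbit [NeZero N] {σ : BraidGroup k}
    {ε : Fin k → rootsOfUnity N ℂ} (h : IsSingleOrbit (affCentral N) (overClass N) σ ε) :
    ∃ X, IsNondegenerateOrbit σ ε X := by
  obtain ⟨t, ht, horb, hC, hcent⟩ := h
  have ht' : affTuple (fun i => (t i).vec) (fun i => (t i).lin) ∈
      twistedFix (affCentral N) σ ε := ht
  have hX := (affTuple_mem_twistedFix_iff.1 ht').1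
  have hemb : ∀ Y ∈ fixedSet σ ε, affTuple 0 Y ∈ twistedFix (affCentral N) σ ε :=
    fun Y hY => affTuple_mem_twistedFix_iff.2 ⟨hY, map_zero _⟩
  have hcent' : ∀ s ∈ twistedFix (affCentral N) σ ε, ∀ g, conjTuple g s = s →
      g ∈ Set.range (affCentral N) := by
    intro s hs g hg
    obtain ⟨a, rfl⟩ := horb s hs
    obtain ⟨ζ, hζ⟩ := hcent (a⁻¹ * g * a) (by
      funext i
      have := congrArg (fun x => a⁻¹ * x * a) (congrFun hg i)
      simpa [conjTuple, mul_assoc] using this)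
    refine ⟨ζ, ?_⟩
    have : g = a * (a⁻¹ * g * a) * a⁻¹ := by group
    rw [this, ← hζ, ← affCentral_central, mul_inv_cancel_right]
  refine ⟨fun i => (t i).lin, ?_, fun Y hY => ?_, fun Y hY => ?_, fun Y hY ξ hξ => ?_,
    fun Y hY u hu => ?_⟩
  · ext Y
    constructor
    · intro hY
      obtain ⟨g, hg⟩ := horb _ (hemb Y hY)
      exact ⟨g.lin, fun i => congrArg AffAd.lin (congrFun hg i)⟩
    · rintro ⟨U, hU⟩
      rw [show Y = conjTuple U _ from funext hU, mem_fixedSet_iff]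
      exact conjTuple_mem_twistedFix scalarSU_central U (mem_fixedSet_iff.1 hX)
  · obtain ⟨g, hg⟩ := horb _ (hemb Y hY)
    have : ∀ i, ∃ P : SU N, (Y i : Mat N) = (P : Mat N) * matA N * ((P⁻¹ : SU N) : Mat N) := by
      intro i
      have h1 := conj_mem_overClass g _ (hC i)
      rw [show g * t i * g⁻¹ = affTuple 0 Y i from (congrFun hg i).symm] at h1
      exact h1
    choose P hP using this
    exact ⟨P, hP⟩
  · refine not_isReducible_of_centralizer fun g hg => ?_
    obtain ⟨ζ, hζ⟩ := hcent' _ (hemb Y hY) (AffAd.ofLin g) (by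
      funext i
      have : AffAd.ofLin g * AffAd.ofLin (Y i) = AffAd.ofLin (Y i) * AffAd.ofLin g := by
        rw [← map_mul, hg i, map_mul]
      exact mul_inv_eq_iff_eq_mul.2 this)
    exact ⟨ζ, (congrArg AffAd.lin hζ).symm⟩
  · obtain ⟨ζ, hζ⟩ := hcent' _ (hemb Y hY) ⟨ξ, 1⟩ (by
      funext i
      refine mul_inv_eq_iff_eq_mul.2 (AffAd.ext ?_ ?_)
      · simp [affTuple, hξ i]
      · simp)
    exact (congrArg AffAd.vec hζ).symm
  · obtain ⟨g, hg⟩ := horb _ (hemb Y hY)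
    obtain ⟨g', hg'⟩ := horb _ (affTuple_mem_twistedFix_iff.2 ⟨hY, hu⟩)
    have hc : affTuple u Y = conjTuple (g' * g⁻¹) (affTuple 0 Y) := by
      rw [hg', hg]; funext i; simp [conjTuple, mul_assoc]
    -- This element carries (0, Y) to (u, Y), so its SU(N) part centralizes Y and its vector part
    -- generates u.
    set a := g' * g⁻¹ with ha
    have hlin : ∀ i, Y i = a.lin * Y i * a.lin⁻¹ := fun i => congrArg AffAd.lin (congrFun hc i)
    refine ⟨a.vec, funext fun i => ?_⟩
    have h1 := congrArg AffAd.vec (congrFun hc i)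
    simp only [conjTuple, affTuple, AffAd.vec_mul, AffAd.lin_mul, AffAd.vec_inv,
      Pi.zero_apply, map_zero, add_zero, map_neg] at h1
    rw [orbitMap_apply, h1, sub_eq_add_neg]
    congr 2
    rw [← Module.End.mul_apply, ← map_mul, ← hlin i]

lemma localSign_eq_of_hasLocalSign {g : RepSpace N k → Amb N k × Amb N k} {X : RepSpace N k}
    (h : ∃ s, HasLocalSign g X s) : localSign g X = 1 ∨ localSign g X = -1 := by
  rw [localSign]
  split_ifs with h1 h2
  · exact Or.inl rfl
  · exact Or.inr rfl
  · obtain ⟨s, hs⟩ := h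
    cases s with
    | zero => exact absurd rfl hs.1
    | neg => exact absurd hs h2
    | pos => exact absurd hs h1

lemma mk_eq_mk_iff {X Y : RepSpace N k} :
    (Quotient.mk'' X : OrbitSpace N k) = Quotient.mk'' Y ↔
      ∃ U : SU N, ∀ i, X i = U * Y i * U⁻¹ := by
  rw [Quotient.eq'', MulAction.orbitRel_apply, MulAction.mem_orbit_iff]
  constructor
  · rintro ⟨g, rfl⟩
    exact ⟨ConjAct.ofConjAct g, fun i => ConjAct.smul_def g (Y i)⟩
  · rintro ⟨U, hU⟩
    exact ⟨ConjAct.toConjAct U, funext fun i => (hU i).symm⟩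

lemma coe_injective : Function.Injective (coe : RepSpace N k → Amb N k) := fun _ _ h =>
  funext fun i => Subtype.ext (congrFun h i)

/-- The Casson-Lin number is a sign if the fixed points form a single nondegenerate orbit. -/
lemma IsNondegenerateOrbit.cassonLin_eq [NeZero N] {σ : BraidGroup k} {ε : Fin k → rootsOfUnity N ℂ}
    {X : RepSpace N k} (h : IsNondegenerateOrbit σ ε X) (hN : 2 ≤ N) (hk : 2 ≤ k)
    (hε : ∏ i, ε i = 1) : cassonLin σ ε = 1 ∨ cassonLin σ ε = -1 := by
  have hsign : ∀ Y ∈ fixedSet σ ε,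
      localSign (graphMap σ ε) Y = 1 ∨ localSign (graphMap σ ε) Y = -1 := by
    intro Y hY
    obtain ⟨P, hP⟩ := h.diagonalizes Y hY
    exact localSign_eq_of_hasLocalSign (exists_hasLocalSign hN hk hε hP (h.irreducible Y hY) hY
      (h.invariants Y hY) (h.coboundary Y hY))
  have hmeets : ∀ Y Z, Meets (graphMap σ ε) Y Z → Y ∈ fixedSet σ ε := by
    rintro Y Z ⟨-, -, hYZ⟩
    have h1 : Y = Z := coe_injective (congrArg Prod.fst hYZ)
    have h2 : twisted σ ε Y = Z := coe_injective (congrArg Prod.snd hYZ)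
    exact h2.trans h1.symm
  have hmk : ∀ Y ∈ fixedSet σ ε, (Quotient.mk'' Y : OrbitSpace N k) = Quotient.mk'' X :=
    fun Y hY => mk_eq_mk_iff.2 (by rw [h.orbit] at hY; exact hY)
  have htrans : IsTransverse (graphMap σ ε) := by
    refine ⟨(Set.finite_singleton (Quotient.mk'' X : OrbitSpace N k)).subset ?_,
      fun Y Z hYZ => ?_⟩
    · rintro o ⟨Y, Z, hYZ, rfl⟩
      exact hmk Y (hmeets Y Z hYZ)
    · rcases hsign Y (hmeets Y Z hYZ) with h1 | h1 <;> rw [h1] <;> norm_num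
  rw [cassonLin, if_pos htrans, signedCount, finsum_eq_single _ (Quotient.mk'' X : OrbitSpace N k)]
  · refine hsign _ ?_
    rw [h.orbit]
    exact mk_eq_mk_iff.1 (Quotient.out_eq' _)
  · intro o ho
    -- Away from the fixed orbit there is no intersection, so the default value 0 of the sign
    -- applies.
    have hno : ∀ s, ¬ HasLocalSign (graphMap σ ε) o.out s := by
      rintro s ⟨-, Z, hZ, -⟩
      exact ho ((Quotient.out_eq' o).symm.trans (hmk _ (hmeets _ Z hZ)))
    rw [localSign, if_neg (hno 1), if_neg (hno (-1))]

end FixedPoints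

/-! ### The link group -/

section LinkGroup

variable {N k : ℕ}

lemma braidMap_meridian (σ : BraidGroup k) (i : Fin k) :
    braidMap σ (meridian σ) i = meridian σ i := by
  have h : FreeGroup.lift (meridian σ) =
      PresentedGroup.mk (Set.range fun i : Fin k => FreeGroup.of i * (wordOf σ i)⁻¹) := by
    ext j; simp [meridian, PresentedGroup.of]
  rw [braidMap, h]
  have h1 := PresentedGroup.one_of_mem
    (rels := Set.range fun i : Fin k => FreeGroup.of i * (wordOf σ i)⁻¹) ⟨i, rfl⟩
  rw [map_mul, map_inv, mul_inv_eq_one] at h1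
  exact h1.symm

lemma commute_meridian_hopf :
    meridian hopfBraid 0 * meridian hopfBraid 1 = meridian hopfBraid 1 * meridian hopfBraid 0 := by
  have h := braidMap_meridian hopfBraid 0
  rw [(braidMap_hopf _).1, mul_assoc, inv_mul_eq_iff_eq_mul] at h
  exact h

lemma linkGroup_induction (σ : BraidGroup k) {p : LinkGroup σ → Prop} (one : p 1)
    (gen : ∀ i, p (meridian σ i)) (mul : ∀ g h, p g → p h → p (g * h))
    (inv : ∀ g, p g → p g⁻¹) (g : LinkGroup σ) : p g := by
  have h : g ∈ Subgroup.closure (Set.range (PresentedGroup.of : Fin k → LinkGroup σ)) := by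
    rw [PresentedGroup.closure_range_of]; trivial
  induction h using Subgroup.closure_induction with
  | mem x hx => obtain ⟨i, rfl⟩ := hx; exact gen i
  | one => exact one
  | mul x y _ _ hx hy => exact mul x y hx hy
  | inv x _ hx => exact inv x hx

instance scalarHom_range_normal [NeZero N] : (scalarHom N).range.Normal := by
  refine ⟨?_⟩
  rintro _ ⟨ζ, rfl⟩ g
  exact ⟨ζ, by rw [scalarHom_apply, ← scalarSU_central, mul_inv_cancel_right]⟩

/-- Fixed points whose entries are distinct modulo the centre come from projective representations
of the link group. -/
lemma exists_projRep [NeZero N] {σ : BraidGroup k} {ε : Fin k → rootsOfUnity N ℂ}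
    {X : RepSpace N k} (hX : X ∈ fixedSet σ ε)
    (hinj : ∀ i j, (∃ ζ : rootsOfUnity N ℂ, X i = scalarSU ζ * X j) → i = j) :
    ∃ ρ : ProjRep (LinkGroup σ) N, ∀ i, ρ.toFun (meridian σ i) = X i := by
  classical
  let q := QuotientGroup.mk' (scalarHom N).range
  have hq : ∀ ζ, q (scalarSU ζ) = 1 := fun ζ =>
    (QuotientGroup.eq_one_iff _).2 ⟨ζ, rfl⟩
  have hrel : ∀ r ∈ Set.range (fun i : Fin k => FreeGroup.of i * (wordOf σ i)⁻¹),
      FreeGroup.lift (fun i => q (X i)) r = 1 := by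
    rintro _ ⟨i, rfl⟩
    rw [map_mul, map_inv, mul_inv_eq_one, FreeGroup.lift_apply_of, ← map_lift]
    have h1 : scalarSU (ε i) * FreeGroup.lift X (wordOf σ i) = X i := congrFun hX i
    rw [← h1, map_mul, hq, one_mul]
  let φ : LinkGroup σ →* _ := PresentedGroup.toGroup hrel
  have hφ : ∀ i, φ (meridian σ i) = q (X i) := fun i => PresentedGroup.toGroup.of hrel
  have hmem : ∀ g, q g = 1 → ∃ ζ : rootsOfUnity N ℂ, g = scalarSU ζ := by
    intro g hg
    obtain ⟨ζ, hζ⟩ := (QuotientGroup.eq_one_iff g).1 hg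
    exact ⟨ζ, hζ.symm⟩
  -- A set-theoretic lift of the homomorphism to SU(N) modulo its centre, prescribed on meridians.
  -- `hinj` ensures that the prescription is consistent, should two meridians coincide in the group.
  let f : LinkGroup σ → SU N := fun g =>
    if h : ∃ i, meridian σ i = g then X h.choose else (φ g).out
  have hqf : ∀ g, q (f g) = φ g := by
    intro g
    by_cases h : ∃ i, meridian σ i = g
    · simp only [f, dif_pos h]
      rw [← hφ, h.choose_spec]
    · simp only [f, dif_neg h]
      exact Quotient.out_eq' (φ g)
  refine ⟨⟨f, fun g h => hmem _ ?_⟩, fun i => ?_⟩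
  · rw [map_mul, map_mul, map_inv, map_inv, hqf, hqf, hqf, map_mul, mul_inv_cancel_right,
      mul_inv_cancel]
  · have h : ∃ j, meridian σ j = meridian σ i := ⟨i, rfl⟩
    simp only [f, dif_pos h]
    congr 1
    refine hinj _ _ ?_
    have h1 : q (X h.choose) = q (X i) := by rw [← hφ, ← hφ, h.choose_spec]
    obtain ⟨ζ, hζ⟩ := hmem (X h.choose * (X i)⁻¹) (by rw [map_mul, map_inv, h1, mul_inv_cancel])
    exact ⟨ζ, by rw [← hζ, inv_mul_cancel_right]⟩

/-- The meridians commute, which imposes on the two meridional values of a cocycle the relation of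
`exists_coboundary_pair`. A cocycle agreeing with a coboundary on generators agrees with it
everywhere. -/
lemma subsingleton_H1_hopf [NeZero N] {ζ : ℂ} (hζ : IsPrimitiveRoot ζ N)
    (ρ : ProjRep (LinkGroup hopfBraid) N)
    (h : (ρ.toFun (meridian hopfBraid 0) : Mat N) * ρ.toFun (meridian hopfBraid 1) =
      ζ • ((ρ.toFun (meridian hopfBraid 1) : Mat N) * ρ.toFun (meridian hopfBraid 0))) :
    Subsingleton (groupCohomology.H1 (Rep.of ρ.ad)) := by
  refine subsingleton_of_forall_eq 0 fun a => ?_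
  induction a using groupCohomology.H1_induction_on with
  | h f =>
    rw [groupCohomology.H1π_eq_zero_iff]
    have hf := (groupCohomology.mem_cocycles₁_iff (f : LinkGroup hopfBraid → su N)).1 f.2
    have hf' : ∀ x y, (f (x * y) : su N) = adjoint N (ρ.toFun x) (f y) + f x := hf
    have hc := congrArg f commute_meridian_hopf
    rw [hf', hf'] at hc
    obtain ⟨ξ, h0, h1⟩ := exists_coboundary_pair hζ h (u := f (meridian hopfBraid 0))
      (v := f (meridian hopfBraid 1)) (by rw [add_comm, hc, add_comm])
    have hall : ∀ g, (f g : su N) = ξ - ρ.ad g ξ := by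
      intro g
      induction g using linkGroup_induction with
      | one =>
        have h2 := hf' 1 1
        have h3 : adjoint N (ρ.toFun 1) = 1 := map_one ρ.ad
        rw [mul_one, h3] at h2
        have h4 : (f 1 : su N) = 0 := by
          have h5 : (f 1 : su N) = f 1 + f 1 := h2
          exact left_eq_add.1 h5
        rw [h4, map_one]
        exact (sub_self ξ).symm
      | gen i => fin_cases i <;> assumption
      | mul x y hx hy =>
        rw [hf', hx, hy, map_mul]
        change ρ.ad x (ξ - ρ.ad y ξ) + (ξ - ρ.ad x ξ) = ξ - ρ.ad x (ρ.ad y ξ)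
        rw [map_sub]
        abel
      | inv x hx =>
        have h2 := hf' x⁻¹ x
        have h3 := hf' 1 1
        have h4 : adjoint N (ρ.toFun 1) = 1 := map_one ρ.ad
        rw [mul_one, h4] at h3
        have h5 : (f 1 : su N) = 0 := by
          have h6 : (f 1 : su N) = f 1 + f 1 := h3
          exact left_eq_add.1 h6
        rw [inv_mul_cancel, h5, hx] at h2
        have h7 : (f x⁻¹ : su N) = -(ρ.ad x⁻¹ (ξ - ρ.ad x ξ)) :=
          (neg_eq_of_add_eq_zero_right h2.symm).symm
        rw [h7, map_sub, ← Module.End.mul_apply, ← map_mul, inv_mul_cancel, map_one,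
          Module.End.one_apply, neg_sub]
    -- The sign reconciles ξ - Ad(g)ξ with the convention ρ(g)x - x for coboundaries.
    refine ⟨-ξ, funext fun g => ?_⟩
    change ρ.ad g (-ξ) - -ξ = f g
    rw [hall g, map_neg]
    abel

end LinkGroup

end CassonLin

end

/-! ### The theorem on the Hopf link. -/

theorem mainTheorem3 (N d : ℕ) [NeZero N] (hd : 1 ≤ d) (hdN : d < N) (hcop : Nat.Coprime d N) :
    -- the invariant of the Hopf link, computed from any braid whose closure is the Hopf link, any
    -- numbering of its components and any compatible tuple
    (∀ (k : ℕ) (σ : CassonLin.BraidGroup k), CassonLin.SameClosure σ CassonLin.hopfBraid →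
      ∀ comp : Fin k → Fin 2, CassonLin.IsComponentNumbering σ comp →
      ∀ ε : Fin k → rootsOfUnity N ℂ,
        CassonLin.Compatible ![(d : ℤ), (N : ℤ) - d] comp ε →
        CassonLin.cassonLin σ ε = 1 ∨ CassonLin.cassonLin σ ε = -1) ∧
    -- the fixed points, for the two orders of the labels
    CassonLin.fixedSet CassonLin.hopfBraid ![CassonLin.omega N ^ d, CassonLin.omega N ^ (N - d)] =
      {X | X 0 * X 1 * (X 0)⁻¹ * (X 1)⁻¹ = CassonLin.scalarSU (CassonLin.omega N ^ (-(d : ℤ)))} ∧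
    CassonLin.fixedSet CassonLin.hopfBraid ![CassonLin.omega N ^ (N - d), CassonLin.omega N ^ d] =
      {X | X 0 * X 1 * (X 0)⁻¹ * (X 1)⁻¹ = CassonLin.scalarSU (CassonLin.omega N ^ d)} ∧
    ∀ ε : Fin 2 → rootsOfUnity N ℂ,
      (ε = ![CassonLin.omega N ^ d, CassonLin.omega N ^ (N - d)] ∨
        ε = ![CassonLin.omega N ^ (N - d), CassonLin.omega N ^ d]) →
      -- they are irreducible and form a single conjugacy class
      (∃ X : CassonLin.RepSpace N 2, ¬ CassonLin.IsReducible X ∧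
        CassonLin.fixedSet CassonLin.hopfBraid ε =
          {Y | ∃ U : CassonLin.SU N, ∀ i, Y i = U * X i * U⁻¹}) ∧
      -- they come from projective representations of the link group
      (∀ X ∈ CassonLin.fixedSet CassonLin.hopfBraid ε,
        ∃ ρ : CassonLin.ProjRep (CassonLin.LinkGroup CassonLin.hopfBraid) N,
          ∀ i, ρ.toFun (CassonLin.meridian CassonLin.hopfBraid i) = X i) ∧
      -- they are nondegenerate
      (∀ ρ : CassonLin.ProjRep (CassonLin.LinkGroup CassonLin.hopfBraid) N,
        (fun i => ρ.toFun (CassonLin.meridian CassonLin.hopfBraid i)) ∈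
          CassonLin.fixedSet CassonLin.hopfBraid ε →
        Subsingleton (groupCohomology.H1 (Rep.of ρ.ad))) := by

  have hN : 2 ≤ N := by omega
  have hω1 : CassonLin.omega N ^ N = 1 := by
    apply Subtype.ext
    exact (mem_rootsOfUnity N _).1 (CassonLin.omega N).2
  have hmul : CassonLin.omega N ^ d * CassonLin.omega N ^ (N - d) = 1 := by
    rw [← pow_add, Nat.add_sub_cancel' hdN.le, hω1]
  have hp1 := CassonLin.primitive_of_coprime hcop
  have hp2 := CassonLin.primitive_of_coprime (N := N) (d := N - d)
    ((Nat.coprime_self_sub_left hdN.le).2 hcop)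
  have hfix : ∀ (ε : Fin 2 → rootsOfUnity N ℂ), ε 0 * ε 1 = 1 →
      ∀ X : CassonLin.RepSpace N 2, X ∈ CassonLin.fixedSet CassonLin.hopfBraid ε ↔
        X 0 * X 1 = CassonLin.scalarSU (ε 1) * (X 1 * X 0) := fun ε hε X =>
    CassonLin.mem_fixedSet_iff.trans
      (CassonLin.mem_twistedFix_hopf _ CassonLin.scalarSU_central hε X)
  have hfix' : ∀ (ε : Fin 2 → rootsOfUnity N ℂ), ε 0 * ε 1 = 1 →
      CassonLin.fixedSet CassonLin.hopfBraid ε =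
        {X | X 0 * X 1 * (X 0)⁻¹ * (X 1)⁻¹ = CassonLin.scalarSU (ε 1)} := by
    intro ε hε
    ext X
    rw [hfix ε hε, Set.mem_ofPred_eq, mul_inv_eq_iff_eq_mul, mul_inv_eq_iff_eq_mul, mul_assoc]
  refine ⟨?_, ?_, ?_, ?_⟩
  · intro k σ hσ comp hcomp ε hε
    have hz : ∀ j, CassonLin.omega N ^ (![(d : ℤ), (N : ℤ) - d] j) =
        ![CassonLin.omega N ^ d, CassonLin.omega N ^ (N - d)] j := by
      intro j
      fin_cases j
      · simp
      · simp [← Nat.cast_sub hdN.le]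
    have hprod : ∏ i, ε i = 1 := by
      rw [← Finset.prod_fiberwise _ comp, Finset.prod_congr rfl fun j _ => (hε j).trans (hz j),
        Fin.prod_univ_two]
      exact hmul
    have hk : 2 ≤ k := by
      simpa using Fintype.card_le_of_surjective comp hcomp.surjective
    have hbase : CassonLin.HasSingleOrbits (CassonLin.affCentral N) (CassonLin.overClass N)
        ![CassonLin.omega N ^ d, CassonLin.omega N ^ (N - d)] CassonLin.hopfBraid :=
      CassonLin.hasSingleOrbits_hopf hmul fun j => by
        fin_cases j
        · exact hp1
        · exact hp2
    have hall := (CassonLin.hasSingleOrbits_iff_of_sameClosure CassonLin.affCentral_central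
      CassonLin.central_mul_mem_overClass CassonLin.conj_mem_overClass hσ).2 hbase
    obtain ⟨X, hX⟩ := (hall comp hcomp ε
      fun j => (hε j).trans (hz j)).exists_isNondegenerateOrbit
    exact hX.cassonLin_eq hN hk hprod
  · rw [hfix' _ hmul]
    have : CassonLin.omega N ^ (-(d : ℤ)) = CassonLin.omega N ^ (N - d) := by
      rw [zpow_neg, zpow_natCast]
      exact inv_eq_of_mul_eq_one_right hmul
    rw [this]
    rfl
  · rw [hfix' _ ((mul_comm _ _).trans hmul)]
    rfl
  · intro ε hε
    obtain ⟨hε1, hprim⟩ : ε 0 * ε 1 = 1 ∧ IsPrimitiveRoot ((ε 1 : ℂˣ) : ℂ) N := by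
      rcases hε with rfl | rfl
      · exact ⟨hmul, hp2⟩
      · exact ⟨(mul_comm _ _).trans hmul, hp1⟩
    obtain ⟨X, hX⟩ := (CassonLin.isSingleOrbit_hopf hε1 hprim).exists_isNondegenerateOrbit
    have hXmem : X ∈ CassonLin.fixedSet CassonLin.hopfBraid ε := by
      rw [hX.orbit]
      exact ⟨1, fun i => by simp⟩
    refine ⟨⟨X, hX.irreducible X hXmem, hX.orbit⟩, fun Y hY => ?_, fun ρ hρ => ?_⟩
    · refine CassonLin.exists_projRep hY ?_
      have hYc := (hfix ε hε1 Y).1 hY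
      -- The entries do not commute because a primitive root with N ≥ 2 is not 1; hence neither is a
      -- central multiple of the other, as `exists_projRep` requires.
      have hne : Y 0 * Y 1 ≠ Y 1 * Y 0 := by
        intro hc
        rw [hc, right_eq_mul] at hYc
        have h1 := congrFun (congrFun (congrArg Subtype.val hYc) 0) 0
        have h2 : ((ε 1 : ℂˣ) : ℂ) = 1 := by
          simpa [CassonLin.scalarSU, CassonLin.scalarMat] using h1
        exact hprim.ne_one (by omega) h2
      have hcomm : ∀ (ζ : rootsOfUnity N ℂ) (Z : CassonLin.SU N),
          CassonLin.scalarSU ζ * Z * Z = Z * (CassonLin.scalarSU ζ * Z) := fun ζ Z => by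
        rw [mul_assoc, ← mul_assoc Z, ← CassonLin.scalarSU_central ζ Z, mul_assoc]
      intro i j
      rintro ⟨ζ, hζ⟩
      fin_cases i <;> fin_cases j
      · rfl
      · have hζ' : Y 0 = CassonLin.scalarSU ζ * Y 1 := hζ
        exact absurd (by rw [hζ', hcomm]) hne
      · have hζ' : Y 1 = CassonLin.scalarSU ζ * Y 0 := hζ
        exact absurd (by rw [hζ', hcomm]) hne
      · rfl
    · exact CassonLin.subsingleton_H1_hopf hprim ρ
        (CassonLin.coe_eq_smul_of_eq_scalarSU_mul ((hfix ε hε1 _).1 hρ))
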